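/- **Setting.** Let $\Phi\subset V$ be an irreducible reduced crystallographic root system in a finite-dimensional real vector space, with coroots $\Phi^\vee\subset V^*$, simple roots $\alpha_1,\dots,\alpha_n$, highest root $\alpha_0=\sum_i n_i\alpha_i$, fundamental coweights $\varpi_i^\vee$, Weyl group $W$ acting on $V^*$, coroot lattice $Q^\vee=\mathbb Z\Phi^\vee$ and coweight lattice $P^\vee=\{\lambda\in V^* : \langle\lambda,\alpha\rangle\in\mathbb Z\ \forall\alpha\in\Phi\}$. Let $W_a=\langle s_0,\dots,s_n\rangle$ be the affine Weyl group, where $s_i=s_{\alpha_i}$ for $i\ge1$ and $s_0(\lambda)=s_{\alpha_0}(\lambda)+\alpha_0^\vee$; for $I\subseteq S_0=\{0,\dots,n\}$ put $(W_a)_I=\langle s_i : i\in I\rangle$. Let $\mathcal A_0=\{\lambda : 0<\langle\lambda,\alpha\rangle<1\ \forall\alpha\in\Phi^+\}$ be the fundamental alcove; its closure is the simplex with vertices $v_0=0$ and $v_i=\varpi_i^\vee/n_i$. Let $Y$ be a $W$-lattice with $Q^\vee\subseteq Y\subseteq P^\vee$, let $W_Y=\mathrm t(Y)\rtimes W$ be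 the group of affine transformations of $V^*$ generated by the translations by $Y$ and by $W$ (it contains $W_a$), and let $\Omega_Y=\{\omega\in W_Y:\omega(\mathcal A_0)=\mathcal A_0\}$. The group $\Omega_Y$ permutes the $v_i$, hence acts on $S_0$ and on the set $F_d$ of $d$-simplices of the barycentric subdivision $\mathrm{Sd}(\overline{\mathcal A_0})$, that is, of chains $Z=(Z_0\subsetneq\cdots\subsetneq Z_d)$ of nonempty subsets of $S_0$; $Z$ is realized as the simplex with ordered vertices $\mathrm{bar}(Z_0),\dots,\mathrm{bar}(Z_d)$, where $\mathrm{bar}(Z_j)$ is the barycenter of $\{v_i : i\in Z_j\}$. Fix a total order $\prec$ on each $F_d$, and let $Z_{d,1}\prec\cdots\prec Z_{d,k_d}$ be the $\prec$-minimal elements of the $\Omega_Y$-orbits in $F_d$, so that each orbit contains exactly one $Z_{d,i}$. For $d\ge1$ write $Z^{(p)}$ for the chain obtained from $Z\in F_d$ by omitting $Z_p$. For a $G$-equivariant triangulation, or a quotient of one, with simplices oriented by ordered vertices, $C^{\mathrm{cell}}_d$ denotes the free abelian group on the $d$-cells with its permutation action of $G$ and boundary the alternating sum of faces, and $C_{\mathrm{cell}}^d=\mathrm{Hom}(C^{\mathrm{cell}}_d,\mathbb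 Z)$ the dual complex, with the simplicial cup product. **Theorem.** 1. The simplices $w\cdot|Z|$ ($w\in W_a$, $Z$ a simplex of $\mathrm{Sd}(\overline{\mathcal A_0})$) form a $W_Y$-equivariant triangulation of $V^*$: $W_Y$ permutes them, and an element of $W_Y$ that stabilizes an open cell fixes it pointwise. 2. There are isomorphisms of $\mathbb Z[W_Y]$-modules $$C^{\mathrm{cell}}_d(V^*,W_Y;\mathbb Z)\cong\bigoplus_{i=1}^{k_d}\mathbb Z\big[W_Y/(W_Y)_{Z_{d,i}}\big],$$ the cell $g\,|Z_{d,i}|$ corresponding to the coset of $g\in W_Y$, and the stabilizers of the cells are the internal semidirect products $$(W_Y)_{Z_{d,i}}=(W_a)_{S_0\setminus (Z_{d,i})_d}\rtimes\bigcap_{j=0}^d(\Omega_Y)_{(Z_{d,i})_j},$$ where $(\Omega_Y)_{(Z_{d,i})_j}$ is the setwise stabilizer of $(Z_{d,i})_j\subseteq S_0$ in $\Omega_Y$. 3. For $d\ge1$ the boundary is given by $$\partial_d(Z_{d,i})=\sum_{p=0}^d(-1)^p\,\omega_{p,i}(Z_{d-1,u_p}),$$ where $Z_{d-1,u_p}$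 is the representative of the orbit of $Z_{d,i}^{(p)}$ and $\omega_{p,i}\in\Omega_Y$ is any element with $\omega_{p,i}(Z_{d-1,u_p})=Z_{d,i}^{(p)}$. 4. With the cup product, $C_{\mathrm{cell}}^*(V^*,W_Y;\mathbb Z)$ is a $\mathbb Z[W_Y]$-dg-algebra ($W_Y$ acts by automorphisms of differential graded algebras). If $(Z_{d,i})_d\ne(Z_{e,j})_0$, then $Z_{d,i}^*\cup Z_{e,j}^*=0$. If $(Z_{d,i})_d=(Z_{e,j})_0$, then $$Z_{d,i}^*\cup Z_{e,j}^*=\omega(Z_{d+e,k})^*,$$ where $Z_{d+e,k}$ is the representative of the orbit of $\big((Z_{d,i})_0,\dots,(Z_{d,i})_d,(Z_{e,j})_1,\dots,(Z_{e,j})_e\big)$ and $\omega\in\Omega_Y$ is any element that takes $Z_{d+e,k}$ to this chain. 5. The torus $V^*/Y$ is Hausdorff, the images of the cells of $V^*$ form a $W$-equivariant cell structure on it, and $$C^{\mathrm{cell}}_*(V^*/Y,W;\mathbb Z)\cong\mathrm{Def}^{W_Y}_W\big(C^{\mathrm{cell}}_*(V^*,W_Y;\mathbb Z)\big)$$ as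 complexes of $\mathbb Z[W]$-modules, through the map that sends the class of a cell to its image. Here $\mathrm{Def}^{W_Y}_W(U)=U/\langle yu-u : y\in\mathrm t(Y),\,u\in U\rangle$, with the action of $W\cong W_Y/\mathrm t(Y)$. -/

import Mathlib

open CategoryTheory
open scoped Pointwise MonoidAlgebra DirectSum

noncomputable section

namespace Alcove

/-! ### Delta-complexes with a group action -/

/-- The interior of the standard `n`-simplex: all barycentric coordinates are positive. -/
def stdInterior (n : ℕ) : Set (stdSimplex ℝ (Fin (n + 1))) :=
  {x | ∀ i, 0 < x i}

/-- A Delta-complex structure on a space `X`: a set of characteristic maps `Δⁿ → X` for every `n`,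
closed under restriction to faces (with the ordering of the vertices), injective on the interior
of the simplices, such that every point lies in exactly one open simplex and `X` carries the weak
topology. In particular it is a CW-structure on `X` all of whose cells are oriented simplices. -/
structure DeltaComplex (X : Type*) [TopologicalSpace X] where
  simplices (n : ℕ) : Set (stdSimplex ℝ (Fin (n + 1)) → X)
  continuous_of_mem : ∀ n, ∀ σ ∈ simplices n, Continuous σ
  face_mem : ∀ m n, ∀ σ ∈ simplices n, ∀ f : Fin (m + 1) ↪o Fin (n + 1),
    (fun x => σ (stdSimplex.map f x)) ∈ simplices m
  injOn : ∀ n, ∀ σ ∈ simplices n, Set.InjOn σ (stdInterior n)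
  existsUnique_mem : ∀ x : X, ∃! p : (Σ n, simplices n), x ∈ p.2.1 '' stdInterior p.1
  isOpen_of_preimage : ∀ A : Set X, (∀ n, ∀ σ ∈ simplices n, IsOpen (σ ⁻¹' A)) → IsOpen A

/-- A Delta-complex on a `G`-space `X` which is permuted by `G` and in which an element of `G`
that stabilizes an open cell fixes each point of this cell (a `G`-CW-complex). -/
structure EquivariantDeltaComplex (G X : Type*) [Group G] [MulAction G X] [TopologicalSpace X]
    extends DeltaComplex X where
  smul_mem : ∀ (g : G) (n : ℕ), ∀ σ ∈ simplices n, (fun x => g • σ x) ∈ simplices n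
  fixes : ∀ (g : G) (n : ℕ), ∀ σ ∈ simplices n,
    (g • (σ '' stdInterior n) : Set X) = σ '' stdInterior n →
      ∀ x ∈ σ '' stdInterior n, g • x = x

namespace EquivariantDeltaComplex

variable {G X : Type*} [Group G] [MulAction G X] [TopologicalSpace X]
  (K : EquivariantDeltaComplex G X)

/-- The `n`-cells. -/
abbrev Cell (n : ℕ) : Type _ := ↥(K.simplices n)

instance (n : ℕ) : MulAction G (K.Cell n) where
  smul g σ := ⟨fun x => g • σ.1 x, K.smul_mem g n σ.1 σ.2⟩
  one_smul σ := Subtype.ext (funext fun x => one_smul G (σ.1 x))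
  mul_smul g h σ := Subtype.ext (funext fun x => mul_smul g h (σ.1 x))

/-- Restriction of a cell to the face of the simplex given by `f`. -/
def restrict {m n : ℕ} (f : Fin (m + 1) ↪o Fin (n + 1)) (σ : K.Cell n) : K.Cell m :=
  ⟨fun x => σ.1 (stdSimplex.map f x), K.face_mem m n σ.1 σ.2 f⟩

lemma restrict_restrict {l m n : ℕ} (f : Fin (m + 1) ↪o Fin (n + 1))
    (g : Fin (l + 1) ↪o Fin (m + 1)) (σ : K.Cell n) :
    K.restrict g (K.restrict f σ) = K.restrict (g.trans f) σ := by
  apply Subtype.ext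
  funext x
  simp only [restrict, stdSimplex.map_comp_apply]
  rfl

lemma smul_restrict {m n : ℕ} (f : Fin (m + 1) ↪o Fin (n + 1)) (g : G) (σ : K.Cell n) :
    g • K.restrict f σ = K.restrict f (g • σ) := rfl

/-- The permutation representation of `G` on the cellular chains `ℤ⟨n-cells⟩`. -/
abbrev chainRep (n : ℕ) : Representation ℤ G ℤ[K.Cell n] :=
  Representation.ofMulAction ℤ G (K.Cell n)

/-- The cellular boundary: the alternating sum of the faces. -/
def boundary (n : ℕ) : ℤ[K.Cell (n + 1)] →ₗ[ℤ] ℤ[K.Cell n] :=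
  Finsupp.linearCombination ℤ (fun σ : K.Cell (n + 1) =>
      ∑ p : Fin (n + 2), (-1 : ℤ) ^ (p : ℕ) •
        MonoidAlgebra.single (K.restrict (Fin.succAboveOrderEmb p) σ) (1 : ℤ))
    ∘ₗ (MonoidAlgebra.coeffLinearEquiv ℤ).toLinearMap

lemma boundary_single (n : ℕ) (σ : K.Cell (n + 1)) :
    K.boundary n (MonoidAlgebra.single σ 1) =
      ∑ p : Fin (n + 2), (-1 : ℤ) ^ (p : ℕ) •
        MonoidAlgebra.single (K.restrict (Fin.succAboveOrderEmb p) σ) (1 : ℤ) := by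
  simp [boundary]

lemma boundary_boundary (n : ℕ) : K.boundary n ∘ₗ K.boundary (n + 1) = 0 := by
  ext σ : 3
  suffices h : K.boundary n (K.boundary (n + 1) (MonoidAlgebra.single σ 1)) = 0 by simpa using h
  simp only [boundary_single, map_sum, map_zsmul, Finset.smul_sum, restrict_restrict, smul_smul]
  rw [← Finset.sum_product', Finset.univ_product_univ]
  let P := Fin (n + 3) × Fin (n + 2)
  let S : Finset P := {ij : P | (ij.1 : ℕ) ≤ (ij.2 : ℕ)}
  rw [← Finset.sum_add_sum_compl S, ← eq_neg_iff_add_eq_zero, ← Finset.sum_neg_distrib]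
  let φ : ∀ ij : P, ij ∈ S → P := fun ij hij =>
    (ij.2.succ, Fin.castLT ij.1 (lt_of_le_of_lt (Finset.mem_filter.mp hij).right (Fin.is_lt ij.2)))
  apply Finset.sum_bij φ
  · intro ij hij
    simp_rw [S, φ, Finset.compl_filter, Finset.mem_filter_univ, Fin.val_succ,
      Fin.val_castLT] at hij ⊢
    lia
  · rintro ⟨i, j⟩ hij ⟨i', j'⟩ hij' h
    have h1 := congrArg Fin.val (congrArg Prod.fst h)
    have h2 := congrArg Fin.val (congrArg Prod.snd h)
    simp only [φ, Fin.val_succ, Fin.val_castLT, Nat.add_right_cancel_iff] at h1 h2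
    exact Prod.ext (Fin.ext h2) (Fin.ext h1)
  · rintro ⟨j', i'⟩ hij'
    simp_rw [S, Finset.compl_filter, Finset.mem_filter_univ, not_le] at hij'
    have h0 : j' ≠ 0 := by
      rintro rfl
      simp at hij'
    refine ⟨(Fin.castSucc i', j'.pred h0), ?_, ?_⟩
    · simpa [S] using Nat.le_sub_one_of_lt hij'
    · simp [φ, Fin.succ_pred]
  · rintro ⟨i, j⟩ hij
    simp only [S, Finset.mem_filter_univ] at hij
    have key : (Fin.succAboveOrderEmb j).trans (Fin.succAboveOrderEmb i) =
        (Fin.succAboveOrderEmb (φ (i, j) (by simpa [S] using hij)).2).trans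
          (Fin.succAboveOrderEmb (φ (i, j) (by simpa [S] using hij)).1) := by
      ext k
      simp only [φ, RelEmbedding.coe_trans, Function.comp_apply, Fin.succAboveOrderEmb_apply,
        Fin.succAbove, Fin.lt_def]
      grind
    rw [key, ← neg_smul]
    congr 1
    simp only [φ, Fin.val_succ, Fin.val_castLT]
    ring

lemma boundary_equivariant (n : ℕ) (g : G) :
    K.boundary n ∘ₗ K.chainRep (n + 1) g = K.chainRep n g ∘ₗ K.boundary n := by
  ext σ : 3
  suffices h : K.boundary n (K.chainRep (n + 1) g (MonoidAlgebra.single σ 1)) =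
      K.chainRep n g (K.boundary n (MonoidAlgebra.single σ 1)) by simpa using h
  simp [boundary_single, smul_restrict]

/-- The cellular chain complex of `X`, a complex of permutation `ℤ[G]`-modules. -/
def cellularComplex : ChainComplex (Rep ℤ G) ℕ :=
  ChainComplex.of (fun n => Rep.of (K.chainRep n))
    (fun n => Rep.ofHom ⟨K.boundary n, K.boundary_equivariant n⟩) (fun n => by
      ext : 2
      exact K.boundary_boundary n)

/-- The cellular cochains `Hom(ℤ⟨n-cells⟩, ℤ)`. -/
abbrev Cochain (n : ℕ) : Type _ := Module.Dual ℤ ℤ[K.Cell n]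

/-- The contragredient action of `G` on the cellular cochains. -/
abbrev cochainRep (n : ℕ) : Representation ℤ G (K.Cochain n) :=
  (K.chainRep n).dual

/-- The coboundary `φ ↦ φ ∘ ∂`. -/
def coboundary (n : ℕ) : K.Cochain n →ₗ[ℤ] K.Cochain (n + 1) :=
  (K.boundary n).dualMap

/-- The front face `[v₀, …, v_p]` of an `m`-simplex, `p + q = m`. -/
def frontFace {p q m : ℕ} (h : p + q = m) : Fin (p + 1) ↪o Fin (m + 1) :=
  Fin.castLEOrderEmb (by omega)

/-- The back face `[v_p, …, v_m]` of an `m`-simplex, `p + q = m`. -/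
def backFace {p q m : ℕ} (h : p + q = m) : Fin (q + 1) ↪o Fin (m + 1) :=
  (Fin.natAddOrderEmb p).trans (Fin.castOrderIso (by omega)).toOrderEmbedding

/-- The cochain with prescribed values on the cells. -/
def cochainOf {n : ℕ} (F : K.Cell n → ℤ) : K.Cochain n :=
  Finsupp.linearCombination ℤ F ∘ₗ (MonoidAlgebra.coeffLinearEquiv ℤ).toLinearMap

@[simp]
lemma cochainOf_single {n : ℕ} (F : K.Cell n → ℤ) (σ : K.Cell n) :
    K.cochainOf F (MonoidAlgebra.single σ 1) = F σ := by
  simp [cochainOf]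

lemma cochain_ext {n : ℕ} {φ ψ : K.Cochain n}
    (h : ∀ σ, φ (MonoidAlgebra.single σ 1) = ψ (MonoidAlgebra.single σ 1)) : φ = ψ := by
  ext σ : 3
  simpa using h σ

/-- The cup product `(φ ∪ ψ)[v₀, …, v_m] = φ[v₀, …, v_p] ψ[v_p, …, v_m]` of cochains. -/
def cup {p q m : ℕ} (h : p + q = m) :
    K.Cochain p →ₗ[ℤ] K.Cochain q →ₗ[ℤ] K.Cochain m :=
  LinearMap.mk₂ ℤ
    (fun φ ψ => K.cochainOf (fun σ : K.Cell m =>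
        φ (MonoidAlgebra.single (K.restrict (frontFace h) σ) 1) *
          ψ (MonoidAlgebra.single (K.restrict (backFace h) σ) 1)))
    (fun φ φ' ψ => K.cochain_ext fun σ => by simp only [cochainOf_single, LinearMap.add_apply, add_mul])
    (fun c φ ψ => K.cochain_ext fun σ => by
      simp only [cochainOf_single, LinearMap.smul_apply, smul_mul_assoc])
    (fun φ ψ ψ' => K.cochain_ext fun σ => by simp only [cochainOf_single, LinearMap.add_apply, mul_add])
    (fun c φ ψ => K.cochain_ext fun σ => by
      simp only [cochainOf_single, LinearMap.smul_apply, mul_smul_comm])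

/-- The unit cochain, with value `1` on each vertex. -/
def unit : K.Cochain 0 := K.cochainOf fun _ => 1

open Classical in
/-- The cochain `σ*` dual to the cell `σ`: it is `1` on `σ` and `0` on the other cells. -/
def dualCell {n : ℕ} (σ : K.Cell n) : K.Cochain n :=
  K.cochainOf fun τ => if τ = σ then 1 else 0

end EquivariantDeltaComplex

/-- `(A, d, mul, one)` is a differential graded algebra on which `G` acts (through `ρ`) by
automorphisms of differential graded algebras. -/
structure IsEquivariantDGAlgebra {G : Type*} [Group G] {A : ℕ → Type*} [∀ n, AddCommGroup (A n)]
    (ρ : ∀ n, Representation ℤ G (A n)) (d : ∀ n, A n →ₗ[ℤ] A (n + 1))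
    (mul : ∀ {p q m : ℕ}, p + q = m → (A p →ₗ[ℤ] A q →ₗ[ℤ] A m)) (one : A 0) : Prop where
  d_d : ∀ n (a : A n), d (n + 1) (d n a) = 0
  mul_assoc : ∀ {p q r s t m : ℕ} (hpq : p + q = s) (hqr : q + r = t) (hs : s + r = m)
    (ht : p + t = m) (a : A p) (b : A q) (c : A r),
    mul hs (mul hpq a b) c = mul ht a (mul hqr b c)
  one_mul : ∀ n (a : A n), mul (Nat.zero_add n) one a = a
  mul_one : ∀ n (a : A n), mul (Nat.add_zero n) a one = a
  leibniz : ∀ {p q m : ℕ} (h : p + q = m) (h₁ : (p + 1) + q = m + 1) (h₂ : p + (q + 1) = m + 1)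
    (a : A p) (b : A q),
    d m (mul h a b) = mul h₁ (d p a) b + (-1 : ℤ) ^ p • mul h₂ a (d q b)
  d_smul : ∀ (g : G) n (a : A n), d n (ρ n g a) = ρ (n + 1) g (d n a)
  mul_smul : ∀ (g : G) {p q m : ℕ} (h : p + q = m) (a : A p) (b : A q),
    ρ m g (mul h a b) = mul h (ρ p g a) (ρ q g b)
  one_smul : ∀ g : G, ρ 0 g one = one

end Alcove

namespace Alcove

/-- The affine group of a vector space acts on it by evaluation. -/
instance affineAction {N : Type*} [AddCommGroup N] [Module ℝ N] :
    MulAction (N ≃ᵃ[ℝ] N) N where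
  smul g x := g x
  one_smul _ := rfl
  mul_smul _ _ _ := rfl

lemma affine_smul_def {N : Type*} [AddCommGroup N] [Module ℝ N] (g : N ≃ᵃ[ℝ] N) (x : N) :
    g • x = g x := rfl

variable {ι M N : Type*} [AddCommGroup M] [Module ℝ M] [AddCommGroup N] [Module ℝ N]

/-! ### Root systems, affine Weyl groups and lattices

`M` is the space `V` containing the roots, `N` is its dual `V*`, containing the coroots. -/

/-- The reflection `λ ↦ λ - ⟨λ, α⟩ α^∨` of `V*`, for a root `α`. -/
def refl (P : RootPairing ι ℝ M N) (i : ι) : N ≃ᵃ[ℝ] N :=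
  (P.coreflection i).toAffineEquiv

/-- The Weyl group, as a group of (linear) transformations of `V*`. -/
def weyl (P : RootPairing ι ℝ M N) : Subgroup (N ≃ᵃ[ℝ] N) :=
  Subgroup.closure (Set.range (refl P))

/-- The coroot lattice `Q^∨`. -/
def corootLattice (P : RootPairing ι ℝ M N) : AddSubgroup N :=
  AddSubgroup.closure (Set.range P.coroot)

/-- The coweight lattice `P^∨`: the vectors of `V*` with integral values on the roots. -/
def coweightLattice (P : RootPairing ι ℝ M N) : AddSubgroup N where
  carrier := {y | ∀ i, ∃ k : ℤ, P.root' i y = k}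
  zero_mem' i := ⟨0, by simp⟩
  add_mem' {x y} hx hy i := by
    obtain ⟨k, hk⟩ := hx i
    obtain ⟨l, hl⟩ := hy i
    exact ⟨k + l, by rw [map_add, hk, hl]; push_cast; rfl⟩
  neg_mem' {x} hx i := by
    obtain ⟨k, hk⟩ := hx i
    exact ⟨-k, by rw [map_neg, hk]; push_cast; rfl⟩

/-- A `W`-lattice `Y` with `Q^∨ ⊆ Y ⊆ P^∨`. -/
structure WLattice (P : RootPairing ι ℝ M N) extends AddSubgroup N where
  coroot_le : corootLattice P ≤ toAddSubgroup
  le_coweight : toAddSubgroup ≤ coweightLattice P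
  weyl_mem : ∀ w ∈ weyl P, ∀ y ∈ toAddSubgroup, w y ∈ toAddSubgroup

section Base

variable {P : RootPairing ι ℝ M N} (b : P.Base)

/-- A root `α₀` is the highest one if `α₀ - α` is a sum of simple roots for every root `α`. -/
def IsHighestRoot (i : ι) : Prop :=
  ∀ j, P.root i - P.root j ∈ AddSubmonoid.closure (P.root '' b.support)

/-- The highest root `α₀`. -/
def highestRoot [Nonempty ι] : ι :=
  Classical.epsilon (IsHighestRoot b)

/-- The index set `S₀ = {0, 1, …, n}`: `none` is `0` and the elements `some i` index the simple
roots. -/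
abbrev Node : Type _ := Option b.support

/-- The fundamental alcove `𝒜₀`. -/
def alcove : Set N :=
  {x | ∀ i, b.IsPos i → 0 < P.root' i x ∧ P.root' i x < 1}

/-- The generators `s_i` of the affine Weyl group: `s_0` is `λ ↦ s_{α₀}(λ) + α₀^∨` and the other
ones are the simple reflections. -/
def simpleAffineReflection [Nonempty ι] : Node b → N ≃ᵃ[ℝ] N
  | none => AffineEquiv.constVAdd ℝ N (P.coroot (highestRoot b)) * refl P (highestRoot b)
  | some i => refl P i

/-- The parabolic subgroup `(W_a)_I`, generated by the `s_i` with `i ∈ I`. -/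
def parabolic [Nonempty ι] (I : Set (Node b)) : Subgroup (N ≃ᵃ[ℝ] N) :=
  Subgroup.closure (simpleAffineReflection b '' I)

/-- The affine Weyl group `W_a = ⟨s_0, …, s_n⟩`. -/
def affineWeyl [Nonempty ι] : Subgroup (N ≃ᵃ[ℝ] N) :=
  Subgroup.closure (Set.range (simpleAffineReflection b))

variable [P.IsRootSystem]

/-- The fundamental coweight `ϖ_i^∨`, dual to the basis of simple roots. -/
def fundamentalCoweight (i : b.support) : N :=
  P.toLinearMap.flip.toPerfPair.symm (b.toWeightBasis.coord i)

open Classical in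
lemma root'_fundamentalCoweight (i j : b.support) :
    P.root' j (fundamentalCoweight b i) = if j = i then 1 else 0 := by
  have h := LinearMap.apply_toPerfPair_flip P.toLinearMap (b.toWeightBasis.coord i) (P.root j)
  rw [RootPairing.root', fundamentalCoweight, h, ← b.toWeightBasis_apply j]
  simp [Finsupp.single_apply]

variable [Nonempty ι]

/-- The coefficient `n_i` of the simple root `α_i` in the highest root `α₀ = ∑ n_i α_i`. -/
def highestCoeff (i : b.support) : ℝ :=
  b.toWeightBasis.repr (P.root (highestRoot b)) i

/-- The vertices of the fundamental alcove: `v_0 = 0` and `v_i = ϖ_i^∨ / n_i`. -/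
def alcoveVertex : Node b → N
  | none => 0
  | some i => (highestCoeff b i)⁻¹ • fundamentalCoweight b i

/-- The barycenter of the face of the closed fundamental alcove with vertices `v_i`, `i ∈ Z`. -/
def barycenter (Z : Finset (Node b)) : N :=
  (Z.card : ℝ)⁻¹ • ∑ i ∈ Z, alcoveVertex b i

end Base

/-! ### Simplices of the barycentric subdivision -/

/-- A `d`-simplex `Z_0 ⊂ Z_1 ⊂ ⋯ ⊂ Z_d` (strict inclusions, nonempty sets) of the barycentric
subdivision of the closed fundamental alcove. -/
structure Flag {P : RootPairing ι ℝ M N} (b : P.Base) (d : ℕ) where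
  set : Fin (d + 1) → Finset (Node b)
  strictMono : StrictMono set
  nonempty : ∀ i, (set i).Nonempty

namespace Flag

variable {P : RootPairing ι ℝ M N} {b : P.Base}

/-- The face `Z^{(p)}`, obtained by omitting `Z_p`. -/
def face {d : ℕ} (Z : Flag b (d + 1)) (p : Fin (d + 2)) : Flag b d where
  set i := Z.set (p.succAbove i)
  strictMono := Z.strictMono.comp (Fin.strictMono_succAbove p)
  nonempty _ := Z.nonempty _

/-- The chain `Z_0 ⊂ ⋯ ⊂ Z_p = Z'_0 ⊂ Z'_1 ⊂ ⋯ ⊂ Z'_q`. -/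
def append {p q : ℕ} (Z : Flag b p) (Z' : Flag b q) (h : Z.set (Fin.last p) = Z'.set 0) :
    Flag b (p + q) where
  set i := if hi : (i : ℕ) ≤ p then Z.set ⟨i, by omega⟩ else Z'.set ⟨i - p, by omega⟩
  strictMono := by
    intro i j hij
    have hij' : (i : ℕ) < j := hij
    by_cases hi : (i : ℕ) ≤ p <;> by_cases hj : (j : ℕ) ≤ p
    · simp only [hi, hj, dif_pos]
      exact Z.strictMono hij
    · simp only [hi, hj, dif_pos, dif_neg, not_false_eq_true]
      refine lt_of_le_of_lt (b := Z.set (Fin.last p)) (Z.strictMono.monotone (Fin.le_last _)) ?_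
      rw [h]
      exact Z'.strictMono (Fin.lt_def.2 (by simp; omega))
    · omega
    · simp only [hi, hj, dif_neg, not_false_eq_true]
      exact Z'.strictMono (Fin.lt_def.2 (by simp; omega))
  nonempty i := by
    by_cases hi : (i : ℕ) ≤ p
    · simp only [hi, dif_pos]
      exact Z.nonempty _
    · simp only [hi, dif_neg, not_false_eq_true]
      exact Z'.nonempty _

variable [P.IsRootSystem] [Nonempty ι]

/-- The affine parametrization of the simplex with vertices `bar(Z_0), …, bar(Z_d)`. -/
def param {d : ℕ} (Z : Flag b d) (x : stdSimplex ℝ (Fin (d + 1))) : N :=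
  ∑ i, x i • barycenter b (Z.set i)

/-- The open simplex with vertices `bar(Z_0), …, bar(Z_d)`. -/
def openCell {d : ℕ} (Z : Flag b d) : Set N :=
  Z.param '' stdInterior d

/-- `g • Z = Z'`, for the action on chains of sets of vertices of the alcove. -/
def Moves {d : ℕ} (g : N ≃ᵃ[ℝ] N) (Z Z' : Flag b d) : Prop :=
  ∀ i, g '' (alcoveVertex b '' (Z.set i : Set (Node b))) =
    alcoveVertex b '' (Z'.set i : Set (Node b))

end Flag

/-- The maps `w ∘ |Z|` with `w ∈ W_a` and `Z` a `d`-simplex of the barycentric subdivision. -/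
def alcoveSimplices {P : RootPairing ι ℝ M N} (b : P.Base) [P.IsRootSystem] [Nonempty ι] (d : ℕ) :
    Set (stdSimplex ℝ (Fin (d + 1)) → N) :=
  {σ | ∃ w ∈ affineWeyl b, ∃ Z : Flag b d, σ = fun x => w (Z.param x)}

/-! ### The group `W_Y` and deflation -/

lemma weyl_map_add {P : RootPairing ι ℝ M N} {w : N ≃ᵃ[ℝ] N} (hw : w ∈ weyl P) (x y : N) :
    w (x + y) = w x + w y := by
  suffices h : w 0 = 0 by
    have h1 := w.map_vadd 0 (x + y)
    have h2 := w.map_vadd 0 x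
    have h3 := w.map_vadd 0 y
    simp only [vadd_eq_add, add_zero, h, map_add] at h1 h2 h3
    rw [h1, h2, h3]
  induction hw using Subgroup.closure_induction with
  | mem w hw =>
    obtain ⟨i, rfl⟩ := hw
    exact map_zero (P.coreflection i)
  | one => rfl
  | mul w w' _ _ h h' => exact (congrArg w h').trans h
  | inv w _ h => exact (congrArg w.symm h.symm).trans (w.symm_apply_apply 0)

instance coinvariantsPreservesZero {k G : Type*} [CommRing k] [Group G] (S : Subgroup G)
    [S.Normal] : (Rep.quotientToCoinvariantsFunctor k S).PreservesZeroMorphisms where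
  map_zero U U' := by
    apply Rep.hom_ext
    apply DFunLike.ext
    intro x
    obtain ⟨u, rfl⟩ := Representation.Coinvariants.mk_surjective (U.ρ.comp S.subtype) x
    rfl

namespace WLattice

variable {P : RootPairing ι ℝ M N} (Y : WLattice P)

/-- The group `t(Y)` of translations by elements of `Y`. -/
def translations : Subgroup (N ≃ᵃ[ℝ] N) :=
  (AddSubgroup.toSubgroup Y.toAddSubgroup).map (AffineEquiv.constVAddHom ℝ N)

lemma mem_translations {g : N ≃ᵃ[ℝ] N} :
    g ∈ Y.translations ↔ ∃ y ∈ Y.toAddSubgroup, AffineEquiv.constVAdd ℝ N y = g :=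
  Iff.rfl

/-- The group `W_Y = t(Y) ⋊ W` of affine transformations of `V*`. -/
def extWeyl : Subgroup (N ≃ᵃ[ℝ] N) :=
  Y.translations ⊔ weyl P

/-- The translations, as a subgroup of `W_Y`. -/
abbrev translationsIn : Subgroup Y.extWeyl :=
  Y.translations.subgroupOf Y.extWeyl

lemma weyl_le_normalizer : weyl P ≤ Subgroup.normalizer (Y.translations : Set (N ≃ᵃ[ℝ] N)) := by
  have key : ∀ w ∈ weyl P, ∀ g ∈ Y.translations, w * g * w⁻¹ ∈ Y.translations := by
    rintro w hw g hg
    obtain ⟨y, hy, rfl⟩ := (Y.mem_translations).1 hg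
    refine (Y.mem_translations).2 ⟨w y, Y.weyl_mem w hw y hy, ?_⟩
    ext x
    change w y + x = w (y + w⁻¹ x)
    rw [weyl_map_add hw]
    congr 1
    exact (w.apply_symm_apply x).symm
  intro w hw
  rw [Subgroup.mem_normalizer_iff]
  intro g
  refine ⟨key w hw g, fun h => ?_⟩
  have := key w⁻¹ (inv_mem hw) _ h
  simpa [mul_assoc] using this

instance : (Y.translationsIn).Normal := by
  have hle : Y.translations ≤ Y.extWeyl := le_sup_left
  rw [translationsIn, Subgroup.normal_subgroupOf_iff_le_normalizer hle]
  exact sup_le Subgroup.le_normalizer Y.weyl_le_normalizer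

/-- The composite `W → W_Y → W_Y / t(Y)`. -/
def weylToQuotient : weyl P →* Y.extWeyl ⧸ Y.translationsIn :=
  (QuotientGroup.mk' Y.translationsIn).comp (Subgroup.inclusion le_sup_right)

/-- The deflation functor `Def_W^{W_Y}`: it sends a `ℤ[W_Y]`-module `U` to the coinvariants
`U_Y = U / ⟨y u - u⟩`, with the action of `W ≅ W_Y / t(Y)`. -/
def deflation : Rep ℤ Y.extWeyl ⥤ Rep ℤ (weyl P) :=
  Rep.quotientToCoinvariantsFunctor ℤ Y.translationsIn ⋙ Rep.resFunctor Y.weylToQuotient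

instance : Y.deflation.PreservesZeroMorphisms :=
  inferInstanceAs ((Rep.quotientToCoinvariantsFunctor ℤ Y.translationsIn ⋙
    Rep.resFunctor Y.weylToQuotient).PreservesZeroMorphisms)

/-- The torus `V* / Y`. -/
abbrev Torus : Type _ := N ⧸ Y.toAddSubgroup

/-- The Weyl group acts on the torus `V* / Y`. -/
instance : MulAction (weyl P) Y.Torus where
  smul w := Quotient.map' w.1 (by
    intro x y h
    rw [QuotientAddGroup.leftRel_apply] at h ⊢
    have h1 := weyl_map_add w.2 x (-x + y)
    rw [add_neg_cancel_left] at h1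
    rw [h1, neg_add_cancel_left]
    exact Y.weyl_mem w.1 w.2 _ h)
  one_smul x := Quotient.inductionOn' x fun _ => rfl
  mul_smul w w' x := Quotient.inductionOn' x fun _ => rfl

variable (b : P.Base)

/-- The stabilizer `Ω_Y` of the fundamental alcove in `W_Y`. -/
def alcoveGroup : Subgroup (N ≃ᵃ[ℝ] N) :=
  Y.extWeyl ⊓ MulAction.stabilizer (N ≃ᵃ[ℝ] N) (alcove b)

variable [P.IsRootSystem] [Nonempty ι] {b}

/-- The stabilizer `(W_Y)_Z` in `W_Y` of the (open) cell `Z`. -/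
def cellStabilizer {d : ℕ} (Z : Flag b d) : Subgroup (N ≃ᵃ[ℝ] N) :=
  Y.extWeyl ⊓ MulAction.stabilizer (N ≃ᵃ[ℝ] N) Z.openCell

/-- The stabilizer in `Ω_Y` of a set of vertices of the alcove. -/
def vertexSetStabilizer (Z : Finset (Node b)) : Subgroup (N ≃ᵃ[ℝ] N) :=
  Y.alcoveGroup b ⊓
    MulAction.stabilizer (N ≃ᵃ[ℝ] N) (alcoveVertex b '' (Z : Set (Node b)))

/-- `Z` is the smallest element of its `Ω_Y`-orbit. -/
def IsOrbitMin {d : ℕ} [LinearOrder (Flag b d)] (Z : Flag b d) : Prop :=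
  ∀ ω ∈ Y.alcoveGroup b, ∀ Z' : Flag b d, Z.Moves ω Z' → Z ≤ Z'

variable (b) in
/-- The representatives `Z_{d,1}, …, Z_{d,k_d}`, smallest in their `Ω_Y`-orbit. -/
abbrev OrbitRep (d : ℕ) [LinearOrder (Flag b d)] : Type _ :=
  {Z : Flag b d // Y.IsOrbitMin Z}

/-- The `ℤ[W_Y]`-module `ℤ[W_Y / (W_Y)_Z]`. -/
abbrev cosetRep {d : ℕ} (Z : Flag b d) :
    Representation ℤ Y.extWeyl ℤ[Y.extWeyl ⧸ (Y.cellStabilizer Z).subgroupOf Y.extWeyl] :=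
  Representation.ofMulAction ℤ Y.extWeyl _

variable (b) in
/-- The `ℤ[W_Y]`-module `⨁_i ℤ[W_Y / (W_Y)_{Z_{d,i}}]`. -/
abbrev orbitRep (d : ℕ) [LinearOrder (Flag b d)] :
    Representation ℤ Y.extWeyl (⨁ Z : Y.OrbitRep b d,
      ℤ[Y.extWeyl ⧸ (Y.cellStabilizer Z.1).subgroupOf Y.extWeyl]) :=
  Representation.directSum fun Z => Y.cosetRep Z.1

open Classical in
/-- The element `g (W_Y)_Z` of the summand `ℤ[W_Y / (W_Y)_Z]`, written `g(Z)`. -/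
def gen {d : ℕ} [LinearOrder (Flag b d)] (Z : Y.OrbitRep b d) (g : Y.extWeyl) :
    ⨁ Z : Y.OrbitRep b d, ℤ[Y.extWeyl ⧸ (Y.cellStabilizer Z.1).subgroupOf Y.extWeyl] :=
  DirectSum.of (fun Z : Y.OrbitRep b d =>
    ℤ[Y.extWeyl ⧸ (Y.cellStabilizer Z.1).subgroupOf Y.extWeyl]) Z
      (MonoidAlgebra.single (QuotientGroup.mk g) 1)

end WLattice

/-- `S` is the internal semidirect product `A ⋊ B` of two subgroups `A` and `B`. -/
def IsInternalSemidirectProduct {G : Type*} [Group G] (A B S : Subgroup G) : Prop :=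
  A ≤ S ∧ B ≤ S ∧ (A.subgroupOf S).Normal ∧ A ⊓ B = ⊥ ∧ A ⊔ B = S

end Alcove

end

/-!
The proof rests on the classical geometry of alcoves, developed from affine roots `λ ↦ ⟨λ, α⟩ + k`
and the reflections in them.

*The alcove.* A root is maximal if no other root exceeds it by a sum of simple roots. By
irreducibility all simple roots occur in a maximal root, and this forces it to be unique
(`IsMaximalRoot.eq`): it is the highest root. Hence the closed alcove is cut out by the simple
affine roots, which are, up to positive factors, the barycentric coordinates `coord` for the
vertices `v_i`, and no affine root changes its sign on it.

*The strict fundamental domain.* A simple reflection makes only one positive affine root negative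
(`IsPosAff.reflAff`). The exchange condition for words in the simple reflections follows, and shows
that a point of the closed alcove which an element `w` of `W_a` maps into the closed alcove is fixed
by `w`, and that `w` is a product of simple reflections fixing it (`eq_self_and_mem_parabolic`).
Counting the positive affine roots that are negative at a point shows that the translates of the
closed alcove cover `V*` (`exists_affineWeyl_mem_closedAlcove`). Moreover `W_Y = W_a Ω_Y`, because
`W_Y` permutes the affine roots.

*The triangulation.* The barycentric coordinates of a point of an open simplex `Z` of the
barycentric subdivision form a positive combination of the indicator functions of the sets `Z_j`,
from which the chain can be recovered as the chain of superlevel sets. With the strict fundamental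
domain this yields `cell_unique`: two translates of open simplices that meet coincide together with
their parametrizations. This fact and `W_Y = W_a Ω_Y` show that the translates form a
triangulation, that stabilizers of open cells fix them pointwise and are the stated semidirect
products, and that the cells are in bijection with the cosets of the stabilizers of the
representatives. The weak topology comes from local finiteness.

*Algebra.* The formula for the boundary is read off from this bijection. The axioms of a
differential graded algebra hold for the cochains of every equivariant Delta-complex. The cup
product of two dual cells is dual to the only cell with the prescribed front and back faces, if
there is one.

*The torus.* If the images of two open cells in `V* / Y` meet, then the cells differ by a
translation in `Y`, again by `cell_unique`. Hence the cells of the torus are the orbits of `t(Y)` on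
the cells of `V*`, the quotient inherits all the properties of a Delta-complex, and its chains are
the coinvariants of the permutation modules of chains of `V*`.
-/

noncomputable section

namespace Alcove

/-! ### The highest root -/

section HighestRoot

variable {ι M N : Type*} [AddCommGroup M] [Module ℝ M] [AddCommGroup N] [Module ℝ N]
  {P : RootPairing ι ℝ M N} (b : P.Base)

variable [P.IsRootSystem]

lemma mem_closure_simple_iff {x : M} :
    x ∈ AddSubmonoid.closure (P.root '' b.support) ↔
      ∃ f : b.support → ℕ, ∀ k, b.toWeightBasis.repr x k = f k := by
  rw [← Submodule.span_nat_eq_addSubmonoidClosure, Submodule.mem_toAddSubmonoid]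
  have : P.root '' b.support = Set.range fun k : b.support => P.root k := by
    ext; simp
  rw [this, Submodule.mem_span_range_iff_exists_fun]
  refine exists_congr fun f => ⟨?_, fun h => ?_⟩
  · rintro rfl k
    have : ∑ i, f i • P.root i = ∑ i, (f i : ℝ) • b.toWeightBasis i := by
      simp [Nat.cast_smul_eq_nsmul]
    rw [this, Module.Basis.repr_sum_self]
  · rw [← b.toWeightBasis.sum_repr x]
    simp [h, Nat.cast_smul_eq_nsmul]

lemma repr_nonneg_of_mem_closure {x : M} (hx : x ∈ AddSubmonoid.closure (P.root '' b.support))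
    (k : b.support) : 0 ≤ b.toWeightBasis.repr x k := by
  obtain ⟨f, hf⟩ := (mem_closure_simple_iff b).1 hx
  rw [hf]
  positivity

lemma eq_zero_of_mem_closure_of_neg_mem_closure {x : M}
    (hx : x ∈ AddSubmonoid.closure (P.root '' b.support))
    (hx' : -x ∈ AddSubmonoid.closure (P.root '' b.support)) : x = 0 := by
  refine b.toWeightBasis.ext_elem fun k => ?_
  have h := repr_nonneg_of_mem_closure b hx k
  have h' := repr_nonneg_of_mem_closure b hx' k
  simp only [map_neg, Finsupp.coe_neg, Pi.neg_apply, map_zero, Finsupp.coe_zero,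
    Pi.zero_apply] at h' ⊢
  linarith

lemma pairing_eq_sum (i j : ι) :
    P.pairing i j = ∑ k, b.toWeightBasis.repr (P.root i) k * P.pairing k j := by
  conv_lhs => rw [← P.root_coroot'_eq_pairing, ← b.toWeightBasis.sum_repr (P.root i)]
  simp

variable [Finite ι] [P.IsCrystallographic]

omit [P.IsRootSystem] in
lemma mem_closure_simple_of_isPos {i : ι} (hi : b.IsPos i) :
    P.root i ∈ AddSubmonoid.closure (P.root '' b.support) :=
  hi.induction_on_add
    (p := fun i => P.root i ∈ AddSubmonoid.closure (P.root '' b.support))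
    (fun j hj => AddSubmonoid.subset_closure ⟨j, hj, rfl⟩)
    fun _ j _ hk hi hj => hk ▸ add_mem hi (AddSubmonoid.subset_closure ⟨j, hj, rfl⟩)

omit [P.IsRootSystem] in
lemma neg_mem_closure_simple_of_not_isPos {i : ι} (hi : ¬ b.IsPos i) :
    -P.root i ∈ AddSubmonoid.closure (P.root '' b.support) := by
  let := P.indexNeg
  have := mem_closure_simple_of_isPos b ((RootPairing.Base.IsPos.neg_iff_not b i).2 hi)
  simpa using this

/-- A root is maximal for the order in which `x ≤ y` means that `y - x` is a sum of simple
roots. -/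
def IsMaximalRoot (i : ι) : Prop :=
  ∀ j, P.root j - P.root i ∈ AddSubmonoid.closure (P.root '' b.support) → j = i

omit [P.IsCrystallographic] in
/-- A root of greatest height among those above `i` is maximal. -/
lemma exists_isMaximalRoot_ge (i : ι) : ∃ j, IsMaximalRoot b j ∧
    P.root j - P.root i ∈ AddSubmonoid.closure (P.root '' b.support) := by
  let h : M →ₗ[ℝ] ℝ := ∑ k, b.toWeightBasis.coord k
  have hh : ∀ x, h x = ∑ k, b.toWeightBasis.repr x k := fun x => by simp [h]
  obtain ⟨j, hj, hmax⟩ := Set.exists_max_image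
    {j | P.root j - P.root i ∈ AddSubmonoid.closure (P.root '' b.support)} (fun j => h (P.root j))
    (Set.toFinite _) ⟨i, by simp⟩
  refine ⟨j, fun k hk => ?_, hj⟩
  have h1 : h (P.root k) ≤ h (P.root j) := hmax k (by simpa using add_mem hk hj)
  have h2 : h (P.root k - P.root j) ≤ 0 := by rw [map_sub]; linarith
  rw [hh] at h2
  have h3 := (Finset.sum_eq_zero_iff_of_nonneg
    (fun k' _ => repr_nonneg_of_mem_closure b hk k')).1
    (le_antisymm h2 (Finset.sum_nonneg fun k' _ => repr_nonneg_of_mem_closure b hk k'))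
  refine P.root.injective (sub_eq_zero.1 (b.toWeightBasis.ext_elem fun k' => ?_))
  simpa using h3 k' (Finset.mem_univ _)

namespace IsMaximalRoot

variable {b} {i j : ι}

omit [P.IsRootSystem] in
lemma isPos (hi : IsMaximalRoot b i) : b.IsPos i := by
  by_contra h
  let := P.indexNeg
  have h1 := neg_mem_closure_simple_of_not_isPos b h
  have h2 : (-i : ι) = i := hi (-i) (by simpa [sub_eq_add_neg] using add_mem h1 h1)
  have h3 : P.root i = -P.root i := by
    conv_lhs => rw [← h2]
    simp
  have h4 : (2 : ℝ) • P.root i = 0 := by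
    rw [two_smul]
    nth_rw 2 [h3]
    exact add_neg_cancel _
  exact P.ne_zero i ((smul_eq_zero.1 h4).resolve_left two_ne_zero)

/-- Otherwise `α_i + α_j` would be a root above `α_i`. -/
lemma pairing_nonneg (hi : IsMaximalRoot b i) (hj : j ∈ b.support) : 0 ≤ P.pairing i j := by
  rw [← P.algebraMap_pairingIn ℤ]
  refine Int.cast_nonneg (not_lt.1 fun h => ?_)
  have hj' : P.root j ∈ AddSubmonoid.closure (P.root '' b.support) :=
    AddSubmonoid.subset_closure ⟨j, hj, rfl⟩
  have hne : P.root i ≠ -P.root j := fun h' =>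
    P.ne_zero i (eq_zero_of_mem_closure_of_neg_mem_closure b
      (mem_closure_simple_of_isPos b hi.isPos) (by rw [h', neg_neg]; exact hj'))
  obtain ⟨k, hk⟩ := P.root_add_root_mem_of_pairingIn_neg h hne
  have h1 : k = i := hi k (by rw [hk]; simpa using hj')
  rw [h1] at hk
  exact P.ne_zero j (by simpa using hk)

variable [P.IsReduced]

/-- The simple roots that occur in a maximal root span an invariant subspace, which is everything
by irreducibility. -/
lemma repr_pos [P.IsIrreducible] (hi : IsMaximalRoot b i) (k : b.support) :
    0 < b.toWeightBasis.repr (P.root i) k := by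
  have hnn := repr_nonneg_of_mem_closure b (mem_closure_simple_of_isPos b hi.isPos)
  refine (hnn k).lt_of_ne' fun hk => ?_
  let J : Set b.support := {k | b.toWeightBasis.repr (P.root i) k ≠ 0}
  let q : Submodule ℝ M := Submodule.span ℝ (b.toWeightBasis '' J)
  have hq : q = ⊤ := by
    refine RootPairing.IsIrreducible.eq_top_of_invtSubmodule_reflection (P := P) q
      ((b.forall_mem_support_invtSubmodule_iff q).1 fun l hl => ?_) ?_
    · by_cases hlJ : (⟨l, hl⟩ : b.support) ∈ J
      · refine Submodule.mem_invtSubmodule_reflection_of_mem _ _ (Submodule.subset_span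
          ⟨⟨l, hl⟩, hlJ, by simp⟩)
      · refine (Module.End.mem_invtSubmodule _).2 (Submodule.span_le.2 ?_)
        rintro _ ⟨m, hm, rfl⟩
        -- `⟨α_i, α_l^∨⟩ ≥ 0` is a sum of terms `≤ 0`, so `s_l` fixes the roots in `J`
        have hterm : ∀ m : b.support, b.toWeightBasis.repr (P.root i) m * P.pairing m l ≤ 0 := by
          intro m
          by_cases hml : (m : ι) = l
          · have : m = ⟨l, hl⟩ := Subtype.ext hml
            have h0 : b.toWeightBasis.repr (P.root i) m = 0 := by
              rw [this]; simpa [J] using hlJ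
            rw [h0, zero_mul]
          · refine mul_nonpos_of_nonneg_of_nonpos (hnn m) ?_
            rw [← P.algebraMap_pairingIn ℤ]
            exact Int.cast_nonpos.2 (b.pairingIn_le_zero_of_ne hml m.2 hl)
        have hsum := hi.pairing_nonneg hl
        rw [pairing_eq_sum b] at hsum
        have hz := (Finset.sum_eq_zero_iff_of_nonpos (fun m _ => hterm m)).1
          (le_antisymm (Finset.sum_nonpos fun m _ => hterm m) hsum) m (Finset.mem_univ _)
        have hml : P.pairing m l = 0 := (mul_eq_zero.1 hz).resolve_left hm
        have : P.reflection l (P.root m) = P.root m := by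
          rw [P.reflection_apply_root, hml, zero_smul, sub_zero]
        simp only [SetLike.mem_coe, Submodule.mem_comap, LinearEquiv.coe_coe,
          RootPairing.Base.toWeightBasis_apply]
        rw [this]
        exact Submodule.subset_span ⟨m, hm, by simp⟩
    · intro hbot
      refine P.ne_zero i ?_
      rw [← b.toWeightBasis.sum_repr (P.root i)]
      refine Finset.sum_eq_zero fun m _ => ?_
      by_cases hm : m ∈ J
      · have : b.toWeightBasis m ∈ q := Submodule.subset_span ⟨m, hm, rfl⟩
        rw [hbot, Submodule.mem_bot] at this
        rw [this, smul_zero]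
      · have : b.toWeightBasis.repr (P.root i) m = 0 := by simpa [J] using hm
        rw [this, zero_smul]
  have hmem : b.toWeightBasis k ∈ q := hq ▸ Submodule.mem_top
  exact (b.toWeightBasis.linearIndependent.notMem_span_image (by simpa [J] using hk)) hmem

/-- Two maximal roots pair positively, because one is a positive combination of all the simple
roots and the other one is dominant. If they were distinct, their difference would be a root,
positive or negative, so that one of them would lie above the other. -/
lemma eq [P.IsIrreducible] (hi : IsMaximalRoot b i) (hj : IsMaximalRoot b j) : i = j := by
  by_contra hne
  obtain ⟨k₀, hk₀, hpos⟩ := hj.isPos.exists_mem_support_pos_pairingIn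
  have hnn : ∀ k : b.support, 0 ≤ P.pairing k j := fun k => by
    have h := hj.pairing_nonneg k.2
    rw [← P.algebraMap_pairingIn ℤ] at h ⊢
    have h' : 0 ≤ P.pairingIn ℤ j k := by simpa using h
    have : 0 ≤ P.pairingIn ℤ k j := by
      by_contra! hlt
      have := (P.pairingIn_lt_zero_iff ℤ).1 hlt
      omega
    simpa using this
  have h1 : 0 < P.pairing i j := by
    rw [pairing_eq_sum b]
    refine Finset.sum_pos' (fun k _ => mul_nonneg (hi.repr_pos k).le (hnn k))
      ⟨⟨k₀, hk₀⟩, Finset.mem_univ _, mul_pos (hi.repr_pos _) ?_⟩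
    rw [← P.algebraMap_pairingIn ℤ]
    simpa using hpos
  have h2 : 0 < P.pairingIn ℤ i j := by
    rw [← P.algebraMap_pairingIn ℤ] at h1
    simpa using h1
  obtain ⟨k, hk⟩ := P.root_sub_root_mem_of_pairingIn_pos h2 hne
  by_cases hkp : b.IsPos k
  · exact hne (hj i (hk ▸ mem_closure_simple_of_isPos b hkp))
  · have := neg_mem_closure_simple_of_not_isPos b hkp
    rw [hk, neg_sub] at this
    exact hne (hi j this).symm

end IsMaximalRoot

variable [Nonempty ι] [P.IsReduced] [P.IsIrreducible]

theorem isHighestRoot_highestRoot : IsHighestRoot b (highestRoot b) := by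
  refine Classical.epsilon_spec (p := IsHighestRoot b) ?_
  obtain ⟨i, hi, -⟩ := exists_isMaximalRoot_ge b (Classical.arbitrary ι)
  refine ⟨i, fun j => ?_⟩
  obtain ⟨k, hk, hjk⟩ := exists_isMaximalRoot_ge b j
  rwa [hi.eq hk]

lemma repr_le_highestCoeff (i : ι) (k : b.support) :
    b.toWeightBasis.repr (P.root i) k ≤ highestCoeff b k := by
  have := repr_nonneg_of_mem_closure b (isHighestRoot_highestRoot b i) k
  simpa [highestCoeff] using this

lemma one_le_highestCoeff (k : b.support) : 1 ≤ highestCoeff b k := by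
  simpa using repr_le_highestCoeff b k k

lemma highestCoeff_pos (k : b.support) : 0 < highestCoeff b k :=
  zero_lt_one.trans_le (one_le_highestCoeff b k)

lemma isPos_highestRoot : b.IsPos (highestRoot b) := by
  by_contra h
  obtain ⟨k, hk⟩ := b.support_nonempty
  have h1 := repr_nonneg_of_mem_closure b (neg_mem_closure_simple_of_not_isPos b h) ⟨k, hk⟩
  have h2 := highestCoeff_pos b ⟨k, hk⟩
  simp only [map_neg, Finsupp.coe_neg, Pi.neg_apply] at h1
  simp only [highestCoeff] at h2
  linarith

end HighestRoot

/-! ### Affine roots and reflections -/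

lemma apply_inv_apply {N : Type*} [AddCommGroup N] [Module ℝ N] (g : N ≃ᵃ[ℝ] N) (x : N) :
    g (g⁻¹ x) = x := g.apply_symm_apply x

lemma inv_apply_apply {N : Type*} [AddCommGroup N] [Module ℝ N] (g : N ≃ᵃ[ℝ] N) (x : N) :
    g⁻¹ (g x) = x := g.symm_apply_apply x

section AffineRoots

variable {ι M N : Type*} [AddCommGroup M] [Module ℝ M] [AddCommGroup N] [Module ℝ N]
  (P : RootPairing ι ℝ M N)

/-- The affine root `λ ↦ ⟨λ, α⟩ + k`, encoded by the index of the root `α` and the integer `k`. -/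
def affRoot (a : ι × ℤ) (x : N) : ℝ := P.root' a.1 x + a.2

/-- The reflection `λ ↦ λ - (⟨λ, α⟩ + k) α^∨` in the zero set of an affine root. -/
def affRefl (a : ι × ℤ) : N ≃ᵃ[ℝ] N :=
  AffineEquiv.constVAdd ℝ N (-(a.2 : ℝ) • P.coroot a.1) * refl P a.1

/-- The opposite of an affine root. -/
def negAff (a : ι × ℤ) : ι × ℤ := (P.reflectionPerm a.1 a.1, -a.2)

/-- The composite of the affine root `a` with the reflection in the affine root `c`, where the
integer `m` is the pairing of the root of `a` with the coroot of `c`. -/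
def reflAff [P.IsCrystallographic] (c a : ι × ℤ) : ι × ℤ :=
  (P.reflectionPerm c.1 a.1, a.2 - P.pairingIn ℤ a.1 c.1 * c.2)

variable {P}

lemma refl_apply (i : ι) (x : N) : refl P i x = x - P.root' i x • P.coroot i :=
  P.coreflection_apply i x

lemma affRefl_apply (a : ι × ℤ) (x : N) :
    affRefl P a x = x - affRoot P a x • P.coroot a.1 := by
  change -(a.2 : ℝ) • P.coroot a.1 + refl P a.1 x = _
  rw [refl_apply, affRoot, add_smul, neg_smul]
  abel

lemma affRoot_negAff (a : ι × ℤ) (x : N) : affRoot P (negAff P a) x = -affRoot P a x := by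
  simp [affRoot, negAff, RootPairing.root']
  ring

lemma affRoot_reflAff [P.IsCrystallographic] (c a : ι × ℤ) (x : N) :
    affRoot P (reflAff P c a) x = affRoot P a (affRefl P c x) := by
  rw [affRefl_apply]
  have h := P.algebraMap_pairingIn ℤ a.1 c.1
  rw [algebraMap_int_eq, eq_intCast] at h
  simp only [affRoot, reflAff, RootPairing.root', P.root_reflectionPerm, P.reflection_apply_root,
    map_sub, map_smul, LinearMap.sub_apply, LinearMap.smul_apply, smul_eq_mul,
    P.root_coroot_eq_pairing]
  push_cast
  rw [h]
  ring

lemma affRoot_affRefl_self (a : ι × ℤ) (x : N) :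
    affRoot P a (affRefl P a x) = -affRoot P a x := by
  simp only [affRefl_apply, affRoot, RootPairing.root', map_sub, map_smul,
    P.root_coroot_two, smul_eq_mul]
  ring

@[simp]
lemma affRefl_affRefl (a : ι × ℤ) (x : N) : affRefl P a (affRefl P a x) = x := by
  rw [affRefl_apply a (affRefl P a x), affRoot_affRefl_self, affRefl_apply]
  simp

lemma affRefl_mul_self (a : ι × ℤ) : affRefl P a * affRefl P a = 1 :=
  AffineEquiv.ext fun x => affRefl_affRefl a x

lemma affRefl_eq_self_iff (a : ι × ℤ) (x : N) : affRefl P a x = x ↔ affRoot P a x = 0 := by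
  rw [affRefl_apply, sub_eq_self]
  refine ⟨fun h => ?_, fun h => by rw [h, zero_smul]⟩
  exact (smul_eq_zero.1 h).resolve_right (P.flip.ne_zero a.1)

/-- The conjugate of a reflection by a reflection is a reflection. -/
lemma affRefl_mul_affRefl [P.IsCrystallographic] (c a : ι × ℤ) :
    affRefl P a * affRefl P c = affRefl P c * affRefl P (reflAff P c a) := by
  refine AffineEquiv.ext fun x => ?_
  change affRefl P a (affRefl P c x) = affRefl P c (affRefl P (reflAff P c a) x)
  have h1 : affRefl P (reflAff P c a) x =
      x - affRoot P a (affRefl P c x) • P.coroot (reflAff P c a).1 := by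
    rw [affRefl_apply, affRoot_reflAff]
  rw [affRefl_apply a, h1, affRefl_apply c, affRefl_apply c (x - _)]
  generalize affRoot P a _ = t
  simp only [affRoot, reflAff, P.coroot_reflectionPerm, P.coreflection_apply, map_sub, map_smul,
    smul_sub, P.root'_coroot_eq_pairing, smul_eq_mul, P.pairing_same]
  module

/-- The affine transformations of `V*` that permute the affine roots and the reflections in
them. -/
def affRootGroup (P : RootPairing ι ℝ M N) : Subgroup (N ≃ᵃ[ℝ] N) where
  carrier := {g | (∀ a, ∃ a', (∀ x, affRoot P a (g x) = affRoot P a' x) ∧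
      affRefl P a * g = g * affRefl P a') ∧
    ∀ a, ∃ a', (∀ x, affRoot P a (g⁻¹ x) = affRoot P a' x) ∧
      affRefl P a * g⁻¹ = g⁻¹ * affRefl P a'}
  one_mem' := ⟨fun a => ⟨a, fun _ => rfl, rfl⟩, fun a => ⟨a, fun _ => rfl, rfl⟩⟩
  mul_mem' := by
    have key : ∀ g h : N ≃ᵃ[ℝ] N,
        (∀ a, ∃ a', (∀ x, affRoot P a (g x) = affRoot P a' x) ∧
          affRefl P a * g = g * affRefl P a') →
        (∀ a, ∃ a', (∀ x, affRoot P a (h x) = affRoot P a' x) ∧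
          affRefl P a * h = h * affRefl P a') →
        ∀ a, ∃ a', (∀ x, affRoot P a ((g * h) x) = affRoot P a' x) ∧
          affRefl P a * (g * h) = (g * h) * affRefl P a' := by
      intro g h hg hh a
      obtain ⟨a', ha', hr'⟩ := hg a
      obtain ⟨a'', ha'', hr''⟩ := hh a'
      refine ⟨a'', fun x => (ha' (h x)).trans (ha'' x), ?_⟩
      rw [← mul_assoc, hr', mul_assoc, hr'', mul_assoc]
    rintro g h ⟨hg, hg'⟩ ⟨hh, hh'⟩
    refine ⟨key g h hg hh, ?_⟩
    rw [mul_inv_rev]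
    exact key _ _ hh' hg'
  inv_mem' := by
    rintro g ⟨hg, hg'⟩
    exact ⟨hg', by simpa using hg⟩

lemma exists_affRoot_eq {g : N ≃ᵃ[ℝ] N} (hg : g ∈ affRootGroup P) (a : ι × ℤ) :
    ∃ a', (∀ x, affRoot P a (g x) = affRoot P a' x) ∧ affRefl P a * g = g * affRefl P a' :=
  hg.1 a

lemma affRefl_mem_affRootGroup [P.IsCrystallographic] (a : ι × ℤ) :
    affRefl P a ∈ affRootGroup P := by
  have h : (affRefl P a)⁻¹ = affRefl P a := inv_eq_of_mul_eq_one_left (affRefl_mul_self a)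
  have : ∀ c, ∃ a', (∀ x, affRoot P c (affRefl P a x) = affRoot P a' x) ∧
      affRefl P c * affRefl P a = affRefl P a * affRefl P a' :=
    fun c => ⟨reflAff P a c, fun x => (affRoot_reflAff a c x).symm, affRefl_mul_affRefl a c⟩
  exact ⟨this, by rwa [h]⟩

lemma constVAdd_mem_affRootGroup {y : N} (hy : y ∈ coweightLattice P) :
    AffineEquiv.constVAdd ℝ N y ∈ affRootGroup P := by
  have key : ∀ y ∈ coweightLattice P, ∀ a : ι × ℤ,
      ∃ a', (∀ x, affRoot P a (y + x) = affRoot P a' x) ∧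
        ∀ x, affRefl P a (y + x) = y + affRefl P a' x := by
    intro y hy a
    obtain ⟨k, hk⟩ := hy a.1
    have h : ∀ x, affRoot P a (y + x) = affRoot P (a.1, a.2 + k) x := fun x => by
      rw [affRoot, map_add, hk, affRoot]
      push_cast
      ring
    refine ⟨(a.1, a.2 + k), h, fun x => ?_⟩
    rw [affRefl_apply, h, affRefl_apply, add_sub_assoc]
  have key' : ∀ y ∈ coweightLattice P, ∀ a : ι × ℤ,
      ∃ a', (∀ x, affRoot P a (AffineEquiv.constVAdd ℝ N y x) = affRoot P a' x) ∧
        affRefl P a * AffineEquiv.constVAdd ℝ N y = AffineEquiv.constVAdd ℝ N y * affRefl P a' := by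
    intro y hy a
    obtain ⟨a', h, h'⟩ := key y hy a
    exact ⟨a', h, AffineEquiv.ext h'⟩
  have hinv : (AffineEquiv.constVAdd ℝ N y)⁻¹ = AffineEquiv.constVAdd ℝ N (-y) :=
    inv_eq_of_mul_eq_one_left (AffineEquiv.ext fun x => neg_add_cancel_left y x)
  exact ⟨key' y hy, hinv ▸ key' (-y) (neg_mem hy)⟩

lemma refl_eq_affRefl (i : ι) : refl P i = affRefl P (i, 0) := by
  refine AffineEquiv.ext fun x => ?_
  rw [refl_apply, affRefl_apply]
  simp [affRoot]

lemma weyl_le_affRootGroup [P.IsCrystallographic] : weyl P ≤ affRootGroup P := by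
  rw [weyl, Subgroup.closure_le]
  rintro _ ⟨i, rfl⟩
  rw [refl_eq_affRefl]
  exact affRefl_mem_affRootGroup _

lemma WLattice.extWeyl_le_affRootGroup [P.IsCrystallographic] (Y : WLattice P) :
    Y.extWeyl ≤ affRootGroup P := by
  refine sup_le ?_ weyl_le_affRootGroup
  intro g hg
  obtain ⟨y, hy, rfl⟩ := Y.mem_translations.1 hg
  exact constVAdd_mem_affRootGroup (Y.le_coweight hy)

end AffineRoots

/-! ### Simple affine roots and barycentric coordinates -/

section Simple

variable {ι M N : Type*} [AddCommGroup M] [Module ℝ M] [AddCommGroup N] [Module ℝ N]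
  {P : RootPairing ι ℝ M N} (b : P.Base) [Nonempty ι]

/-- The simple affine roots: `1 - α₀` and the simple roots. The index of `-α₀` is obtained by
reflecting `α₀` in itself. -/
def simpleAff : Node b → ι × ℤ
  | none => (P.reflectionPerm (highestRoot b) (highestRoot b), 1)
  | some i => (i, 0)

lemma affRoot_simpleAff_none (x : N) :
    affRoot P (simpleAff b none) x = 1 - P.root' (highestRoot b) x := by
  simp [affRoot, simpleAff, RootPairing.root']
  ring

lemma affRoot_simpleAff_some (i : b.support) (x : N) :
    affRoot P (simpleAff b (some i)) x = P.root' i x := by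
  simp [affRoot, simpleAff]

lemma simpleAffineReflection_eq (j : Node b) :
    simpleAffineReflection b j = affRefl P (simpleAff b j) := by
  refine AffineEquiv.ext fun x => ?_
  cases j with
  | none =>
    rw [affRefl_apply, affRoot_simpleAff_none]
    change P.coroot (highestRoot b) + refl P (highestRoot b) x = _
    rw [refl_apply]
    simp only [simpleAff, P.coroot_reflectionPerm, P.coreflection_apply_self]
    module
  | some i =>
    change refl P i x = _
    rw [refl_eq_affRefl]
    rfl

lemma affineWeyl_le_affRootGroup [P.IsCrystallographic] : affineWeyl b ≤ affRootGroup P := by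
  rw [affineWeyl, Subgroup.closure_le]
  rintro _ ⟨i, rfl⟩
  rw [simpleAffineReflection_eq]
  exact affRefl_mem_affRootGroup _

variable [P.IsRootSystem]

/-- The coefficients `n_i` of the highest root, with `n_0 = 1`. -/
def nodeCoeff : Node b → ℝ
  | none => 1
  | some i => highestCoeff b i

/-- The barycentric coordinates of a point of `V*` with respect to the vertices of the
fundamental alcove. -/
def coord (j : Node b) (x : N) : ℝ := nodeCoeff b j * affRoot P (simpleAff b j) x

omit [Nonempty ι] in
lemma root'_eq_sum (i : ι) (x : N) :
    P.root' i x = ∑ k : b.support, b.toWeightBasis.repr (P.root i) k * P.root' k x := by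
  conv_lhs => rw [RootPairing.root', ← b.toWeightBasis.sum_repr (P.root i)]
  simp [RootPairing.root']

lemma root'_highestRoot (x : N) :
    P.root' (highestRoot b) x = ∑ k : b.support, highestCoeff b k * P.root' k x :=
  root'_eq_sum b _ x

lemma sum_coord (x : N) : ∑ j, coord b j x = 1 := by
  rw [Fintype.sum_option]
  simp only [coord, nodeCoeff, affRoot_simpleAff_none, affRoot_simpleAff_some, root'_highestRoot b]
  ring

omit [Nonempty ι] in
/-- The simple roots separate the points of `V*`. -/
lemma ext_of_root' {x y : N} (h : ∀ i : b.support, P.root' i x = P.root' i y) : x = y := by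
  have : P.toLinearMap.flip x = P.toLinearMap.flip y :=
    b.toWeightBasis.ext fun i => by simpa using h i
  exact P.toLinearMap.flip.toPerfPair.injective this

end Simple

/-! ### The fundamental alcove and positive affine roots -/

section FundamentalAlcove

variable {ι M N : Type*} [AddCommGroup M] [Module ℝ M] [AddCommGroup N] [Module ℝ N]
  {P : RootPairing ι ℝ M N} (b : P.Base) [Nonempty ι]
  [Finite ι] [P.IsCrystallographic] [P.IsReduced] [P.IsIrreducible]

lemma nodeCoeff_pos (j : Node b) : 0 < nodeCoeff b j := by
  cases j with
  | none => exact one_pos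
  | some i => exact highestCoeff_pos b i

open Classical in
lemma affRoot_simpleAff_vertex (i j : Node b) :
    affRoot P (simpleAff b j) (alcoveVertex b i) = if i = j then (nodeCoeff b j)⁻¹ else 0 := by
  cases j with
  | none =>
    rw [affRoot_simpleAff_none]
    cases i with
    | none => simp [alcoveVertex, nodeCoeff]
    | some i =>
      rw [alcoveVertex, map_smul, root'_highestRoot b, if_neg (by simp)]
      simp_rw [root'_fundamentalCoweight]
      have := (highestCoeff_pos b i).ne'
      simp [this]
  | some j =>
    rw [affRoot_simpleAff_some]
    cases i with
    | none => simp [alcoveVertex]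
    | some i =>
      rw [alcoveVertex, map_smul, root'_fundamentalCoweight]
      by_cases h : j = i
      · subst h; simp [nodeCoeff]
      · have h' : ¬ i = j := fun h' => h h'.symm
        simp [h, h']

open Classical in
lemma coord_vertex (i j : Node b) : coord b j (alcoveVertex b i) = if i = j then 1 else 0 := by
  rw [coord, affRoot_simpleAff_vertex, mul_ite, mul_zero, mul_inv_cancel₀ (nodeCoeff_pos b j).ne']

lemma sum_coord_smul (x : N) : ∑ j, coord b j x • alcoveVertex b j = x := by
  classical
  refine ext_of_root' b fun k => ?_
  rw [map_sum]
  simp_rw [map_smul, ← affRoot_simpleAff_some, affRoot_simpleAff_vertex, smul_eq_mul]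
  simp [coord, nodeCoeff]
  have := (highestCoeff_pos b k).ne'
  field_simp

/-- Affine roots are affine functions, hence determined by their values on the vertices of the
alcove. -/
lemma affRoot_eq_sum (a : ι × ℤ) (x : N) :
    affRoot P a x = ∑ j, coord b j x * affRoot P a (alcoveVertex b j) := by
  conv_lhs => rw [affRoot, ← sum_coord_smul b x]
  simp only [affRoot, mul_add, Finset.sum_add_distrib, ← Finset.sum_mul, sum_coord, map_sum,
    map_smul, smul_eq_mul, one_mul]

omit [P.IsReduced] in
lemma root'_fundamental_nonneg {i : ι} (hi : b.IsPos i) {x : N}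
    (hx : ∀ k : b.support, 0 ≤ P.root' k x) : 0 ≤ P.root' i x := by
  rw [root'_eq_sum b]
  exact Finset.sum_nonneg fun k _ => mul_nonneg
    (repr_nonneg_of_mem_closure b (mem_closure_simple_of_isPos b hi) k) (hx k)

lemma root'_le_highestRoot (i : ι) {x : N} (hx : ∀ k : b.support, 0 ≤ P.root' k x) :
    P.root' i x ≤ P.root' (highestRoot b) x := by
  rw [root'_eq_sum b, root'_highestRoot b]
  exact Finset.sum_le_sum fun k _ => mul_le_mul_of_nonneg_right (repr_le_highestCoeff b i k) (hx k)

omit [P.IsReduced] in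
lemma root'_pos_of_forall_pos {i : ι} (hi : b.IsPos i) {x : N}
    (hx : ∀ k : b.support, 0 < P.root' k x) : 0 < P.root' i x := by
  have h0 := repr_nonneg_of_mem_closure b (mem_closure_simple_of_isPos b hi)
  have hne : ∃ k, b.toWeightBasis.repr (P.root i) k ≠ 0 := by
    by_contra! h
    exact P.ne_zero i (b.toWeightBasis.ext_elem fun k => by simpa using h k)
  obtain ⟨k, hk⟩ := hne
  rw [root'_eq_sum b]
  exact Finset.sum_pos' (fun k _ => mul_nonneg (h0 k) (hx k).le)
    ⟨k, Finset.mem_univ _, mul_pos ((h0 k).lt_of_ne' hk) (hx k)⟩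

/-- The open fundamental alcove is cut out by the simple affine roots. -/
lemma mem_alcove_iff (x : N) : x ∈ alcove b ↔ ∀ j, 0 < affRoot P (simpleAff b j) x := by
  constructor
  · intro hx j
    cases j with
    | none =>
      rw [affRoot_simpleAff_none]
      linarith [(hx _ (isPos_highestRoot b)).2]
    | some j =>
      rw [affRoot_simpleAff_some]
      exact (hx j (b.isPos_of_mem_support j.2)).1
  · intro hx i hi
    have h1 : ∀ k : b.support, 0 < P.root' k x := fun k => by
      simpa [affRoot_simpleAff_some] using hx (some k)
    have h2 := hx none
    rw [affRoot_simpleAff_none] at h2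
    exact ⟨root'_pos_of_forall_pos b hi h1,
      by linarith [root'_le_highestRoot b i (fun k => (h1 k).le)]⟩

/-- The closed fundamental alcove. -/
def closedAlcove : Set N := {x | ∀ j, 0 ≤ affRoot P (simpleAff b j) x}

/-- An affine root is positive if it is nonnegative on the fundamental alcove, that is, at the
vertices. -/
def IsPosAff (a : ι × ℤ) : Prop := ∀ j, 0 ≤ affRoot P a (alcoveVertex b j)

variable {b}

lemma coord_nonneg {x : N} (hx : x ∈ closedAlcove b) (j : Node b) : 0 ≤ coord b j x :=
  mul_nonneg (nodeCoeff_pos b j).le (hx j)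

lemma coord_pos {x : N} (hx : x ∈ alcove b) (j : Node b) : 0 < coord b j x :=
  mul_pos (nodeCoeff_pos b j) ((mem_alcove_iff b x).1 hx j)

lemma mem_closedAlcove_iff_coord {x : N} : x ∈ closedAlcove b ↔ ∀ j, 0 ≤ coord b j x :=
  ⟨coord_nonneg, fun h j => (mul_nonneg_iff_of_pos_left (nodeCoeff_pos b j)).1 (h j)⟩

lemma mem_alcove_iff_coord {x : N} : x ∈ alcove b ↔ ∀ j, 0 < coord b j x :=
  ⟨coord_pos, fun h => (mem_alcove_iff b x).2
    fun j => (mul_pos_iff_of_pos_left (nodeCoeff_pos b j)).1 (h j)⟩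

lemma coord_eq_zero_iff {x : N} {j : Node b} :
    coord b j x = 0 ↔ affRoot P (simpleAff b j) x = 0 := by
  rw [coord, mul_eq_zero, or_iff_right (nodeCoeff_pos b j).ne']

lemma alcove_subset_closedAlcove : alcove b ⊆ closedAlcove b :=
  fun x hx j => ((mem_alcove_iff b x).1 hx j).le

lemma isPosAff_simpleAff (j : Node b) : IsPosAff b (simpleAff b j) := by
  classical
  intro i
  rw [affRoot_simpleAff_vertex]
  split_ifs
  · exact inv_nonneg.2 (nodeCoeff_pos b j).le
  · exact le_rfl

lemma alcoveVertex_mem_closedAlcove (i : Node b) : alcoveVertex b i ∈ closedAlcove b :=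
  fun j => isPosAff_simpleAff j i

/-- Positive roots take values in `[0, 1]` on the vertices of the alcove, so that no affine root
changes its sign on the alcove. -/
lemma isPosAff_or_negAff (a : ι × ℤ) : IsPosAff b a ∨ IsPosAff b (negAff P a) := by
  have key : ∀ a : ι × ℤ, b.IsPos a.1 → IsPosAff b a ∨ IsPosAff b (negAff P a) := by
    intro a ha
    have h1 : ∀ i (k : b.support), 0 ≤ P.root' k (alcoveVertex b i) := fun i k => by
      simpa [affRoot_simpleAff_some] using alcoveVertex_mem_closedAlcove i (some k)
    rcases le_or_gt 0 a.2 with hk | hk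
    · left
      intro i
      exact add_nonneg (root'_fundamental_nonneg b ha (h1 i)) (Int.cast_nonneg hk)
    · right
      intro i
      rw [affRoot_negAff, affRoot]
      have h2 := alcoveVertex_mem_closedAlcove i none
      rw [affRoot_simpleAff_none] at h2
      have h3 : (a.2 : ℝ) ≤ -1 := by exact_mod_cast Int.le_sub_one_of_lt hk
      linarith [root'_le_highestRoot b a.1 (h1 i)]
  let := P.indexNeg
  rcases RootPairing.Base.IsPos.or_neg b a.1 with h | h
  · exact key a h
  · rcases key (negAff P a) h with h' | h'
    · exact .inr h'
    · refine .inl fun i => ?_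
      simpa [affRoot_negAff] using h' i

/-- Affine roots are not constant. -/
lemma exists_affRoot_vertex_ne_zero (a : ι × ℤ) : ∃ j, affRoot P a (alcoveVertex b j) ≠ 0 := by
  by_contra! h
  have h0 : ∀ x, affRoot P a x = 0 := fun x => by
    rw [affRoot_eq_sum b]
    exact Finset.sum_eq_zero fun j _ => by rw [h j, mul_zero]
  have h1 := h0 0
  have h2 := h0 (P.coroot a.1)
  simp only [affRoot, map_zero, zero_add] at h1
  simp only [affRoot, h1, add_zero, RootPairing.root', P.root_coroot_two] at h2
  norm_num at h2

namespace IsPosAff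

lemma nonneg {a : ι × ℤ} (ha : IsPosAff b a) {x : N} (hx : x ∈ closedAlcove b) :
    0 ≤ affRoot P a x := by
  rw [affRoot_eq_sum b]
  exact Finset.sum_nonneg fun j _ => mul_nonneg (coord_nonneg hx j) (ha j)

lemma pos {a : ι × ℤ} (ha : IsPosAff b a) {x : N} (hx : x ∈ alcove b) : 0 < affRoot P a x := by
  obtain ⟨j, hj⟩ := exists_affRoot_vertex_ne_zero (b := b) a
  rw [affRoot_eq_sum b]
  exact Finset.sum_pos' (fun j _ => mul_nonneg (coord_pos hx j).le (ha j))
    ⟨j, Finset.mem_univ _, mul_pos (coord_pos hx j) ((ha j).lt_of_ne' hj)⟩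

lemma not_negAff {a : ι × ℤ} (ha : IsPosAff b a) : ¬ IsPosAff b (negAff P a) := by
  intro h
  obtain ⟨j, hj⟩ := exists_affRoot_vertex_ne_zero (b := b) a
  have h1 := h j
  rw [affRoot_negAff] at h1
  exact hj (le_antisymm (by linarith) (ha j))

/-- A positive affine root that vanishes at all the vertices of the alcove but one is a multiple of
a simple affine root, hence equal to it. -/
lemma eq_simpleAff {a : ι × ℤ} (ha : IsPosAff b a) {j : Node b}
    (hz : ∀ i, i ≠ j → affRoot P a (alcoveVertex b i) = 0) : a = simpleAff b j := by
  set c := nodeCoeff b j * affRoot P a (alcoveVertex b j) with hc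
  have hc0 : 0 ≤ c := mul_nonneg (nodeCoeff_pos b j).le (ha j)
  have hax : ∀ x, affRoot P a x = c * affRoot P (simpleAff b j) x := by
    intro x
    rw [affRoot_eq_sum b, Finset.sum_eq_single j (fun i _ hij => by rw [hz i hij, mul_zero])
      (by simp), hc, coord]
    ring
  have h0 := hax 0
  simp only [affRoot, map_zero, zero_add] at h0
  have hlin : ∀ x, P.root' a.1 x = c * P.root' (simpleAff b j).1 x := by
    intro x
    have := hax x
    simp only [affRoot, mul_add, h0] at this
    linarith
  have hroot : P.root a.1 = c • P.root (simpleAff b j).1 := by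
    refine P.toLinearMap.toPerfPair.injective (LinearMap.ext fun x => ?_)
    simpa [RootPairing.root'] using hlin x
  have hcne : c ≠ 0 := by
    rintro h
    rw [h, zero_smul] at hroot
    exact P.ne_zero _ hroot
  have hdep : ¬ LinearIndependent ℝ ![P.root a.1, P.root (simpleAff b j).1] := by
    rw [LinearIndependent.pair_iff]
    push Not
    exact ⟨1, -c, by rw [hroot]; module, fun h => absurd h one_ne_zero⟩
  have h2 : ∀ z : ℝ, P.root a.1 = z • P.root (simpleAff b j).1 → c = z := fun z hz => by
    rw [hroot] at hz
    exact smul_left_injective ℝ (P.ne_zero _) hz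
  rcases RootPairing.IsReduced.eq_or_eq_neg (P := P) a.1 (simpleAff b j).1 hdep with h | h
  · have hc1 : c = 1 := h2 1 (by rw [h, one_smul])
    rw [hc1, one_mul] at h0
    exact Prod.ext (P.root.injective h) (by exact_mod_cast h0)
  · have hc1 : c = -1 := h2 (-1) (by rw [h, neg_one_smul])
    linarith

/-- A simple reflection makes only one positive affine root negative. -/
lemma reflAff {a : ι × ℤ} (ha : IsPosAff b a) {j : Node b} (hj : a ≠ simpleAff b j) :
    IsPosAff b (reflAff P (simpleAff b j) a) := by
  classical
  refine (isPosAff_or_negAff _).resolve_right fun hneg => hj (ha.eq_simpleAff fun i hij => ?_)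
  have h1 : affRefl P (simpleAff b j) (alcoveVertex b i) = alcoveVertex b i := by
    rw [affRefl_eq_self_iff, affRoot_simpleAff_vertex, if_neg hij]
  have h2 := hneg i
  rw [affRoot_negAff, affRoot_reflAff, h1] at h2
  exact le_antisymm (by linarith) (ha i)

end IsPosAff

end FundamentalAlcove

/-! ### The fundamental domain of the affine Weyl group -/

section FundamentalDomain

variable {ι M N : Type*} [AddCommGroup M] [Module ℝ M] [AddCommGroup N] [Module ℝ N]
  {P : RootPairing ι ℝ M N} (b : P.Base) [Nonempty ι]

/-- The product of simple affine reflections given by a word in the nodes. -/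
def wordProd (l : List (Node b)) : N ≃ᵃ[ℝ] N := (l.map (simpleAffineReflection b)).prod

variable {b}

@[simp]
lemma wordProd_nil : wordProd b [] = 1 := rfl

lemma wordProd_cons (j : Node b) (l : List (Node b)) :
    wordProd b (j :: l) = affRefl P (simpleAff b j) * wordProd b l := by
  rw [wordProd, List.map_cons, List.prod_cons, simpleAffineReflection_eq]
  rfl

lemma exists_wordProd_eq {w : N ≃ᵃ[ℝ] N} (hw : w ∈ affineWeyl b) : ∃ l, wordProd b l = w := by
  rw [affineWeyl] at hw
  induction hw using Subgroup.closure_induction'' with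
  | one => exact ⟨[], rfl⟩
  | mem x hx => obtain ⟨j, rfl⟩ := hx; exact ⟨[j], by simp [wordProd]⟩
  | inv_mem x hx =>
    obtain ⟨j, rfl⟩ := hx
    refine ⟨[j], ?_⟩
    rw [wordProd_cons, wordProd_nil, mul_one, simpleAffineReflection_eq]
    exact (inv_eq_of_mul_eq_one_left (affRefl_mul_self _)).symm
  | mul x y _ _ hx hy =>
    obtain ⟨l, rfl⟩ := hx
    obtain ⟨l', rfl⟩ := hy
    exact ⟨l ++ l', by simp [wordProd]⟩

lemma wordProd_mem_affineWeyl (l : List (Node b)) : wordProd b l ∈ affineWeyl b := by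
  induction l with
  | nil => exact one_mem _
  | cons j t ih =>
    rw [wordProd, List.map_cons, List.prod_cons]
    exact mul_mem (Subgroup.subset_closure ⟨j, rfl⟩) ih

lemma parabolic_le_affineWeyl (I : Set (Node b)) : parabolic b I ≤ affineWeyl b :=
  Subgroup.closure_mono (Set.image_subset_range _ _)

variable [Finite ι] [P.IsCrystallographic] [P.IsReduced] [P.IsIrreducible]

/-- The exchange condition: if the hyperplane of the positive affine root `a` separates the
fundamental alcove from its image under a word, then multiplication by the reflection in `a`
amounts to the deletion of a letter. -/
lemma exists_affRefl_mul_wordProd_eq (l : List (Node b)) (a c : ι × ℤ) (ha : IsPosAff b a)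
    (hc : ∀ x, affRoot P a (wordProd b l x) = affRoot P c x) (hneg : ¬ IsPosAff b c) :
    ∃ l', l'.length + 1 = l.length ∧ affRefl P a * wordProd b l = wordProd b l' := by
  induction l generalizing a with
  | nil => exact absurd (fun j => (ha j).trans_eq (hc _)) hneg
  | cons j t ih =>
    by_cases haj : a = simpleAff b j
    · refine ⟨t, rfl, ?_⟩
      rw [wordProd_cons, haj, ← mul_assoc, affRefl_mul_self, one_mul]
    · obtain ⟨l', hl', hw⟩ := ih (reflAff P (simpleAff b j) a) (ha.reflAff haj) fun x => by
        rw [affRoot_reflAff, ← hc, wordProd_cons]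
        rfl
      refine ⟨j :: l', by simp [← hl'], ?_⟩
      rw [wordProd_cons, wordProd_cons, ← hw, ← mul_assoc, affRefl_mul_affRefl, mul_assoc]

/-- The closed fundamental alcove is a strict fundamental domain for the affine Weyl group, and the
stabilizers of its points are generated by simple reflections. -/
theorem eq_self_and_mem_parabolic {w : N ≃ᵃ[ℝ] N} (hw : w ∈ affineWeyl b) {x : N}
    (hx : x ∈ closedAlcove b) (hwx : w x ∈ closedAlcove b) :
    w x = x ∧ w ∈ parabolic b {j | affRoot P (simpleAff b j) x = 0} := by
  obtain ⟨l, rfl⟩ := exists_wordProd_eq hw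
  clear hw
  induction h : l.length using Nat.strong_induction_on generalizing l with
  | _ n ih =>
    cases l with
    | nil => exact ⟨rfl, one_mem _⟩
    | cons j t =>
      obtain ⟨c, hc, -⟩ := exists_affRoot_eq
        (affineWeyl_le_affRootGroup b (wordProd_mem_affineWeyl t)) (simpleAff b j)
      -- `c = a_j ∘ t`: if it is positive, then `s_j` fixes `t x`; if not, a letter can be deleted
      by_cases hcp : IsPosAff b c
      · have h1 : 0 ≤ affRoot P (simpleAff b j) (wordProd b t x) := by
          rw [hc]
          exact hcp.nonneg hx
        rw [wordProd_cons] at hwx ⊢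
        have h2 : 0 ≤ -affRoot P (simpleAff b j) (wordProd b t x) := by
          rw [← affRoot_affRefl_self]
          exact hwx j
        have h0 : affRoot P (simpleAff b j) (wordProd b t x) = 0 := le_antisymm (by linarith) h1
        have hfix : affRefl P (simpleAff b j) (wordProd b t x) = wordProd b t x :=
          (affRefl_eq_self_iff _ _).2 h0
        have hwx' : wordProd b t x ∈ closedAlcove b := hfix ▸ hwx
        obtain ⟨h3, h4⟩ := ih t.length (by simp [← h]) t hwx' rfl
        refine ⟨hfix.trans h3, mul_mem (Subgroup.subset_closure ⟨j, ?_, ?_⟩) h4⟩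
        · rw [h3] at h0
          exact h0
        · exact simpleAffineReflection_eq b j
      · obtain ⟨l', hl', hw⟩ := exists_affRefl_mul_wordProd_eq t (simpleAff b j) c
          (isPosAff_simpleAff j) hc hcp
        rw [wordProd_cons, hw] at hwx ⊢
        exact ih l'.length (by simp [← h, ← hl']) l' hwx rfl

/-- The affine Weyl group acts freely on the alcoves. -/
lemma affineWeyl_eq_one_of_alcove {w : N ≃ᵃ[ℝ] N} (hw : w ∈ affineWeyl b) {x : N}
    (hx : x ∈ alcove b) (hwx : w x ∈ closedAlcove b) : w = 1 := by
  have h := (eq_self_and_mem_parabolic hw (alcove_subset_closedAlcove hx) hwx).2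
  have : {j | affRoot P (simpleAff b j) x = 0} = ∅ := by
    ext j
    simpa using ((mem_alcove_iff b x).1 hx j).ne'
  rw [this, parabolic, Set.image_empty, Subgroup.closure_empty] at h
  exact h

variable (b) in
/-- The positive affine roots that are negative at `x`. -/
def negativeAt (x : N) : Set (ι × ℤ) := {a | IsPosAff b a ∧ affRoot P a x < 0}

omit [P.IsCrystallographic] [P.IsReduced] in
lemma finite_negativeAt (x : N) : (negativeAt b x).Finite := by
  have : negativeAt b x ⊆ ⋃ i, {i} ×ˢ Set.Icc 0 ⌈-P.root' i x⌉ := by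
    rintro ⟨i, k⟩ ⟨h1, h2⟩
    refine Set.mem_iUnion.2 ⟨i, rfl, ?_, ?_⟩
    · have := h1 none
      simp only [affRoot, alcoveVertex, map_zero, zero_add] at this
      exact_mod_cast this
    · simp only [affRoot] at h2
      have : (k : ℝ) ≤ ⌈-P.root' i x⌉ := le_trans (by linarith) (Int.le_ceil _)
      exact_mod_cast this
  exact (Set.finite_iUnion fun i => (Set.finite_singleton i).prod (Set.finite_Icc _ _)).subset this

/-- The reflection in a simple affine root `a_j` that is negative at `x` permutes the positive
affine roots other than `a_j`, and `a_j` itself is no longer negative at `s_j x`. -/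
lemma ncard_negativeAt_lt {x : N} {j : Node b} (hj : affRoot P (simpleAff b j) x < 0) :
    (negativeAt b (affRefl P (simpleAff b j) x)).ncard < (negativeAt b x).ncard := by
  have hinv : ∀ a, reflAff P (simpleAff b j) (reflAff P (simpleAff b j) a) = a := by
    intro a
    have : P.pairingIn ℤ (P.reflectionPerm (simpleAff b j).1 a.1) (simpleAff b j).1 =
        -P.pairingIn ℤ a.1 (simpleAff b j).1 := by
      rw [← P.pairingIn_reflectionPerm]
      simp
    refine Prod.ext (by simp [reflAff]) ?_
    simp only [reflAff, this]
    ring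
  have hmaps : Set.MapsTo (reflAff P (simpleAff b j))
      (negativeAt b (affRefl P (simpleAff b j) x)) (negativeAt b x \ {simpleAff b j}) := by
    rintro a ⟨h1, h2⟩
    have hne : a ≠ simpleAff b j := by
      rintro rfl
      rw [affRoot_affRefl_self] at h2
      linarith
    refine ⟨⟨h1.reflAff hne, by rwa [affRoot_reflAff]⟩, fun h => ?_⟩
    have hs : reflAff P (simpleAff b j) (simpleAff b j) = a :=
      (congrArg (reflAff P (simpleAff b j)) (Set.mem_singleton_iff.1 h)).symm.trans (hinv a)
    have h5 : IsPosAff b (negAff P (simpleAff b j)) := by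
      intro i
      rw [affRoot_negAff, ← affRoot_affRefl_self, ← affRoot_reflAff, hs]
      exact h1 i
    exact (isPosAff_simpleAff j).not_negAff h5
  have hinj : Set.InjOn (reflAff P (simpleAff b j))
      (negativeAt b (affRefl P (simpleAff b j) x)) := fun a _ a' _ h => by
    rw [← hinv a, h, hinv]
  calc _ ≤ (negativeAt b x \ {simpleAff b j}).ncard :=
        Set.ncard_le_ncard_of_injOn _ hmaps hinj ((finite_negativeAt x).subset Set.sdiff_subset)
    _ < _ := Set.ncard_sdiff_singleton_lt_of_mem ⟨isPosAff_simpleAff j, hj⟩ (finite_negativeAt x)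

variable (b) in
/-- The translates of the closed fundamental alcove cover `V*`: as long as a simple affine root is
negative at `x`, the reflection in it lowers the number of positive affine roots that are negative
at `x`. -/
theorem exists_affineWeyl_mem_closedAlcove (x : N) : ∃ w ∈ affineWeyl b, w x ∈ closedAlcove b := by
  induction h : (negativeAt b x).ncard using Nat.strong_induction_on generalizing x with
  | _ n ih =>
    by_cases hx : x ∈ closedAlcove b
    · exact ⟨1, one_mem _, hx⟩
    · simp only [closedAlcove, Set.mem_ofPred_eq, not_forall, not_le] at hx
      obtain ⟨j, hj⟩ := hx
      obtain ⟨w, hw, hwx⟩ := ih _ (h ▸ ncard_negativeAt_lt hj) _ rfl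
      refine ⟨w * affRefl P (simpleAff b j), mul_mem hw (Subgroup.subset_closure ⟨j, ?_⟩), hwx⟩
      exact simpleAffineReflection_eq b j

end FundamentalDomain

/-! ### The stabilizer of the fundamental alcove -/

section AlcoveGroup

lemma affineEquiv_sum_smul {N κ : Type*} [AddCommGroup N] [Module ℝ N] (g : N ≃ᵃ[ℝ] N)
    (s : Finset κ) (t : κ → ℝ) (ht : ∑ i ∈ s, t i = 1) (v : κ → N) :
    g (∑ i ∈ s, t i • v i) = ∑ i ∈ s, t i • g (v i) := by
  have h : ∀ x, g x = g.linear x + g 0 := fun x => by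
    simpa using g.map_vadd 0 x
  simp_rw [h (∑ i ∈ s, t i • v i), h (v _), map_sum, map_smul, smul_add, Finset.sum_add_distrib,
    ← Finset.sum_smul, ht, one_smul]

variable {ι M N : Type*} [AddCommGroup M] [Module ℝ M] [AddCommGroup N] [Module ℝ N]
  {P : RootPairing ι ℝ M N} {b : P.Base} [Nonempty ι]
  [Finite ι] [P.IsCrystallographic] [P.IsReduced] [P.IsIrreducible]

omit [Finite ι] [P.IsCrystallographic] [P.IsReduced] in
lemma coord_sum_smul {κ : Type*} (s : Finset κ) (t : κ → ℝ) (ht : ∑ i ∈ s, t i = 1) (v : κ → N)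
    (j : Node b) : coord b j (∑ i ∈ s, t i • v i) = ∑ i ∈ s, t i * coord b j (v i) := by
  simp only [coord, affRoot, map_sum, map_smul, smul_eq_mul]
  have h : ((simpleAff b j).2 : ℝ) = ∑ i ∈ s, t i * (simpleAff b j).2 := by
    rw [← Finset.sum_mul, ht, one_mul]
  conv_lhs => rw [h, ← Finset.sum_add_distrib, Finset.mul_sum]
  exact Finset.sum_congr rfl fun i _ => by ring

lemma coord_sum_smul_vertex (t : Node b → ℝ) (ht : ∑ i, t i = 1) (j : Node b) :
    coord b j (∑ i, t i • alcoveVertex b i) = t j := by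
  classical
  rw [coord_sum_smul _ _ ht]
  simp [coord_vertex]

lemma ext_coord {x y : N} (h : ∀ j, coord b j x = coord b j y) : x = y := by
  rw [← sum_coord_smul b x, ← sum_coord_smul b y]
  simp [h]

lemma alcove_nonempty : (alcove b).Nonempty := by
  refine ⟨∑ i, (Fintype.card (Node b) : ℝ)⁻¹ • alcoveVertex b i, mem_alcove_iff_coord.2 fun j => ?_⟩
  have : (0 : ℝ) < Fintype.card (Node b) := by exact_mod_cast Fintype.card_pos
  rw [coord_sum_smul_vertex _ (by rw [Finset.sum_const, Finset.card_univ, nsmul_eq_mul,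
    mul_inv_cancel₀ this.ne'])]
  positivity

/-- A transformation that permutes the affine roots and maps a point of the alcove into the closed
alcove maps the alcove into itself. -/
lemma mapsTo_alcove {g : N ≃ᵃ[ℝ] N} (hg : g ∈ affRootGroup P) {x : N} (hx : x ∈ alcove b)
    (hgx : g x ∈ closedAlcove b) : Set.MapsTo g (alcove b) (alcove b) := by
  intro y hy
  refine (mem_alcove_iff b _).2 fun j => ?_
  obtain ⟨c, hc, -⟩ := exists_affRoot_eq hg (simpleAff b j)
  rw [hc]
  refine IsPosAff.pos ((isPosAff_or_negAff c).resolve_right fun h => ?_) hy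
  have h1 := h.pos hx
  have h2 := hgx j
  rw [affRoot_negAff, ← hc] at h1
  linarith

lemma smul_alcove_eq {g : N ≃ᵃ[ℝ] N} (hg : g ∈ affRootGroup P) {x : N} (hx : x ∈ alcove b)
    (hgx : g x ∈ closedAlcove b) : g • alcove b = alcove b := by
  have h := mapsTo_alcove hg hx hgx
  refine (Set.image_subset_iff.2 h).antisymm fun y hy => ?_
  have h' : Set.MapsTo (⇑(g⁻¹)) (alcove b) (alcove b) := by
    refine mapsTo_alcove (inv_mem hg) (h hx) ?_
    rw [inv_apply_apply]
    exact alcove_subset_closedAlcove hx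
  exact ⟨g⁻¹ y, h' hy, apply_inv_apply g y⟩

omit [Finite ι] [P.IsCrystallographic] [P.IsReduced] [P.IsIrreducible] in
lemma affineWeyl_le_extWeyl (Y : WLattice P) : affineWeyl b ≤ Y.extWeyl := by
  rw [affineWeyl, Subgroup.closure_le]
  have hr : ∀ i, refl P i ∈ Y.extWeyl := fun i =>
    (le_sup_right : weyl P ≤ Y.extWeyl) (Subgroup.subset_closure ⟨i, rfl⟩)
  rintro _ ⟨j, rfl⟩
  cases j with
  | none =>
    exact mul_mem ((le_sup_left : Y.translations ≤ Y.extWeyl) (Y.mem_translations.2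
      ⟨_, Y.coroot_le (AddSubgroup.subset_closure ⟨_, rfl⟩), rfl⟩)) (hr _)
  | some i => exact hr i

variable {Y : WLattice P}

omit [Nonempty ι] [Finite ι] [P.IsReduced] [P.IsIrreducible] in
lemma mem_affRootGroup_of_mem_alcoveGroup {ω : N ≃ᵃ[ℝ] N} (hω : ω ∈ Y.alcoveGroup b) :
    ω ∈ affRootGroup P :=
  Y.extWeyl_le_affRootGroup hω.1

omit [Nonempty ι] [Finite ι] [P.IsCrystallographic] [P.IsReduced] [P.IsIrreducible] in
lemma mem_alcove_of_mem_alcoveGroup {ω : N ≃ᵃ[ℝ] N} (hω : ω ∈ Y.alcoveGroup b) {x : N}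
    (hx : x ∈ alcove b) : ω x ∈ alcove b := by
  have h : ω • alcove b = alcove b := hω.2
  rw [← h]
  exact ⟨x, hx, rfl⟩

/-- `W_Y` is the product of the affine Weyl group and of the stabilizer of the alcove. -/
theorem exists_eq_mul_of_mem_extWeyl {g : N ≃ᵃ[ℝ] N} (hg : g ∈ Y.extWeyl) :
    ∃ w ∈ affineWeyl b, ∃ ω ∈ Y.alcoveGroup b, g = w * ω := by
  obtain ⟨x, hx⟩ := alcove_nonempty (b := b)
  obtain ⟨w, hw, hwx⟩ := exists_affineWeyl_mem_closedAlcove b (g x)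
  have hwg : w * g ∈ Y.extWeyl := mul_mem (affineWeyl_le_extWeyl Y hw) hg
  refine ⟨w⁻¹, inv_mem hw, w * g, ⟨hwg, ?_⟩, by simp⟩
  exact smul_alcove_eq (Y.extWeyl_le_affRootGroup hwg) hx hwx

lemma coord_sum_affineEquiv (g : N ≃ᵃ[ℝ] N) (x : N) (k : Node b) :
    coord b k (g x) = ∑ j, coord b j x * coord b k (g (alcoveVertex b j)) := by
  conv_lhs => rw [← sum_coord_smul b x, affineEquiv_sum_smul g _ _ (sum_coord b x)]
  exact coord_sum_smul _ _ (sum_coord b x) _ _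

lemma mem_closedAlcove_of_mem_alcoveGroup {ω : N ≃ᵃ[ℝ] N} (hω : ω ∈ Y.alcoveGroup b) {x : N}
    (hx : x ∈ closedAlcove b) : ω x ∈ closedAlcove b := by
  intro j
  obtain ⟨c, hc, -⟩ := exists_affRoot_eq (mem_affRootGroup_of_mem_alcoveGroup hω) (simpleAff b j)
  rw [hc]
  refine IsPosAff.nonneg ((isPosAff_or_negAff c).resolve_right fun h => ?_) hx
  obtain ⟨y, hy⟩ := alcove_nonempty (b := b)
  have h1 := h.pos hy
  have h2 := (mem_alcove_iff b _).1 (mem_alcove_of_mem_alcoveGroup hω hy) j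
  rw [affRoot_negAff, ← hc] at h1
  linarith

/-- The vertices are the extreme points of the closed alcove, which `Ω_Y` preserves. -/
lemma exists_vertex_eq {ω : N ≃ᵃ[ℝ] N} (hω : ω ∈ Y.alcoveGroup b) (i : Node b) :
    ∃ j, ω (alcoveVertex b i) = alcoveVertex b j := by
  classical
  have hc := mem_closedAlcove_of_mem_alcoveGroup hω (alcoveVertex_mem_closedAlcove (b := b) i)
  obtain ⟨j, hj⟩ : ∃ j, coord b j (ω (alcoveVertex b i)) ≠ 0 := by
    by_contra! h
    have := sum_coord b (ω (alcoveVertex b i))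
    simp [h] at this
  refine ⟨j, ?_⟩
  suffices h : ω⁻¹ (alcoveVertex b j) = alcoveVertex b i by
    rw [← h, apply_inv_apply]
  have hnn : ∀ j k, 0 ≤ coord b k (ω⁻¹ (alcoveVertex b j)) := fun j k =>
    coord_nonneg (mem_closedAlcove_of_mem_alcoveGroup (inv_mem hω)
      (alcoveVertex_mem_closedAlcove j)) k
  -- the barycentric coordinates of `v_i` are a convex combination of those of the `ω⁻¹ v_j`
  have hz : ∀ k, k ≠ i → coord b k (ω⁻¹ (alcoveVertex b j)) = 0 := by
    intro k hk
    have h1 := coord_sum_affineEquiv (b := b) ω⁻¹ (ω (alcoveVertex b i)) k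
    rw [inv_apply_apply, coord_vertex, if_neg hk.symm, eq_comm,
      Finset.sum_eq_zero_iff_of_nonneg fun j _ => mul_nonneg (coord_nonneg hc j) (hnn j k)] at h1
    exact (mul_eq_zero.1 (h1 j (Finset.mem_univ _))).resolve_left hj
  refine ext_coord (b := b) fun k => ?_
  rw [coord_vertex]
  split_ifs with h
  · subst h
    have := sum_coord b (ω⁻¹ (alcoveVertex b j))
    rwa [Finset.sum_eq_single i (fun k _ hk => hz k hk) (by simp)] at this
  · exact hz k (Ne.symm h)

lemma alcoveVertex_injective : Function.Injective (alcoveVertex b) := by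
  classical
  intro i j h
  by_contra hij
  have := coord_vertex b i i
  rw [h, coord_vertex, if_pos rfl, if_neg (Ne.symm hij)] at this
  exact zero_ne_one this

lemma exists_perm_vertex {ω : N ≃ᵃ[ℝ] N} (hω : ω ∈ Y.alcoveGroup b) :
    ∃ π : Equiv.Perm (Node b), ∀ i, ω (alcoveVertex b i) = alcoveVertex b (π i) := by
  choose f hf using exists_vertex_eq hω
  have hinj : Function.Injective f := fun i j h =>
    alcoveVertex_injective (ω.injective (by rw [hf, hf, h]))
  exact ⟨Equiv.ofBijective f (Finite.injective_iff_bijective.1 hinj), hf⟩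

/-- The stabilizer of the alcove permutes the simple reflections. -/
lemma conj_affineWeyl {ω w : N ≃ᵃ[ℝ] N} (hω : ω ∈ Y.alcoveGroup b) (hw : w ∈ affineWeyl b) :
    ω * w * ω⁻¹ ∈ affineWeyl b := by
  classical
  rw [affineWeyl] at hw
  induction hw using Subgroup.closure_induction with
  | one => simp [one_mem]
  | mul x y _ _ hx hy =>
    have := mul_mem hx hy
    simpa [mul_assoc] using this
  | inv x _ hx =>
    have := inv_mem hx
    simpa [mul_assoc] using this
  | mem x hx =>
    obtain ⟨j, rfl⟩ := hx
    rw [simpleAffineReflection_eq]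
    obtain ⟨c, hc, hr⟩ := exists_affRoot_eq
      (mem_affRootGroup_of_mem_alcoveGroup (inv_mem hω)) (simpleAff b j)
    obtain ⟨π, hπ⟩ := exists_perm_vertex (inv_mem hω)
    have h1 : ω * affRefl P (simpleAff b j) * ω⁻¹ = affRefl P c := by
      rw [mul_assoc, hr, mul_inv_cancel_left]
    have hpos : IsPosAff b c := fun i => by
      rw [← hc, hπ]
      exact isPosAff_simpleAff j _
    have hcj : c = simpleAff b (π.symm j) := hpos.eq_simpleAff fun i hi => by
      rw [← hc, hπ, affRoot_simpleAff_vertex, if_neg]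
      rintro rfl
      simp at hi
    rw [h1, hcj, ← simpleAffineReflection_eq]
    exact Subgroup.subset_closure ⟨_, rfl⟩

/-- The affine Weyl group is normal in `W_Y`. -/
lemma conj_affineWeyl_of_mem_extWeyl {g w : N ≃ᵃ[ℝ] N} (hg : g ∈ Y.extWeyl)
    (hw : w ∈ affineWeyl b) : g * w * g⁻¹ ∈ affineWeyl b := by
  obtain ⟨w', hw', ω, hω, rfl⟩ := exists_eq_mul_of_mem_extWeyl (b := b) hg
  have := mul_mem (mul_mem hw' (conj_affineWeyl hω hw)) (inv_mem hw')
  simpa [mul_assoc] using this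

end AlcoveGroup

/-! ### Chains of finite sets and barycentric subdivision -/

section Chains

variable {κ : Type*} [DecidableEq κ]

/-- The function `∑ y_j 1_{Z_j}` attached to sets `Z_j` with weights `y_j`. -/
def levelSum {d : ℕ} (Z : Fin (d + 1) → Finset κ) (y : Fin (d + 1) → ℝ) (i : κ) : ℝ :=
  ∑ j, if i ∈ Z j then y j else 0

variable {d : ℕ} {Z : Fin (d + 1) → Finset κ}

omit [DecidableEq κ] in
lemma exists_first_mem (hZ : StrictMono Z) (hne : (Z 0).Nonempty) (j : Fin (d + 1)) :
    ∃ i, ∀ l, i ∈ Z l ↔ j ≤ l := by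
  suffices h : ∃ i ∈ Z j, ∀ l < j, i ∉ Z l by
    obtain ⟨i, hi, hi'⟩ := h
    exact ⟨i, fun l => ⟨fun h => not_lt.1 fun hl => hi' l hl h, fun h => hZ.monotone h hi⟩⟩
  cases j using Fin.cases with
  | zero => exact ⟨hne.choose, hne.choose_spec, fun l hl => absurd hl (Fin.not_lt_zero l)⟩
  | succ j =>
    obtain ⟨i, hi, hi'⟩ := Finset.exists_of_ssubset (hZ (Fin.castSucc_lt_succ (i := j)))
    exact ⟨i, hi, fun l hl h => hi' (hZ.monotone (Fin.le_castSucc_iff.2 hl) h)⟩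

lemma levelSum_eq {i : κ} {j : Fin (d + 1)} (hi : ∀ l, i ∈ Z l ↔ j ≤ l) (y : Fin (d + 1) → ℝ) :
    levelSum Z y i = ∑ l ∈ Finset.Ici j, y l := by
  rw [levelSum, ← Finset.sum_filter]
  congr 1
  ext l
  simp [hi]

/-- The indicator functions of the members of a chain are linearly independent. -/
lemma eq_zero_of_levelSum_eq_zero (hZ : StrictMono Z) (hne : (Z 0).Nonempty)
    {y : Fin (d + 1) → ℝ} (h : ∀ i, levelSum Z y i = 0) : y = 0 := by
  have key : ∀ j, ∑ l ∈ Finset.Ici j, y l = 0 := fun j => by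
    obtain ⟨i, hi⟩ := exists_first_mem hZ hne j
    rw [← levelSum_eq hi, h]
  funext j
  induction j using WellFoundedGT.induction with
  | _ j ih =>
    have := key j
    rw [Finset.sum_eq_single_of_mem j (by simp)] at this
    · exact this
    · intro l hl hlj
      exact ih l (lt_of_le_of_ne (Finset.mem_Ici.1 hl) hlj.symm)

/-- The members of a chain are the superlevel sets of a positive combination of their indicator
functions. -/
lemma mem_iff_levelSum_le (hZ : StrictMono Z) {y : Fin (d + 1) → ℝ} (hy : ∀ j, 0 < y j)
    {i : κ} {j : Fin (d + 1)} (hi : ∀ l, i ∈ Z l ↔ j ≤ l) (k : κ) :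
    k ∈ Z j ↔ levelSum Z y i ≤ levelSum Z y k := by
  constructor
  · intro hk
    refine Finset.sum_le_sum fun l _ => ?_
    by_cases hl : i ∈ Z l
    · rw [if_pos hl, if_pos (hZ.monotone ((hi l).1 hl) hk)]
    · rw [if_neg hl]
      split_ifs
      exacts [(hy l).le, le_rfl]
  · intro h
    by_contra hk
    refine absurd h (not_le.2 (Finset.sum_lt_sum (fun l _ => ?_) ⟨j, Finset.mem_univ _, ?_⟩))
    · by_cases hl : k ∈ Z l
      · have : i ∈ Z l := (hi l).2 (not_lt.1 fun hlt => hk (hZ.monotone hlt.le hl))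
        rw [if_pos hl, if_pos this]
      · rw [if_neg hl]
        split_ifs
        exacts [(hy l).le, le_rfl]
    · rw [if_neg hk, if_pos ((hi j).2 le_rfl)]
      exact hy j

lemma levelSum_pos_iff {y : Fin (d + 1) → ℝ} (hy : ∀ j, 0 < y j) (i : κ) :
    0 < levelSum Z y i ↔ ∃ j, i ∈ Z j := by
  constructor
  · intro h
    by_contra! hn
    simp [levelSum, hn] at h
  · rintro ⟨j, hj⟩
    refine Finset.sum_pos' (fun l _ => ?_) ⟨j, Finset.mem_univ _, by rw [if_pos hj]; exact hy j⟩
    split_ifs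
    exacts [(hy l).le, le_rfl]

/-- A chain is determined by any positive combination of the indicator functions of its members. -/
lemma range_eq_superlevel (hZ : StrictMono Z) (hne : (Z 0).Nonempty)
    {y : Fin (d + 1) → ℝ} (hy : ∀ j, 0 < y j) :
    Set.range Z = {S | ∃ i, 0 < levelSum Z y i ∧
      ∀ k, k ∈ S ↔ levelSum Z y i ≤ levelSum Z y k} := by
  ext S
  constructor
  · rintro ⟨j, rfl⟩
    obtain ⟨i, hi⟩ := exists_first_mem hZ hne j
    exact ⟨i, (levelSum_pos_iff hy i).2 ⟨j, (hi j).2 le_rfl⟩, mem_iff_levelSum_le hZ hy hi⟩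
  · rintro ⟨i, hi, hS⟩
    have hex := (levelSum_pos_iff hy i).1 hi
    obtain ⟨j, hj, hmin⟩ := WellFounded.has_min (wellFounded_lt (α := Fin (d + 1)))
      {j | i ∈ Z j} hex
    refine ⟨j, Finset.ext fun k => ?_⟩
    rw [hS, mem_iff_levelSum_le hZ hy fun l => ?_]
    exact ⟨fun h => not_lt.1 (hmin l h), fun h => hZ.monotone h hj⟩

/-- Every nonnegative function `≠ 0` on a finite set is a positive combination of the indicator
functions of a chain: subtract a multiple of the indicator function of the support, and repeat. -/
lemma exists_levelSum_eq [Fintype κ] (f : κ → ℝ) (hf : ∀ i, 0 ≤ f i) (hf0 : f ≠ 0) :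
    ∃ (d : ℕ) (Z : Fin (d + 1) → Finset κ) (y : Fin (d + 1) → ℝ), StrictMono Z ∧
      (Z 0).Nonempty ∧ (∀ j, 0 < y j) ∧ (∀ i, levelSum Z y i = f i) ∧
      ∀ i, i ∈ Z (Fin.last d) ↔ f i ≠ 0 := by
  induction h : (Finset.univ.filter fun i => f i ≠ 0).card using Nat.strong_induction_on
    generalizing f with
  | _ n ih =>
    set S := Finset.univ.filter fun i => f i ≠ 0 with hS
    have hmemS : ∀ i, i ∈ S ↔ f i ≠ 0 := fun i => by simp [hS]
    have hSne : S.Nonempty := by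
      obtain ⟨i, hi⟩ := Function.ne_iff.1 hf0
      exact ⟨i, (hmemS i).2 hi⟩
    obtain ⟨m, hmS, hm⟩ := S.exists_min_image f hSne
    have hmpos : 0 < f m := (hf m).lt_of_ne' ((hmemS m).1 hmS)
    set f' : κ → ℝ := fun i => if i ∈ S then f i - f m else 0 with hf'
    have hff' : ∀ i, f i = f' i + if i ∈ S then f m else 0 := fun i => by
      by_cases hi : i ∈ S
      · simp [hf', hi]
      · have : f i = 0 := by simpa [hmemS] using hi
        simp [hf', hi, this]
    by_cases hf'0 : f' = 0
    · refine ⟨0, fun _ => S, fun _ => f m, ?_, hSne, fun _ => hmpos, fun i => ?_,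
        fun i => hmemS i⟩
      · have : Subsingleton (Fin (0 + 1)) := inferInstanceAs (Subsingleton (Fin 1))
        exact Subsingleton.strictMono _
      · rw [hff' i, hf'0]
        simp [levelSum]
    · have hsub : (Finset.univ.filter fun i => f' i ≠ 0) ⊂ S := by
        refine (Finset.ssubset_iff_of_subset fun i hi => ?_).2 ⟨m, hmS, by simp [hf']⟩
        by_contra hiS
        simp [hf', hiS] at hi
      obtain ⟨d, Z, y, hZ, hne, hy, hsum, hlast⟩ := ih _ (h ▸ Finset.card_lt_card hsub) f'
        (fun i => by
          by_cases hi : i ∈ S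
          · simpa [hf', hi] using hm i hi
          · simp [hf', hi]) hf'0 rfl
      refine ⟨d + 1, Fin.snoc (α := fun _ => Finset κ) Z S, Fin.snoc (α := fun _ => ℝ) y (f m),
        ?_, ?_, ?_, ?_, ?_⟩
      · refine Fin.strictMono_iff_lt_succ.2 fun i => ?_
        cases i using Fin.lastCases with
        | last =>
          rw [Fin.snoc_castSucc, Fin.succ_last, Fin.snoc_last]
          refine lt_of_eq_of_lt (Finset.ext fun i => ?_) hsub
          simp [hlast]
        | cast i =>
          rw [Fin.snoc_castSucc, Fin.succ_castSucc, Fin.snoc_castSucc]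
          exact hZ Fin.castSucc_lt_succ
      · rw [← Fin.castSucc_zero, Fin.snoc_castSucc]
        exact hne
      · intro j
        cases j using Fin.lastCases with
        | last => rw [Fin.snoc_last]; exact hmpos
        | cast j => rw [Fin.snoc_castSucc]; exact hy j
      · intro i
        rw [levelSum, Fin.sum_univ_castSucc]
        simp only [Fin.snoc_castSucc, Fin.snoc_last]
        rw [hff' i, ← hsum]
        rfl
      · intro i
        rw [Fin.snoc_last]
        exact hmemS i

end Chains

/-! ### Translates of the simplices of the barycentric subdivision -/

section Cells

variable {ι M N : Type*} [AddCommGroup M] [Module ℝ M] [AddCommGroup N] [Module ℝ N]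
  {P : RootPairing ι ℝ M N} {b : P.Base}

namespace Flag

@[ext]
lemma ext_set {d : ℕ} {Z Z' : Flag b d} (h : Z.set = Z'.set) : Z = Z' := by
  cases Z; cases Z'; cases h; rfl

lemma sigma_eq_of_range_eq {d d' : ℕ} {Z : Flag b d} {Z' : Flag b d'}
    (h : Set.range Z.set = Set.range Z'.set) :
    (⟨d, Z⟩ : Σ d, Flag b d) = ⟨d', Z'⟩ := by
  have hd : d = d' := by
    have h1 := Set.ncard_range_of_injective Z.strictMono.injective
    have h2 := Set.ncard_range_of_injective Z'.strictMono.injective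
    rw [h, h2] at h1
    simpa using h1.symm
  subst hd
  congr 1
  exact ext_set ((Z.strictMono.range_inj Z'.strictMono).1 h)

instance finite_sigma : Finite (Σ d, Flag b d) :=
  Finite.of_injective (fun Z : Σ d, Flag b d => Set.range Z.2.set)
    fun _ _ h => sigma_eq_of_range_eq h

instance (d : ℕ) : Finite (Flag b d) :=
  Finite.of_injective (fun Z => (⟨d, Z⟩ : Σ d, Flag b d)) sigma_mk_injective

/-- The face of a simplex of the barycentric subdivision with a given set of vertices. -/
def restrict {d e : ℕ} (Z : Flag b d) (f : Fin (e + 1) ↪o Fin (d + 1)) : Flag b e where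
  set i := Z.set (f i)
  strictMono := Z.strictMono.comp f.strictMono
  nonempty _ := Z.nonempty _

lemma face_eq_restrict {d : ℕ} (Z : Flag b (d + 1)) (p : Fin (d + 2)) :
    Z.face p = Z.restrict (Fin.succAboveOrderEmb p) := rfl

/-- The image of a chain under a permutation of the nodes. -/
def perm {d : ℕ} (π : Equiv.Perm (Node b)) (Z : Flag b d) : Flag b d where
  set i := (Z.set i).map π.toEmbedding
  strictMono _ _ h := Finset.map_ssubset_map.2 (Z.strictMono h)
  nonempty i := (Z.nonempty i).map

end Flag

variable [Nonempty ι] [Finite ι] [P.IsCrystallographic] [P.IsReduced] [P.IsIrreducible]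

omit [Nonempty ι] [Finite ι] [P.IsCrystallographic] [P.IsReduced] [P.IsIrreducible] in
lemma sum_inv_card {S : Finset (Node b)} (hS : S.Nonempty) :
    ∑ _i ∈ S, (S.card : ℝ)⁻¹ = 1 := by
  have : (S.card : ℝ) ≠ 0 := by exact_mod_cast hS.card_ne_zero
  rw [Finset.sum_const, nsmul_eq_mul, mul_inv_cancel₀ this]

open Classical in
lemma coord_barycenter {S : Finset (Node b)} (hS : S.Nonempty) (i : Node b) :
    coord b i (barycenter b S) = if i ∈ S then (S.card : ℝ)⁻¹ else 0 := by
  rw [barycenter, Finset.smul_sum, coord_sum_smul _ _ (sum_inv_card hS)]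
  simp [coord_vertex]

omit [Finite ι] [P.IsCrystallographic] [P.IsReduced] in
lemma affineEquiv_barycenter (g : N ≃ᵃ[ℝ] N) {S : Finset (Node b)} (hS : S.Nonempty) :
    g (barycenter b S) = (S.card : ℝ)⁻¹ • ∑ i ∈ S, g (alcoveVertex b i) := by
  rw [barycenter, Finset.smul_sum, affineEquiv_sum_smul g _ _ (sum_inv_card hS), Finset.smul_sum]

namespace Flag

variable {d : ℕ} (Z : Flag b d)

omit [Finite ι] [P.IsCrystallographic] [P.IsReduced] in
lemma affineEquiv_param (g : N ≃ᵃ[ℝ] N) (t : stdSimplex ℝ (Fin (d + 1))) :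
    g (Z.param t) = ∑ i, t i • g (barycenter b (Z.set i)) :=
  affineEquiv_sum_smul g _ _ t.2.2 _

open Classical in
/-- The barycentric coordinates of a point of the simplex `Z` are a combination of the indicator
functions of the sets `Z_j`. -/
lemma coord_param (t : stdSimplex ℝ (Fin (d + 1))) (i : Node b) :
    coord b i (Z.param t) = levelSum Z.set (fun j => t j * ((Z.set j).card : ℝ)⁻¹) i := by
  rw [param, coord_sum_smul _ _ (stdSimplex.sum_eq_one t), levelSum]
  refine Finset.sum_congr rfl fun j _ => ?_
  rw [coord_barycenter (Z.nonempty j), mul_ite, mul_zero]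

omit [Nonempty ι] [Finite ι] [P.IsCrystallographic] [P.IsReduced] [P.IsIrreducible] in
lemma card_pos (j : Fin (d + 1)) : 0 < ((Z.set j).card : ℝ)⁻¹ :=
  inv_pos.2 (by exact_mod_cast (Z.nonempty j).card_pos)

lemma param_mem_closedAlcove (t : stdSimplex ℝ (Fin (d + 1))) : Z.param t ∈ closedAlcove b := by
  classical
  refine mem_closedAlcove_iff_coord.2 fun i => ?_
  rw [coord_param]
  refine Finset.sum_nonneg fun j _ => ?_
  split_ifs
  exacts [mul_nonneg (stdSimplex.zero_le t j) (Z.card_pos j).le, le_rfl]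

lemma param_injective : Function.Injective Z.param := by
  classical
  intro t t' h
  have h1 := eq_zero_of_levelSum_eq_zero Z.strictMono (Z.nonempty 0)
    (y := fun j => t j * ((Z.set j).card : ℝ)⁻¹ - t' j * ((Z.set j).card : ℝ)⁻¹) fun i => by
      have := congrArg (coord b i) h
      rw [coord_param, coord_param, levelSum, levelSum, ← sub_eq_zero,
        ← Finset.sum_sub_distrib] at this
      refine (Finset.sum_congr rfl fun j _ => ?_).trans this
      split_ifs <;> simp
  refine stdSimplex.ext (funext fun j => ?_)
  have h2 := congrFun h1 j
  simp only [Pi.zero_apply, ← sub_mul] at h2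
  exact sub_eq_zero.1 ((mul_eq_zero.1 h2).resolve_right (Z.card_pos j).ne')

/-- Two open simplices of the barycentric subdivision that meet are equal. -/
lemma sigma_eq_of_param_eq {d' : ℕ} {Z : Flag b d} {Z' : Flag b d'}
    {t : stdSimplex ℝ (Fin (d + 1))} {t' : stdSimplex ℝ (Fin (d' + 1))} (ht : t ∈ stdInterior d)
    (ht' : t' ∈ stdInterior d') (h : Z.param t = Z'.param t') :
    (⟨d, Z⟩ : Σ d, Flag b d) = ⟨d', Z'⟩ := by
  classical
  refine sigma_eq_of_range_eq ?_
  rw [range_eq_superlevel Z.strictMono (Z.nonempty 0) fun j => mul_pos (ht j) (Z.card_pos j),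
    range_eq_superlevel Z'.strictMono (Z'.nonempty 0) fun j => mul_pos (ht' j) (Z'.card_pos j)]
  simp only [← coord_param, h]

lemma coord_param_eq_zero_iff {t : stdSimplex ℝ (Fin (d + 1))} (ht : t ∈ stdInterior d)
    (i : Node b) : coord b i (Z.param t) = 0 ↔ i ∉ Z.set (Fin.last d) := by
  classical
  have hnn := coord_nonneg (Z.param_mem_closedAlcove t) i
  have h := levelSum_pos_iff (Z := Z.set) (fun j => mul_pos (ht j) (Z.card_pos j)) i
  rw [← coord_param] at h
  rw [← not_iff_not, not_not, ← ne_eq, ← hnn.lt_iff_ne', h]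
  exact ⟨fun ⟨j, hj⟩ => Z.strictMono.monotone (Fin.le_last j) hj, fun h => ⟨_, h⟩⟩

lemma coord_param_eq_zero (t : stdSimplex ℝ (Fin (d + 1))) {i : Node b}
    (hi : i ∉ Z.set (Fin.last d)) : coord b i (Z.param t) = 0 := by
  classical
  rw [coord_param, levelSum]
  exact Finset.sum_eq_zero fun j _ =>
    if_neg fun h => hi (Z.strictMono.monotone (Fin.le_last j) h)

lemma setOf_affRoot_eq_zero {t : stdSimplex ℝ (Fin (d + 1))} (ht : t ∈ stdInterior d) :
    {j | affRoot P (simpleAff b j) (Z.param t) = 0} = {j | j ∉ Z.set (Fin.last d)} := by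
  ext j
  rw [Set.mem_ofPred_eq, Set.mem_ofPred_eq, ← coord_eq_zero_iff, Z.coord_param_eq_zero_iff ht]

/-- The reflections `s_j` with `j ∉ Z_d` fix the simplex `Z` pointwise. -/
lemma param_eq_self_of_mem_parabolic {w : N ≃ᵃ[ℝ] N}
    (hw : w ∈ parabolic b {j | j ∉ Z.set (Fin.last d)}) (t : stdSimplex ℝ (Fin (d + 1))) :
    w (Z.param t) = Z.param t := by
  rw [parabolic] at hw
  induction hw using Subgroup.closure_induction with
  | one => rfl
  | mul x y _ _ hx hy => exact (congrArg x hy).trans hx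
  | inv x _ hx =>
    conv_lhs => rw [← hx]
    exact inv_apply_apply x _
  | mem x hx =>
    obtain ⟨j, hj, rfl⟩ := hx
    rw [simpleAffineReflection_eq, affRefl_eq_self_iff, ← coord_eq_zero_iff]
    exact Z.coord_param_eq_zero t hj

omit [Finite ι] [P.IsCrystallographic] [P.IsReduced] in
lemma param_map {e : ℕ} (f : Fin (e + 1) ↪o Fin (d + 1)) (t : stdSimplex ℝ (Fin (e + 1))) :
    Z.param (stdSimplex.map f t) = (Z.restrict f).param t := by
  classical
  rw [param, param, stdSimplex.map_coe]
  simp_rw [FunOnFinite.linearMap_apply_apply, Finset.sum_smul]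
  rw [← Finset.sum_fiberwise Finset.univ f]
  refine Finset.sum_congr rfl fun j _ => Finset.sum_congr rfl fun i hi => ?_
  rw [← (Finset.mem_filter.1 hi).2]
  rfl

end Flag

/-- Every point of the closed alcove lies in an open simplex of the barycentric subdivision. -/
lemma exists_param_eq {x : N} (hx : x ∈ closedAlcove b) :
    ∃ (d : ℕ) (Z : Flag b d), ∃ t ∈ stdInterior d, Z.param t = x := by
  classical
  have h1 := sum_coord b x
  obtain ⟨d, Z, y, hZ, hne, hy, hsum, -⟩ := exists_levelSum_eq (fun i => coord b i x)
    (coord_nonneg hx) fun h => by simp [fun i => congrFun h i] at h1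
  let Z' : Flag b d := ⟨Z, hZ, fun j => hne.mono (hZ.monotone (Fin.zero_le j))⟩
  have hcard := Z'.card_pos
  have hcard' : ∀ j, 0 < ((Z j).card : ℝ) := fun j => inv_pos.1 (hcard j)
  have htot : ∑ j, y j * (Z j).card = 1 := by
    rw [← h1, ← Finset.sum_congr rfl fun i _ => hsum i]
    unfold levelSum
    rw [Finset.sum_comm]
    refine Finset.sum_congr rfl fun j _ => ?_
    rw [← Finset.sum_filter, Finset.filter_mem_eq_inter, Finset.univ_inter, Finset.sum_const,
      nsmul_eq_mul, mul_comm]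
  let t : stdSimplex ℝ (Fin (d + 1)) :=
    ⟨fun j => y j * (Z j).card, fun j => (mul_pos (hy j) (hcard' j)).le, htot⟩
  refine ⟨d, Z', t, fun j => mul_pos (hy j) (hcard' j), ext_coord (b := b) fun i => ?_⟩
  rw [Flag.coord_param, ← hsum i]
  congr 1
  funext j
  change y j * (Z j).card * ((Z j).card : ℝ)⁻¹ = y j
  rw [mul_assoc, mul_inv_cancel₀ (hcard' j).ne', mul_one]

/-- Two translates of open simplices of the barycentric subdivision that meet coincide, together
with their parametrizations. -/
theorem cell_unique {w w' : N ≃ᵃ[ℝ] N} (hw : w ∈ affineWeyl b) (hw' : w' ∈ affineWeyl b)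
    {d d' : ℕ} {Z : Flag b d} {Z' : Flag b d'}
    {t : stdSimplex ℝ (Fin (d + 1))} {t' : stdSimplex ℝ (Fin (d' + 1))} (ht : t ∈ stdInterior d)
    (ht' : t' ∈ stdInterior d') (h : w (Z.param t) = w' (Z'.param t')) :
    (⟨d, Z⟩ : Σ d, Flag b d) = ⟨d', Z'⟩ ∧
      w'⁻¹ * w ∈ parabolic b {j | j ∉ Z.set (Fin.last d)} := by
  have h1 : (w'⁻¹ * w) (Z.param t) = Z'.param t' := by
    change w'⁻¹ (w (Z.param t)) = _
    rw [h, inv_apply_apply]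
  obtain ⟨h2, h3⟩ := eq_self_and_mem_parabolic (mul_mem (inv_mem hw') hw)
    (Z.param_mem_closedAlcove t) (h1 ▸ Z'.param_mem_closedAlcove t')
  rw [Z.setOf_affRoot_eq_zero ht] at h3
  exact ⟨Flag.sigma_eq_of_param_eq ht ht' (h2.symm.trans h1), h3⟩

variable (b) in
/-- Every point of `V*` lies in a translate of an open simplex of the barycentric subdivision. -/
lemma exists_cell (x : N) : ∃ w ∈ affineWeyl b, ∃ (d : ℕ) (Z : Flag b d), ∃ t ∈ stdInterior d,
    w (Z.param t) = x := by
  obtain ⟨w, hw, hwx⟩ := exists_affineWeyl_mem_closedAlcove b x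
  obtain ⟨d, Z, t, ht, h⟩ := exists_param_eq hwx
  exact ⟨w⁻¹, inv_mem hw, d, Z, t, ht, by rw [h, inv_apply_apply]⟩

section Moves

variable {Y : WLattice P} {ω : N ≃ᵃ[ℝ] N} {d : ℕ}

lemma Flag.moves_iff {π : Equiv.Perm (Node b)}
    (hπ : ∀ i, ω (alcoveVertex b i) = alcoveVertex b (π i)) {Z Z' : Flag b d} :
    Z.Moves ω Z' ↔ Z' = Z.perm π := by
  have key : ∀ S S' : Finset (Node b), ω '' (alcoveVertex b '' (S : Set (Node b))) =
      alcoveVertex b '' (S' : Set (Node b)) ↔ S' = S.map π.toEmbedding := by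
    intro S S'
    have : ω '' (alcoveVertex b '' (S : Set (Node b))) =
        alcoveVertex b '' ((S.map π.toEmbedding : Finset _) : Set (Node b)) := by
      simp [Set.image_image, hπ]
    rw [this, alcoveVertex_injective.image_injective.eq_iff, Finset.coe_inj, eq_comm]
  constructor
  · exact fun h => Flag.ext_set (funext fun i => (key _ _).1 (h i))
  · rintro rfl i
    exact (key _ _).2 rfl

lemma exists_moves (hω : ω ∈ Y.alcoveGroup b) (Z : Flag b d) : ∃ Z', Z.Moves ω Z' := by
  obtain ⟨π, hπ⟩ := exists_perm_vertex hω
  exact ⟨_, (Flag.moves_iff hπ).2 rfl⟩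

/-- If `ω` moves `Z` to `Z'`, then it carries the parametrization of `Z` to that of `Z'`. -/
lemma Flag.Moves.apply_param (hω : ω ∈ Y.alcoveGroup b) {Z Z' : Flag b d} (h : Z.Moves ω Z')
    (t : stdSimplex ℝ (Fin (d + 1))) : ω (Z.param t) = Z'.param t := by
  obtain ⟨π, hπ⟩ := exists_perm_vertex hω
  rw [(Flag.moves_iff hπ).1 h, Z.affineEquiv_param, Flag.param]
  refine Finset.sum_congr rfl fun i _ => ?_
  rw [affineEquiv_barycenter _ (Z.nonempty i)]
  simp [Flag.perm, barycenter, hπ]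

omit [Finite ι] [P.IsCrystallographic] [P.IsReduced] in
lemma Flag.Moves.symm {Z Z' : Flag b d} (h : Z.Moves ω Z') : Z'.Moves ω⁻¹ Z := fun i => by
  rw [← h i, Set.image_image]
  simp [inv_apply_apply]

omit [Finite ι] [P.IsCrystallographic] [P.IsReduced] in
lemma Flag.Moves.mul {ω' : N ≃ᵃ[ℝ] N} {Z Z' Z'' : Flag b d} (h : Z.Moves ω Z')
    (h' : Z'.Moves ω' Z'') : Z.Moves (ω' * ω) Z'' := fun i => by
  rw [← h' i, ← h i, Set.image_image ω' ω]
  rfl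

end Moves

end Cells

/-! ### The triangulation as a geometric simplicial complex -/

lemma convexHull_range_eq_image_stdSimplex {κ E : Type*} [Fintype κ] [AddCommGroup E] [Module ℝ E]
    (p : κ → E) :
    convexHull ℝ (Set.range p) = (fun t : κ → ℝ => ∑ i, t i • p i) '' stdSimplex ℝ κ := by
  classical
  refine Set.Subset.antisymm (convexHull_min ?_ ?_) ?_
  · rintro _ ⟨i, rfl⟩
    exact ⟨Pi.single i 1, single_mem_stdSimplex ℝ i, by simp [Pi.single_apply]⟩
  · have := (convex_stdSimplex ℝ κ).linear_image (Fintype.linearCombination ℝ p)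
    exact this
  · rintro _ ⟨t, ht, rfl⟩
    exact (convex_convexHull ℝ _).sum_mem (fun i _ => ht.1 i) ht.2
      fun i _ => subset_convexHull ℝ _ ⟨i, rfl⟩

/-- A point of a simplex lies in the interior of one of its faces. -/
lemma exists_map_eq {d : ℕ} (t : stdSimplex ℝ (Fin (d + 1))) :
    ∃ (e : ℕ) (f : Fin (e + 1) ↪o Fin (d + 1)), ∃ s ∈ stdInterior e, stdSimplex.map f s = t := by
  classical
  set J : Finset (Fin (d + 1)) := Finset.univ.filter fun i => t i ≠ 0 with hJ
  have hsum : ∑ i ∈ J, t i = 1 := by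
    rw [hJ, Finset.sum_filter_ne_zero, stdSimplex.sum_eq_one]
  have hcard : J.card ≠ 0 := by
    rw [Finset.card_ne_zero, Finset.nonempty_iff_ne_empty]
    intro h
    rw [h] at hsum
    simp at hsum
  obtain ⟨e, he⟩ := Nat.exists_eq_succ_of_ne_zero hcard
  let f := J.orderEmbOfFin he
  have hf : ∀ i, f i ∈ J := J.orderEmbOfFin_mem he
  have himage : Finset.univ.image f = J := by
    ext i
    have := Finset.range_orderEmbOfFin J he
    simp only [Finset.mem_image, Finset.mem_univ, true_and]
    rw [← Finset.mem_coe, ← this]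
    rfl
  let s : stdSimplex ℝ (Fin (e + 1)) := ⟨fun i => t (f i), fun i => stdSimplex.zero_le t _, by
    rw [← hsum, ← himage, Finset.sum_image f.injective.injOn]⟩
  refine ⟨e, f, s, fun i => (stdSimplex.zero_le t _).lt_of_ne' (by simpa [hJ] using hf i),
    stdSimplex.ext (funext fun i => ?_)⟩
  rw [stdSimplex.map_coe, FunOnFinite.linearMap_apply_apply]
  by_cases hi : i ∈ J
  · rw [← himage] at hi
    obtain ⟨j, -, rfl⟩ := Finset.mem_image.1 hi
    rw [Finset.sum_eq_single j]
    · rfl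
    · intro k hk hkj
      exact absurd (f.injective (Finset.mem_filter.1 hk).2) hkj
    · simp
  · have h0 : t i = 0 := by simpa [hJ] using hi
    rw [h0]
    refine Finset.sum_eq_zero fun k hk => absurd (hf k) ?_
    rwa [(Finset.mem_filter.1 hk).2]

section Triangulation

variable {ι M N : Type*} [AddCommGroup M] [Module ℝ M] [AddCommGroup N] [Module ℝ N]
  {P : RootPairing ι ℝ M N} {b : P.Base}
  [Nonempty ι] [Finite ι] [P.IsCrystallographic] [P.IsReduced] [P.IsIrreducible]

omit [Finite ι] [P.IsCrystallographic] [P.IsReduced] in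
/-- The barycentric coordinates are affine functions. -/
lemma sum_mul_coord_eq_zero {κ : Type*} (s : Finset κ) (y : κ → ℝ) (p : κ → N)
    (hy : ∑ i ∈ s, y i = 0) (hp : ∑ i ∈ s, y i • p i = 0) (j : Node b) :
    ∑ i ∈ s, y i * coord b j (p i) = 0 := by
  have h := congrArg (P.root' (simpleAff b j).1) hp
  simp only [map_sum, map_smul, smul_eq_mul, map_zero] at h
  calc ∑ i ∈ s, y i * coord b j (p i)
      = nodeCoeff b j * (∑ i ∈ s, y i * P.root' (simpleAff b j).1 (p i) +
          (∑ i ∈ s, y i) * (simpleAff b j).2) := by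
        rw [Finset.sum_mul, ← Finset.sum_add_distrib, Finset.mul_sum]
        exact Finset.sum_congr rfl fun i _ => by rw [coord, affRoot]; ring
    _ = 0 := by rw [h, hy]; ring

variable (b) in
lemma affineIndependent_alcoveVertex : AffineIndependent ℝ (alcoveVertex b) := by
  classical
  refine affineIndependent_iff.2 fun s y hy hp j hj => ?_
  have := sum_mul_coord_eq_zero s y _ hy hp j
  simp_rw [coord_vertex] at this
  simpa [hj] using this

lemma Flag.affineIndependent_barycenter {d : ℕ} (Z : Flag b d) :
    AffineIndependent ℝ fun i => barycenter b (Z.set i) := by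
  classical
  refine (affineIndependent_iff_of_fintype ℝ _).2 fun y hy hp j => ?_
  rw [Finset.weightedVSub_eq_linear_combination _ hy] at hp
  have h := eq_zero_of_levelSum_eq_zero Z.strictMono (Z.nonempty 0)
    (y := fun j => y j * ((Z.set j).card : ℝ)⁻¹) fun i => by
      rw [← sum_mul_coord_eq_zero (b := b) _ y _ hy hp i]
      exact Finset.sum_congr rfl fun j _ => by
        rw [coord_barycenter (Z.nonempty j), mul_ite, mul_zero]
  exact (mul_eq_zero.1 (congrFun h j)).resolve_right (Z.card_pos j).ne'

lemma Flag.apply_param_eq {d : ℕ} (Z : Flag b d) {w w' : N ≃ᵃ[ℝ] N}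
    (h : w'⁻¹ * w ∈ parabolic b {j | j ∉ Z.set (Fin.last d)}) (t : stdSimplex ℝ (Fin (d + 1))) :
    w (Z.param t) = w' (Z.param t) := by
  have := congrArg w' (Z.param_eq_self_of_mem_parabolic h t)
  rw [← this]
  exact (apply_inv_apply w' _).symm

omit [Finite ι] [P.IsCrystallographic] [P.IsReduced] in
lemma Flag.exists_param_eq_barycenter {d : ℕ} (Z : Flag b d) (i : Fin (d + 1)) :
    ∃ t, Z.param t = barycenter b (Z.set i) := by
  classical
  refine ⟨⟨Pi.single i 1, single_mem_stdSimplex ℝ i⟩, ?_⟩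
  change ∑ j, (Pi.single i 1 : Fin (d + 1) → ℝ) j • _ = _
  simp [Pi.single_apply]

variable (b) in
/-- The vertex sets of the translates of the simplices of the barycentric subdivision. -/
def vertexSets : Set (Finset N) :=
  {s | ∃ w ∈ affineWeyl b, ∃ (d : ℕ) (Z : Flag b d),
    (s : Set N) = Set.range fun i => w (barycenter b (Z.set i))}

omit [Finite ι] [P.IsCrystallographic] [P.IsReduced] in
lemma Flag.convexHull_eq {d : ℕ} (Z : Flag b d) (w : N ≃ᵃ[ℝ] N) :
    convexHull ℝ (Set.range fun i => w (barycenter b (Z.set i))) =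
      Set.range fun t => w (Z.param t) := by
  rw [convexHull_range_eq_image_stdSimplex]
  ext x
  constructor
  · rintro ⟨t, ht, rfl⟩
    exact ⟨⟨t, ht⟩, Z.affineEquiv_param w _⟩
  · rintro ⟨t, rfl⟩
    exact ⟨t.1, t.2, (Z.affineEquiv_param w _).symm⟩

variable (b) in
/-- The translates of the simplices of the barycentric subdivision of the closed alcove, as a
simplicial complex. -/
def alcoveComplex : Geometry.SimplicialComplex ℝ N where
  faces := vertexSets b
  isRelLowerSet_faces := by
    classical
    rintro s ⟨w, hw, d, Z, hs⟩
    constructor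
    · rw [← Finset.coe_nonempty, hs]
      exact Set.range_nonempty _
    · intro s' hs' hne
      set J : Finset (Fin (d + 1)) :=
        Finset.univ.filter fun i => w (barycenter b (Z.set i)) ∈ s' with hJ
      have hsJ : (s' : Set N) = (fun i => w (barycenter b (Z.set i))) '' J := by
        ext x
        constructor
        · intro hx
          have : x ∈ (s : Set N) := hs' hx
          rw [hs] at this
          obtain ⟨i, rfl⟩ := this
          exact ⟨i, by simpa [hJ] using hx, rfl⟩
        · rintro ⟨i, hi, rfl⟩
          simpa [hJ] using hi
      have hcard : J.card ≠ 0 := by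
        intro h
        rw [Finset.card_eq_zero.1 h, Finset.coe_empty, Set.image_empty] at hsJ
        exact hne.ne_empty (Finset.coe_eq_empty.1 hsJ)
      obtain ⟨e, he⟩ := Nat.exists_eq_succ_of_ne_zero hcard
      refine ⟨w, hw, e, Z.restrict (J.orderEmbOfFin he), ?_⟩
      rw [hsJ, ← Finset.range_orderEmbOfFin J he, ← Set.range_comp]
      rfl
  indep := by
    rintro s ⟨w, hw, d, Z, hs⟩
    have h1 : AffineIndependent ℝ fun i => w (barycenter b (Z.set i)) :=
      (AffineEquiv.affineIndependent_iff w).2 Z.affineIndependent_barycenter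
    have h2 := h1.range
    rw [← hs] at h2
    exact h2
  -- a common point lies in the interior of a face of each simplex, and these faces coincide
  inter_subset_convexHull := by
    rintro s s' ⟨w, hw, d, Z, hs⟩ ⟨w', hw', d', Z', hs'⟩ x ⟨hx, hx'⟩
    rw [hs, Flag.convexHull_eq] at hx
    rw [hs', Flag.convexHull_eq] at hx'
    obtain ⟨t, rfl⟩ := hx
    obtain ⟨t', ht'⟩ := hx'
    obtain ⟨e, f, u, hu, rfl⟩ := exists_map_eq t
    obtain ⟨e', f', u', hu', rfl⟩ := exists_map_eq t'
    simp only [Flag.param_map] at ht' ⊢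
    have hmem : ∀ i, w (barycenter b ((Z.restrict f).set i)) ∈ (s : Set N) := fun i => by
      rw [hs]
      exact ⟨f i, rfl⟩
    have hmem' : ∀ i, w' (barycenter b ((Z'.restrict f').set i)) ∈ (s' : Set N) := fun i => by
      rw [hs']
      exact ⟨f' i, rfl⟩
    generalize Z.restrict f = X at *
    generalize Z'.restrict f' = X' at *
    obtain ⟨h1, h2⟩ := cell_unique hw hw' hu hu' ht'.symm
    cases h1
    rw [X.affineEquiv_param]
    refine (convex_convexHull ℝ _).sum_mem (fun i _ => stdSimplex.zero_le u i)
      (stdSimplex.sum_eq_one u) fun i _ => subset_convexHull ℝ _ ⟨hmem i, ?_⟩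
    obtain ⟨v, hv⟩ := X.exists_param_eq_barycenter i
    rw [← hv, X.apply_param_eq h2, hv]
    exact hmem' i

variable (b) in
lemma alcoveComplex_space : (alcoveComplex b).space = Set.univ := by
  classical
  refine Set.eq_univ_of_forall fun x => ?_
  obtain ⟨w, hw, d, Z, t, -, rfl⟩ := exists_cell b x
  refine Geometry.SimplicialComplex.mem_space_iff.2
    ⟨Finset.univ.image fun i => w (barycenter b (Z.set i)), ⟨w, hw, d, Z, by simp⟩, ?_⟩
  rw [Finset.coe_image, Finset.coe_univ, Set.image_univ, Flag.convexHull_eq]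
  exact ⟨t, rfl⟩

end Triangulation

/-! ### The topology of the triangulation -/

section Topology

variable {ι M N : Type*} [AddCommGroup M] [Module ℝ M] [AddCommGroup N] [Module ℝ N]
  {P : RootPairing ι ℝ M N} {b : P.Base}
  [Nonempty ι] [Finite ι] [P.IsCrystallographic] [P.IsReduced] [P.IsIrreducible]

lemma abs_root'_le_one (i : ι) {x : N} (hx : x ∈ closedAlcove b) : |P.root' i x| ≤ 1 := by
  have h1 : ∀ k : b.support, 0 ≤ P.root' k x := fun k => by
    simpa [affRoot_simpleAff_some] using hx (some k)
  have h2 := hx none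
  rw [affRoot_simpleAff_none] at h2
  have key : ∀ i, b.IsPos i → |P.root' i x| ≤ 1 := fun i hi => abs_le.2
    ⟨by linarith [root'_fundamental_nonneg b hi h1], by linarith [root'_le_highestRoot b i h1]⟩
  let := P.indexNeg
  rcases RootPairing.Base.IsPos.or_neg b i with h | h
  · exact key i h
  · simpa [RootPairing.root'] using key (-i) h

/-- Only finitely many alcoves meet a given bounded set. -/
lemma finite_setOf_affineWeyl (c : ι → ℝ) :
    {w : affineWeyl b | ∃ p ∈ closedAlcove b, ∀ i, |P.root' i (w.1 p)| ≤ c i}.Finite := by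
  have hex : ∀ (w : affineWeyl b) (i : ι), ∃ a : ι × ℤ, ∀ x,
      P.root' i (w.1 x) = affRoot P a x := fun w i => by
    obtain ⟨a, ha, -⟩ := exists_affRoot_eq (affineWeyl_le_affRootGroup b w.2) (i, 0)
    exact ⟨a, fun x => by simpa [affRoot] using ha x⟩
  -- `w` is determined by the affine roots `α_i ∘ w`, whose constant terms are bounded, since roots
  -- take values in `[-1, 1]` on the closed alcove
  choose Φ hΦ using hex
  have hinj : Function.Injective Φ := fun w w' h => Subtype.ext (AffineEquiv.ext fun x =>
    ext_of_root' b fun i => by rw [hΦ, hΦ, h])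
  refine Set.Finite.of_finite_image (f := Φ) ?_ hinj.injOn
  refine (Set.Finite.pi' (t := fun i => (Set.univ : Set ι) ×ˢ Set.Icc (-⌈c i + 1⌉) ⌈c i + 1⌉)
    fun i => Set.finite_univ.prod (Set.finite_Icc _ _)).subset ?_
  rintro _ ⟨w, ⟨p, hp, hw⟩, rfl⟩ i
  have h1 := abs_le.1 (hw i)
  rw [hΦ] at h1
  have h2 := abs_le.1 (abs_root'_le_one (Φ w i).1 hp)
  simp only [affRoot] at h1
  have h3 := Int.le_ceil (c i + 1)
  refine ⟨trivial, ?_, ?_⟩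
  · have : ((-⌈c i + 1⌉ : ℤ) : ℝ) ≤ ((Φ w i).2 : ℝ) := by push_cast; linarith
    exact_mod_cast this
  · have : ((Φ w i).2 : ℝ) ≤ ⌈c i + 1⌉ := by linarith
    exact_mod_cast this

variable [TopologicalSpace N] [IsTopologicalAddGroup N] [ContinuousSMul ℝ N]

omit [Finite ι] [P.IsCrystallographic] [P.IsReduced] in
lemma Flag.continuous_param {d : ℕ} (Z : Flag b d) : Continuous Z.param :=
  continuous_finsetSum _ fun i _ =>
    ((continuous_apply i).comp continuous_subtype_val).smul continuous_const

variable [T2Space N]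

omit [TopologicalSpace N] [IsTopologicalAddGroup N] [ContinuousSMul ℝ N] [T2Space N] in
lemma finiteDimensional_coroots {P : RootPairing ι ℝ M N} [P.IsIrreducible] (b : P.Base) :
    FiniteDimensional ℝ N :=
  Module.Finite.of_basis b.toCoweightBasis

lemma continuous_root' {P : RootPairing ι ℝ M N} [P.IsIrreducible] (b : P.Base) (i : ι) :
    Continuous (P.root' i) :=
  have := finiteDimensional_coroots b
  LinearMap.continuous_of_finiteDimensional _

lemma continuous_affineEquiv {P : RootPairing ι ℝ M N} [P.IsIrreducible] (b : P.Base)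
    (g : N ≃ᵃ[ℝ] N) : Continuous g := by
  have := finiteDimensional_coroots b
  have h : ∀ x, g x = g.linear x + g 0 := fun x => by simpa using g.map_vadd 0 x
  have h' : ⇑g = fun x => g.linear.toLinearMap x + g 0 := funext h
  rw [h']
  exact (LinearMap.continuous_of_finiteDimensional _).add continuous_const

variable (b) in
omit [P.IsCrystallographic] [P.IsReduced] in
lemma isClosed_closedAlcove : IsClosed (closedAlcove b) := by
  have : closedAlcove b = ⋂ j, {x | 0 ≤ affRoot P (simpleAff b j) x} := by
    ext x
    simp [closedAlcove]
  rw [this]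
  exact isClosed_iInter fun j => isClosed_le continuous_const
    ((continuous_root' b _).add continuous_const)

variable (b) in
lemma closure_alcove : closure (alcove b) = closedAlcove b := by
  refine (closure_minimal alcove_subset_closedAlcove (isClosed_closedAlcove b)).antisymm ?_
  intro x hx
  obtain ⟨y, hy⟩ := alcove_nonempty (b := b)
  -- `x` is the limit of the points `x + t (y - x)` as `t > 0` tends to `0`
  have hlim : Filter.Tendsto (fun t : ℝ => x + t • (y - x)) (nhdsWithin 0 (Set.Ioo 0 1))
      (nhds x) := by
    have : Continuous fun t : ℝ => x + t • (y - x) := by fun_prop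
    have h := this.tendsto 0
    simp only [zero_smul, add_zero] at h
    exact h.mono_left nhdsWithin_le_nhds
  have hne : (nhdsWithin (0 : ℝ) (Set.Ioo 0 1)).NeBot := by
    rw [← mem_closure_iff_nhdsWithin_neBot, closure_Ioo zero_ne_one]
    simp
  refine mem_closure_of_tendsto hlim (Filter.eventually_of_mem self_mem_nhdsWithin ?_)
  rintro t ⟨ht0, ht1⟩
  refine (mem_alcove_iff b _).2 fun j => ?_
  have h1 := hx j
  have h2 := (mem_alcove_iff b _).1 hy j
  have : affRoot P (simpleAff b j) (x + t • (y - x)) =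
      (1 - t) * affRoot P (simpleAff b j) x + t * affRoot P (simpleAff b j) y := by
    simp only [affRoot, map_add, map_smul, map_sub, smul_eq_mul]
    ring
  rw [this]
  exact add_pos_of_nonneg_of_pos (mul_nonneg (by linarith) h1) (mul_pos ht0 h2)

omit [TopologicalSpace N] [IsTopologicalAddGroup N] [ContinuousSMul ℝ N] [T2Space N] in
variable (b) in
lemma closedAlcove_eq_convexHull :
    closedAlcove b = convexHull ℝ (Set.range (alcoveVertex b)) := by
  rw [convexHull_range_eq_image_stdSimplex]
  ext x
  constructor
  · intro hx
    exact ⟨fun j => coord b j x, ⟨coord_nonneg hx, sum_coord b x⟩, sum_coord_smul b x⟩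
  · rintro ⟨t, ht, rfl⟩
    refine mem_closedAlcove_iff_coord.2 fun j => ?_
    rw [coord_sum_smul_vertex _ ht.2]
    exact ht.1 j

omit [P.IsCrystallographic] [P.IsReduced] in
lemma continuous_of_mem_alcoveSimplices {d : ℕ} {σ : stdSimplex ℝ (Fin (d + 1)) → N}
    (hσ : σ ∈ alcoveSimplices b d) : Continuous σ := by
  obtain ⟨w, -, Z, rfl⟩ := hσ
  exact (continuous_affineEquiv b w).comp Z.continuous_param

/-- The triangulation is locally finite, hence `V*` carries the weak topology. -/
lemma isOpen_of_preimage_alcoveSimplices (A : Set N)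
    (hA : ∀ n, ∀ σ ∈ alcoveSimplices b n, IsOpen (σ ⁻¹' A)) : IsOpen A := by
  rw [← isClosed_compl_iff]
  let f : affineWeyl b → Set N := fun w => ⋃ p : Σ d, Flag b d,
    (fun t => w.1 (p.2.param t)) '' ((fun t => w.1 (p.2.param t)) ⁻¹' Aᶜ)
  have hcell : ∀ (w : affineWeyl b) (p : Σ d, Flag b d),
      (fun t => w.1 (p.2.param t)) ∈ alcoveSimplices b p.1 := fun w p => ⟨w.1, w.2, p.2, rfl⟩
  have hf : ∀ w, IsClosed (f w) := fun w => isClosed_iUnion_of_finite fun p => by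
    have h1 : IsClosed ((fun t => w.1 (p.2.param t)) ⁻¹' Aᶜ) :=
      ⟨by simpa using hA _ _ (hcell w p)⟩
    exact (h1.isCompact.image (continuous_of_mem_alcoveSimplices (hcell w p))).isClosed
  have hlf : LocallyFinite f := by
    intro x
    refine ⟨{y | ∀ i, |P.root' i y| < |P.root' i x| + 1}, ?_, ?_⟩
    · refine IsOpen.mem_nhds ?_ fun i => by simp
      rw [Set.ofPred_forall]
      exact isOpen_iInter_of_finite fun i =>
        isOpen_lt (continuous_root' b i).abs continuous_const
    · refine (finite_setOf_affineWeyl (b := b) fun i => |P.root' i x| + 1).subset ?_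
      rintro w ⟨y, hy, hy'⟩
      obtain ⟨p, t, -, rfl⟩ := Set.mem_iUnion.1 hy
      exact ⟨_, p.2.param_mem_closedAlcove t, fun i => (hy' i).le⟩
  have hU : Aᶜ = ⋃ w, f w := by
    ext x
    constructor
    · intro hx
      obtain ⟨w, hw, d, Z, t, -, rfl⟩ := exists_cell b x
      exact Set.mem_iUnion.2 ⟨⟨w, hw⟩, Set.mem_iUnion.2 ⟨⟨d, Z⟩, t, hx, rfl⟩⟩
    · intro hx
      obtain ⟨w, hw⟩ := Set.mem_iUnion.1 hx
      obtain ⟨p, t, ht, rfl⟩ := Set.mem_iUnion.1 hw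
      exact ht
  rw [hU]
  exact hlf.isClosed_iUnion hf

omit [TopologicalSpace N] [IsTopologicalAddGroup N] [ContinuousSMul ℝ N] [T2Space N] in
/-- Two open cells that meet are equal. -/
lemma sigma_alcoveSimplices_eq {p q : Σ n, alcoveSimplices b n} {x : N}
    (hp : x ∈ p.2.1 '' stdInterior p.1) (hq : x ∈ q.2.1 '' stdInterior q.1) : p = q := by
  obtain ⟨d, σ, w, hw, Z, rfl⟩ := p
  obtain ⟨d', σ', w', hw', Z', rfl⟩ := q
  obtain ⟨t, ht, rfl⟩ := hp
  obtain ⟨t', ht', h⟩ := hq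
  obtain ⟨h1, h2⟩ := cell_unique hw hw' ht ht' h.symm
  cases h1
  congr 2
  exact funext fun s => Z.apply_param_eq h2 s

omit [TopologicalSpace N] [IsTopologicalAddGroup N] [ContinuousSMul ℝ N] [T2Space N] in
/-- `W_Y = W_a Ω_Y` permutes the cells, since `Ω_Y` permutes the simplices in the closed alcove. -/
lemma smul_mem_alcoveSimplices {Y : WLattice P} {g : N ≃ᵃ[ℝ] N} (hg : g ∈ Y.extWeyl) {d : ℕ}
    {σ : stdSimplex ℝ (Fin (d + 1)) → N} (hσ : σ ∈ alcoveSimplices b d) :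
    (fun t => g (σ t)) ∈ alcoveSimplices b d := by
  obtain ⟨w, hw, Z, rfl⟩ := hσ
  obtain ⟨w', hw', ω, hω, h⟩ :=
    exists_eq_mul_of_mem_extWeyl (b := b) (mul_mem hg (affineWeyl_le_extWeyl Y hw))
  obtain ⟨Z', hZ'⟩ := exists_moves hω Z
  refine ⟨w', hw', Z', funext fun t => ?_⟩
  rw [← hZ'.apply_param hω]
  exact DFunLike.congr_fun h (Z.param t)

variable (b) in
/-- The triangulation of `V*` by the translates of the simplices of the barycentric subdivision,
with the action of `W_Y`. -/
def cellStructure (Y : WLattice P) : EquivariantDeltaComplex Y.extWeyl N where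
  simplices := alcoveSimplices b
  continuous_of_mem _ _ hσ := continuous_of_mem_alcoveSimplices hσ
  face_mem := by
    rintro m n _ ⟨w, hw, Z, rfl⟩ f
    exact ⟨w, hw, Z.restrict f, funext fun t => congrArg w (Z.param_map f t)⟩
  injOn := by
    rintro n _ ⟨w, hw, Z, rfl⟩
    exact (w.injective.comp Z.param_injective).injOn
  existsUnique_mem x := by
    obtain ⟨w, hw, d, Z, t, ht, rfl⟩ := exists_cell b x
    refine ⟨⟨d, _, w, hw, Z, rfl⟩, ⟨t, ht, rfl⟩, fun q hq => ?_⟩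
    exact sigma_alcoveSimplices_eq hq ⟨t, ht, rfl⟩
  isOpen_of_preimage := isOpen_of_preimage_alcoveSimplices
  smul_mem g _ _ hσ := smul_mem_alcoveSimplices g.2 hσ
  fixes := by
    rintro g n σ hσ h _ ⟨t, ht, rfl⟩
    have h1 : g.1 (σ t) ∈ σ '' stdInterior n := by
      rw [← h]
      exact ⟨σ t, ⟨t, ht, rfl⟩, rfl⟩
    have h2 := sigma_alcoveSimplices_eq (b := b)
      (p := ⟨n, fun t => g.1 (σ t), smul_mem_alcoveSimplices g.2 hσ⟩) (q := ⟨n, σ, hσ⟩)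
      ⟨t, ht, rfl⟩ h1
    have h3 : (fun t => g.1 (σ t)) = σ := by simpa using h2
    exact congrFun h3 t

end Topology

/-! ### Stabilizers and orbits of cells -/

section Stabilizers

variable {ι M N : Type*} [AddCommGroup M] [Module ℝ M] [AddCommGroup N] [Module ℝ N]
  {P : RootPairing ι ℝ M N} {b : P.Base}
  [Nonempty ι] [Finite ι] [P.IsCrystallographic] [P.IsReduced] [P.IsIrreducible]

lemma stdInterior_nonempty (d : ℕ) : (stdInterior d).Nonempty := by
  have h : (0 : ℝ) < ((d + 1 : ℕ) : ℝ)⁻¹ := inv_pos.2 (by exact_mod_cast d.succ_pos)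
  refine ⟨⟨fun _ => ((d + 1 : ℕ) : ℝ)⁻¹, fun _ => h.le, ?_⟩, fun _ => h⟩
  rw [Finset.sum_const, Finset.card_univ, Fintype.card_fin, nsmul_eq_mul,
    mul_inv_cancel₀ (inv_pos.1 h).ne']

omit [Finite ι] [P.IsCrystallographic] [P.IsReduced] in
lemma param_mem_alcoveSimplices {d : ℕ} (Z : Flag b d) : Z.param ∈ alcoveSimplices b d :=
  ⟨1, one_mem _, Z, rfl⟩

/-- The parabolic subgroup `(W_a)_I` for the complement `I` of `Z_d` is the pointwise stabilizer of
the simplex `Z` in the affine Weyl group. -/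
lemma mem_parabolic_iff {d : ℕ} (Z : Flag b d) {w : N ≃ᵃ[ℝ] N} :
    w ∈ parabolic b {j | j ∉ Z.set (Fin.last d)} ↔
      w ∈ affineWeyl b ∧ ∀ t, w (Z.param t) = Z.param t := by
  refine ⟨fun h => ⟨parabolic_le_affineWeyl _ h, Z.param_eq_self_of_mem_parabolic h⟩, ?_⟩
  rintro ⟨hw, h⟩
  obtain ⟨t, ht⟩ := stdInterior_nonempty d
  have := (eq_self_and_mem_parabolic hw (Z.param_mem_closedAlcove t)
    ((h t).symm ▸ Z.param_mem_closedAlcove t)).2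
  rwa [Z.setOf_affRoot_eq_zero ht] at this

variable (Y : WLattice P)

/-- A transformation in `W_Y` that maps the simplex `Z` to the simplex `Z'` is the product of an
element of the pointwise stabilizer of `Z'` in `W_a` and of one that moves `Z` to `Z'` in `Ω_Y`. -/
lemma exists_moves_of_apply_param {g : N ≃ᵃ[ℝ] N} (hg : g ∈ Y.extWeyl) {d : ℕ} {Z Z' : Flag b d}
    (h : ∀ t, g (Z.param t) = Z'.param t) :
    ∃ w ∈ parabolic b {j | j ∉ Z'.set (Fin.last d)}, ∃ ω ∈ Y.alcoveGroup b,
      Z.Moves ω Z' ∧ g = w * ω := by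
  obtain ⟨w, hw, ω, hω, rfl⟩ := exists_eq_mul_of_mem_extWeyl (b := b) hg
  obtain ⟨Z₁, hZ₁⟩ := exists_moves hω Z
  obtain ⟨t, ht⟩ := stdInterior_nonempty d
  have h1 : w (Z₁.param t) = (1 : N ≃ᵃ[ℝ] N) (Z'.param t) := by
    rw [← hZ₁.apply_param hω]
    exact h t
  obtain ⟨h2, h3⟩ := cell_unique hw (one_mem _) ht ht h1
  cases h2
  rw [inv_one, one_mul] at h3
  exact ⟨w, h3, ω, hω, hZ₁, rfl⟩

variable {Y}

/-- An element of `W_Y` that stabilizes an open cell fixes it pointwise. -/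
lemma mem_cellStabilizer_iff {d : ℕ} {Z : Flag b d} {g : N ≃ᵃ[ℝ] N} :
    g ∈ Y.cellStabilizer Z ↔ g ∈ Y.extWeyl ∧ ∀ t, g (Z.param t) = Z.param t := by
  refine and_congr_right fun hg => ⟨fun h => ?_, fun h => ?_⟩
  · have h' : g • Z.openCell = Z.openCell := h
    obtain ⟨t, ht⟩ := stdInterior_nonempty d
    have h1 : g (Z.param t) ∈ Z.param '' stdInterior d := by
      change _ ∈ Z.openCell
      rw [← h']
      exact ⟨Z.param t, ⟨t, ht, rfl⟩, rfl⟩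
    have h2 := sigma_alcoveSimplices_eq (b := b)
      (p := ⟨d, _, smul_mem_alcoveSimplices hg (param_mem_alcoveSimplices Z)⟩)
      (q := ⟨d, Z.param, param_mem_alcoveSimplices Z⟩) ⟨t, ht, rfl⟩ h1
    have h3 : (fun t => g (Z.param t)) = Z.param := by simpa using h2
    exact congrFun h3
  · change g • Z.openCell = Z.openCell
    rw [Flag.openCell, ← Set.image_smul, Set.image_image]
    exact Set.image_congr fun t _ => h t

omit [Finite ι] [P.IsCrystallographic] [P.IsReduced] in
lemma mem_iInf_vertexSetStabilizer_iff {d : ℕ} {Z : Flag b d} {g : N ≃ᵃ[ℝ] N} :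
    g ∈ ⨅ j, Y.vertexSetStabilizer (Z.set j) ↔ g ∈ Y.alcoveGroup b ∧ Z.Moves g Z := by
  rw [Subgroup.mem_iInf]
  exact ⟨fun h => ⟨(h 0).1, fun i => (h i).2⟩, fun h i => ⟨h.1, h.2 i⟩⟩

variable (Y) in
/-- The stabilizer of a cell is generated by its intersections with the normal subgroup `W_a` and
with `Ω_Y`, which have trivial intersection because `W_a` acts freely on the alcoves. -/
theorem isInternalSemidirectProduct_cellStabilizer {d : ℕ} (Z : Flag b d) :
    IsInternalSemidirectProduct (parabolic b {i | i ∉ Z.set (Fin.last d)})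
      (⨅ j, Y.vertexSetStabilizer (Z.set j)) (Y.cellStabilizer Z) := by
  have hA : parabolic b {i | i ∉ Z.set (Fin.last d)} ≤ Y.cellStabilizer Z := fun w hw =>
    mem_cellStabilizer_iff.2
      ⟨affineWeyl_le_extWeyl Y (parabolic_le_affineWeyl _ hw), ((mem_parabolic_iff Z).1 hw).2⟩
  have hB : ⨅ j, Y.vertexSetStabilizer (Z.set j) ≤ Y.cellStabilizer Z := fun g hg => by
    obtain ⟨h1, h2⟩ := mem_iInf_vertexSetStabilizer_iff.1 hg
    exact mem_cellStabilizer_iff.2 ⟨h1.1, h2.apply_param h1⟩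
  refine ⟨hA, hB, ⟨fun a ha g => ?_⟩, ?_, ?_⟩
  · rw [Subgroup.mem_subgroupOf] at ha ⊢
    rw [mem_parabolic_iff] at ha ⊢
    have hg := mem_cellStabilizer_iff.1 g.2
    have hgag := mem_cellStabilizer_iff.1 (g * a * g⁻¹).2
    exact ⟨conj_affineWeyl_of_mem_extWeyl hg.1 ha.1, hgag.2⟩
  · rw [eq_bot_iff]
    rintro w ⟨hw, hw'⟩
    obtain ⟨h1, -⟩ := mem_iInf_vertexSetStabilizer_iff.1 hw'
    obtain ⟨x, hx⟩ := alcove_nonempty (b := b)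
    exact affineWeyl_eq_one_of_alcove (parabolic_le_affineWeyl _ hw) hx
      (alcove_subset_closedAlcove (mem_alcove_of_mem_alcoveGroup h1 hx))
  · refine le_antisymm (sup_le hA hB) fun g hg => ?_
    obtain ⟨hg, hfix⟩ := mem_cellStabilizer_iff.1 hg
    obtain ⟨w, hw, ω, hω, hZ, rfl⟩ := exists_moves_of_apply_param Y hg hfix
    exact Subgroup.mul_mem_sup hw (mem_iInf_vertexSetStabilizer_iff.2 ⟨hω, hZ⟩)

variable (Y) in
omit [Finite ι] [P.IsCrystallographic] [P.IsReduced] in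
lemma existsUnique_orbitRep {d : ℕ} [LinearOrder (Flag b d)] (Z : Flag b d) :
    ∃! R : Y.OrbitRep b d, ∃ ω ∈ Y.alcoveGroup b, R.1.Moves ω Z := by
  obtain ⟨R, ⟨ω, hω, hR⟩, hmin⟩ := Set.exists_min_image
    {Z' : Flag b d | ∃ ω ∈ Y.alcoveGroup b, Z'.Moves ω Z} id (Set.toFinite _)
    ⟨Z, 1, one_mem _, fun i => by simp⟩
  refine ⟨⟨R, fun ω' hω' Z' h => hmin Z' ⟨_, mul_mem hω (inv_mem hω'), h.symm.mul hR⟩⟩,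
    ⟨ω, hω, hR⟩, ?_⟩
  rintro R' ⟨ω', hω', hR'⟩
  refine Subtype.ext (le_antisymm ?_ ?_)
  · exact R'.2 _ (mul_mem (inv_mem hω) hω') _ (hR'.mul hR.symm)
  · exact hmin R'.1 ⟨ω', hω', hR'⟩

omit [Finite ι] [P.IsCrystallographic] [P.IsReduced] in
lemma OrbitRep.eq_of_moves {d : ℕ} [LinearOrder (Flag b d)] {R R' : Y.OrbitRep b d}
    {ω : N ≃ᵃ[ℝ] N} (hω : ω ∈ Y.alcoveGroup b) (h : R.1.Moves ω R'.1) : R = R' :=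
  Subtype.ext (le_antisymm (R.2 ω hω _ h) (R'.2 _ (inv_mem hω) _ h.symm))

end Stabilizers

/-! ### The cellular chains as a sum of permutation modules -/

section SumEquiv

variable {I C : Type*} {X : I → Type*}

/-- The linear map on `ℤ[C]` with prescribed values on the basis. -/
def linComb {A : Type*} [AddCommGroup A] (F : C → A) : ℤ[C] →ₗ[ℤ] A :=
  Finsupp.linearCombination ℤ F ∘ₗ (MonoidAlgebra.coeffLinearEquiv ℤ).toLinearMap

@[simp]
lemma linComb_single {A : Type*} [AddCommGroup A] (F : C → A) (c : C) :
    linComb F (MonoidAlgebra.single c 1) = F c := by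
  simp [linComb]

lemma linearMap_ext_single {A : Type*} [AddCommGroup A] {f g : ℤ[C] →ₗ[ℤ] A}
    (h : ∀ c, f (MonoidAlgebra.single c 1) = g (MonoidAlgebra.single c 1)) : f = g := by
  ext c : 3
  simpa using h c

variable [DecidableEq I]

lemma directSum_ext_single {A : Type*} [AddCommGroup A] {f g : (⨁ i, ℤ[X i]) →ₗ[ℤ] A}
    (h : ∀ i x, f (DirectSum.of (fun i => ℤ[X i]) i (MonoidAlgebra.single x 1)) =
      g (DirectSum.of (fun i => ℤ[X i]) i (MonoidAlgebra.single x 1))) : f = g := by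
  refine DirectSum.linearMap_ext ℤ fun i => linearMap_ext_single fun x => ?_
  exact h i x

/-- The isomorphism `⨁ ℤ[X_i] ≅ ℤ[C]` defined by a bijection between `C` and the disjoint union of
the sets `X_i`. -/
def directSumEquiv (e : (Σ i, X i) ≃ C) : (⨁ i, ℤ[X i]) ≃ₗ[ℤ] ℤ[C] :=
  LinearEquiv.ofLinearMap
    (DirectSum.toModule ℤ I ℤ[C] fun i => linComb fun x => MonoidAlgebra.single (e ⟨i, x⟩) 1)
    (linComb fun c => DirectSum.of (fun i => ℤ[X i]) (e.symm c).1
      (MonoidAlgebra.single (e.symm c).2 1))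
    (linearMap_ext_single fun c => by
      rw [LinearMap.comp_apply, linComb_single, ← DirectSum.lof_eq_of ℤ, DirectSum.toModule_lof,
        linComb_single]
      simp)
    (directSum_ext_single fun i x => by
      rw [← DirectSum.lof_eq_of ℤ, LinearMap.comp_apply, DirectSum.toModule_lof, linComb_single,
        linComb_single, e.symm_apply_apply, LinearMap.id_apply, DirectSum.lof_eq_of])

lemma directSumEquiv_of (e : (Σ i, X i) ≃ C) (i : I) (x : X i) :
    directSumEquiv e (DirectSum.of (fun i => ℤ[X i]) i (MonoidAlgebra.single x 1)) =
      MonoidAlgebra.single (e ⟨i, x⟩) 1 := by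
  rw [← DirectSum.lof_eq_of ℤ]
  change DirectSum.toModule ℤ I ℤ[C] _ _ = _
  rw [DirectSum.toModule_lof, linComb_single]

end SumEquiv

section Chains

variable {ι M N : Type*} [AddCommGroup M] [Module ℝ M] [AddCommGroup N] [Module ℝ N]
  {P : RootPairing ι ℝ M N} {b : P.Base}
  [Nonempty ι] [Finite ι] [P.IsCrystallographic] [P.IsReduced] [P.IsIrreducible]
  [TopologicalSpace N] [IsTopologicalAddGroup N] [ContinuousSMul ℝ N] [T2Space N]
  (Y : WLattice P)

/-- The simplex `Z` of the closed alcove, as a cell of `V*`. -/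
def cellOf {d : ℕ} (Z : Flag b d) : (cellStructure b Y).Cell d :=
  ⟨Z.param, param_mem_alcoveSimplices Z⟩

lemma smul_cellOf_eq_iff {d : ℕ} {Z Z' : Flag b d} {g g' : Y.extWeyl} :
    g • cellOf Y Z = g' • cellOf Y Z' ↔ ∀ t, (g'⁻¹ * g).1 (Z.param t) = Z'.param t := by
  rw [← inv_smul_eq_iff, ← mul_smul, Subtype.ext_iff, funext_iff]
  rfl

lemma smul_cellOf_eq_of_moves {d : ℕ} {Z Z' : Flag b d} (ω : Y.alcoveGroup b)
    (h : Z.Moves ω.1 Z') :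
    (Subgroup.inclusion inf_le_left ω : Y.extWeyl) • cellOf Y Z = cellOf Y Z' :=
  Subtype.ext (funext fun t => h.apply_param ω.2 t)

variable {d : ℕ} [LinearOrder (Flag b d)]

variable (b d) in
/-- The map `(Z, g (W_Y)_Z) ↦ g |Z|` from the disjoint union of the coset spaces to the cells. -/
def cosetToCell (p : Σ Z : Y.OrbitRep b d,
    Y.extWeyl ⧸ (Y.cellStabilizer Z.1).subgroupOf Y.extWeyl) : (cellStructure b Y).Cell d :=
  Quotient.liftOn' p.2 (fun g => g • cellOf Y p.1.1) fun g g' h => by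
    rw [QuotientGroup.leftRel_apply, Subgroup.mem_subgroupOf] at h
    exact ((smul_cellOf_eq_iff Y).2 (mem_cellStabilizer_iff.1 h).2).symm

lemma cosetToCell_mk (Z : Y.OrbitRep b d) (g : Y.extWeyl) :
    cosetToCell b Y d ⟨Z, QuotientGroup.mk g⟩ = g • cellOf Y Z.1 := rfl

variable (b d) in
/-- Every orbit contains the cell of exactly one representative `Z`, and the stabilizer of this cell
is `(W_Y)_Z`. -/
lemma cosetToCell_bijective : Function.Bijective (cosetToCell b Y d) := by
  constructor
  · rintro ⟨Z, q⟩ ⟨Z', q'⟩ h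
    induction q using QuotientGroup.induction_on with
    | H g =>
    induction q' using QuotientGroup.induction_on with
    | H g' =>
    rw [cosetToCell_mk, cosetToCell_mk, smul_cellOf_eq_iff] at h
    obtain ⟨w, -, ω, hω, hZ, -⟩ := exists_moves_of_apply_param Y (g'⁻¹ * g).2 h
    obtain rfl := OrbitRep.eq_of_moves hω hZ
    congr 1
    refine (QuotientGroup.eq.2 ?_).symm
    exact mem_cellStabilizer_iff.2 ⟨(g'⁻¹ * g).2, h⟩
  · rintro ⟨σ, w, hw, Z, rfl⟩
    obtain ⟨R, ⟨ω, hω, hR⟩, -⟩ := existsUnique_orbitRep Y Z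
    refine ⟨⟨R, QuotientGroup.mk ⟨w * ω, mul_mem (affineWeyl_le_extWeyl Y hw) hω.1⟩⟩, ?_⟩
    rw [cosetToCell_mk]
    exact Subtype.ext (funext fun t => congrArg w (hR.apply_param hω t))

variable (b d) in
/-- The isomorphism `⨁_i ℤ[W_Y / (W_Y)_{Z_{d,i}}] ≅ C_d`. -/
def chainEquiv : (Y.orbitRep b d).Equiv ((cellStructure b Y).chainRep d) :=
  .mk (directSumEquiv (Equiv.ofBijective _ (cosetToCell_bijective b Y d))) fun g => by
    refine directSum_ext_single fun Z q => ?_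
    induction q using QuotientGroup.induction_on with
    | H h =>
    simp only [LinearMap.comp_apply, LinearEquiv.coe_coe]
    rw [directSumEquiv_of, Representation.ofMulAction_single]
    change directSumEquiv _ (DirectSum.lmap _ _) = _
    rw [← DirectSum.lof_eq_of ℤ, DirectSum.lmap_lof, Representation.ofMulAction_single,
      DirectSum.lof_eq_of, directSumEquiv_of]
    congr 1

lemma chainEquiv_gen (Z : Y.OrbitRep b d) (g : Y.extWeyl) :
    chainEquiv b Y d (Y.gen Z g) = MonoidAlgebra.single (g • cellOf Y Z.1) 1 := by
  exact directSumEquiv_of (Equiv.ofBijective _ (cosetToCell_bijective b Y d)) Z (QuotientGroup.mk g)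

end Chains

/-! ### The boundary -/

namespace EquivariantDeltaComplex

variable {G X : Type*} [Group G] [MulAction G X] [TopologicalSpace X]
  (K : EquivariantDeltaComplex G X)

lemma cellularComplex_d (n : ℕ) :
    K.cellularComplex.d (n + 1) n = Rep.ofHom ⟨K.boundary n, K.boundary_equivariant n⟩ :=
  ChainComplex.of_d (fun n => Rep.of (K.chainRep n))
    (fun n => Rep.ofHom ⟨K.boundary n, K.boundary_equivariant n⟩) n

lemma cellularComplex_d_apply (n : ℕ) (x : ℤ[K.Cell (n + 1)]) :
    (K.cellularComplex.d (n + 1) n).hom x = K.boundary n x :=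
  congrArg (fun f => Rep.Hom.hom f x) (K.cellularComplex_d n)

end EquivariantDeltaComplex

section Boundary

variable {ι M N : Type*} [AddCommGroup M] [Module ℝ M] [AddCommGroup N] [Module ℝ N]
  {P : RootPairing ι ℝ M N} {b : P.Base}
  [Nonempty ι] [Finite ι] [P.IsCrystallographic] [P.IsReduced] [P.IsIrreducible]
  [TopologicalSpace N] [IsTopologicalAddGroup N] [ContinuousSMul ℝ N] [T2Space N]
  (Y : WLattice P)

lemma restrict_cellOf {m d : ℕ} (f : Fin (m + 1) ↪o Fin (d + 1)) (Z : Flag b d) :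
    (cellStructure b Y).restrict f (cellOf Y Z) = cellOf Y (Z.restrict f) :=
  Subtype.ext (funext fun t => Z.param_map f t)

variable [∀ d, LinearOrder (Flag b d)]

/-- The `p`-th face of the representative `Z` is the translate by `ω_p` of the representative of its
orbit. -/
lemma boundary_chainEquiv_gen (d : ℕ) (Z : Y.OrbitRep b (d + 1)) (R : Fin (d + 2) → Y.OrbitRep b d)
    (ω : Fin (d + 2) → Y.alcoveGroup b) (hR : ∀ p, (R p).1.Moves (ω p).1 (Z.1.face p)) :
    (cellStructure b Y).boundary d (chainEquiv b Y (d + 1) (Y.gen Z 1)) =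
      ∑ p : Fin (d + 2), (-1 : ℤ) ^ (p : ℕ) •
        chainEquiv b Y d (Y.gen (R p) (Subgroup.inclusion inf_le_left (ω p))) := by
  rw [chainEquiv_gen, one_smul, EquivariantDeltaComplex.boundary_single]
  refine Finset.sum_congr rfl fun p _ => ?_
  rw [chainEquiv_gen, smul_cellOf_eq_of_moves Y (ω p) (hR p), restrict_cellOf,
    Flag.face_eq_restrict]

end Boundary

/-! ### The cup product -/

namespace EquivariantDeltaComplex

variable {G X : Type*} [Group G] [MulAction G X] [TopologicalSpace X]
  (K : EquivariantDeltaComplex G X)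

lemma cup_apply_single {p q m : ℕ} (h : p + q = m) (φ : K.Cochain p) (ψ : K.Cochain q)
    (σ : K.Cell m) : K.cup h φ ψ (MonoidAlgebra.single σ 1) =
      φ (MonoidAlgebra.single (K.restrict (frontFace h) σ) 1) *
        ψ (MonoidAlgebra.single (K.restrict (backFace h) σ) 1) :=
  K.cochainOf_single _ σ

lemma restrict_eq_self {n : ℕ} (f : Fin (n + 1) ↪o Fin (n + 1)) (σ : K.Cell n) :
    K.restrict f σ = σ := by
  obtain rfl : f = RelEmbedding.refl _ :=
    DFunLike.ext' (f.strictMono.range_inj strictMono_id |>.1 (by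
      rw [Set.range_id]
      exact (Finite.surjective_of_injective f.injective).range_eq))
  refine Subtype.ext (funext fun x => ?_)
  exact congrArg σ.1 (stdSimplex.map_id_apply x)

lemma coboundary_apply_single (n : ℕ) (φ : K.Cochain n) (σ : K.Cell (n + 1)) :
    K.coboundary n φ (MonoidAlgebra.single σ 1) = ∑ p : Fin (n + 2), (-1 : ℤ) ^ (p : ℕ) *
      φ (MonoidAlgebra.single (K.restrict (Fin.succAboveOrderEmb p) σ) 1) := by
  rw [coboundary, LinearMap.dualMap_apply, boundary_single, map_sum]
  refine Finset.sum_congr rfl fun p _ => ?_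
  rw [map_zsmul, smul_eq_mul]

lemma cochainRep_apply_single (n : ℕ) (g : G) (φ : K.Cochain n) (σ : K.Cell n) :
    K.cochainRep n g φ (MonoidAlgebra.single σ 1) = φ (MonoidAlgebra.single (g⁻¹ • σ) 1) := by
  simp [Representation.dual]

lemma frontFace_val {p q m : ℕ} (h : p + q = m) (i : Fin (p + 1)) :
    (frontFace h i : ℕ) = i := rfl

lemma backFace_val {p q m : ℕ} (h : p + q = m) (i : Fin (q + 1)) :
    (backFace h i : ℕ) = p + i := rfl

/-- The Leibniz rule: a face of an `(m + 1)`-simplex obtained by omitting a vertex contributes to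
`d φ ∪ ψ` when the vertex belongs to the front part and to `φ ∪ d ψ` when it belongs to the back
part; the two remaining terms, in which the common vertex is omitted, cancel. -/
lemma coboundary_cup {p q m : ℕ} (h : p + q = m) (h₁ : (p + 1) + q = m + 1)
    (h₂ : p + (q + 1) = m + 1) (φ : K.Cochain p) (ψ : K.Cochain q) :
    K.coboundary m (K.cup h φ ψ) =
      K.cup h₁ (K.coboundary p φ) ψ + (-1 : ℤ) ^ p • K.cup h₂ φ (K.coboundary q ψ) := by
  refine K.cochain_ext fun σ => ?_
  rw [LinearMap.add_apply, LinearMap.smul_apply, cup_apply_single, cup_apply_single,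
    coboundary_apply_single, coboundary_apply_single, coboundary_apply_single]
  simp only [cup_apply_single, restrict_restrict]
  have hm : p + 1 + (q + 1) = m + 2 := by omega
  rw [Fin.sum_univ_castSucc (n := p + 1), Fin.sum_univ_succ (n := q + 1),
    ← (finCongr hm).sum_comp, Fin.sum_univ_add]
  have e1 : ∀ i : Fin (p + 1),
      (frontFace h).trans (Fin.succAboveOrderEmb (Fin.cast hm
        (Fin.castAdd (q + 1) i))) =
      (Fin.succAboveOrderEmb i.castSucc).trans (frontFace h₁) := fun i => by
    ext k
    simp only [RelEmbedding.coe_trans, Function.comp_apply, Fin.succAboveOrderEmb_apply,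
      frontFace_val, Fin.succAbove, Fin.lt_def, Fin.val_cast, Fin.val_castAdd,
      Fin.val_castSucc]
    split_ifs <;> simp [frontFace_val]
  have e2 : ∀ i : Fin (p + 1),
      (backFace h).trans (Fin.succAboveOrderEmb (Fin.cast hm
        (Fin.castAdd (q + 1) i))) = backFace h₁ := fun i => by
    ext k
    simp only [RelEmbedding.coe_trans, Function.comp_apply, Fin.succAboveOrderEmb_apply,
      backFace_val, Fin.succAbove, Fin.lt_def, Fin.val_cast, Fin.val_castAdd,
      Fin.val_castSucc]
    have := i.2
    split_ifs <;> simp [backFace_val] <;> omega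
  have e3 : ∀ j : Fin (q + 1),
      (frontFace h).trans (Fin.succAboveOrderEmb (Fin.cast hm
        (Fin.natAdd (p + 1) j))) = frontFace h₂ := fun j => by
    ext k
    simp only [RelEmbedding.coe_trans, Function.comp_apply, Fin.succAboveOrderEmb_apply,
      frontFace_val, Fin.succAbove, Fin.lt_def, Fin.val_cast, Fin.val_natAdd,
      Fin.val_castSucc]
    have := k.2
    rw [if_pos (by omega)]
    rfl
  have e4 : ∀ j : Fin (q + 1),
      (backFace h).trans (Fin.succAboveOrderEmb (Fin.cast hm
        (Fin.natAdd (p + 1) j))) =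
      (Fin.succAboveOrderEmb j.succ).trans (backFace h₂) := fun j => by
    ext k
    simp only [RelEmbedding.coe_trans, Function.comp_apply, Fin.succAboveOrderEmb_apply,
      backFace_val, Fin.succAbove, Fin.lt_def, Fin.val_cast, Fin.val_natAdd,
      Fin.val_castSucc, Fin.val_succ]
    split_ifs <;> simp [backFace_val] <;> omega
  have e5 : (Fin.succAboveOrderEmb (Fin.last (p + 1))).trans (frontFace h₁) = frontFace h₂ := by
    ext k
    simp [frontFace_val]
  have e6 : (Fin.succAboveOrderEmb (0 : Fin (q + 2))).trans (backFace h₂) = backFace h₁ := by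
    ext k
    simp [backFace_val]
    omega
  simp only [finCongr_apply, e1, e2, e3, e4, e5, e6, Fin.val_cast, Fin.val_castAdd, Fin.val_natAdd,
    Fin.val_castSucc, Fin.val_last, Fin.val_succ, Fin.val_zero, add_mul, Finset.sum_mul, mul_add,
    Finset.mul_sum, smul_eq_mul]
  have key {A A' B B' x y : ℤ} (hA : A = A') (hB : B = B') (h : x + y = 0) :
      A + B = A' + x + (y + B') := by
    linarith
  exact key (Finset.sum_congr rfl fun i _ => by ring) (Finset.sum_congr rfl fun j _ => by ring)
    (by ring)

/-- The cochains of an equivariant Delta-complex form a differential graded algebra with an action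
of the group. -/
theorem isEquivariantDGAlgebra :
    IsEquivariantDGAlgebra K.cochainRep K.coboundary K.cup K.unit where
  d_d n a := K.cochain_ext fun σ => by
    have := LinearMap.congr_fun (K.boundary_boundary n) (MonoidAlgebra.single σ 1)
    rw [LinearMap.comp_apply] at this
    rw [coboundary, coboundary, LinearMap.dualMap_apply, LinearMap.dualMap_apply, this]
    simp
  mul_assoc hpq hqr hs ht a b c := K.cochain_ext fun σ => by
    simp only [cup_apply_single, restrict_restrict, mul_assoc]
    have e1 : (frontFace hpq).trans (frontFace hs) = frontFace ht := by
      ext i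
      simp [frontFace_val]
    have e2 : (backFace hpq).trans (frontFace hs) = (frontFace hqr).trans (backFace ht) := by
      ext i
      simp [frontFace_val, backFace_val]
    have e3 : (backFace hqr).trans (backFace ht) = backFace hs := by
      ext i
      simp [backFace_val]
      omega
    rw [e1, e2, e3]
  one_mul n a := K.cochain_ext fun σ => by
    rw [cup_apply_single, unit, cochainOf_single, one_mul, restrict_eq_self]
  mul_one n a := K.cochain_ext fun σ => by
    rw [cup_apply_single, unit, cochainOf_single, mul_one, restrict_eq_self]
  leibniz := K.coboundary_cup
  d_smul g n a := K.cochain_ext fun σ => by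
    simp only [coboundary_apply_single, cochainRep_apply_single, smul_restrict]
  mul_smul g _ _ _ h a b := K.cochain_ext fun σ => by
    simp only [cup_apply_single, cochainRep_apply_single, smul_restrict]
  one_smul g := K.cochain_ext fun σ => by
    rw [cochainRep_apply_single, unit, cochainOf_single, cochainOf_single]

open Classical in
lemma dualCell_apply_single {n : ℕ} (σ τ : K.Cell n) :
    K.dualCell σ (MonoidAlgebra.single τ 1) = if τ = σ then 1 else 0 :=
  K.cochainOf_single _ τ

/-- This applies when the last vertex of `σ` is not the first vertex of `σ'`: then no cell has front
face `σ` and back face `σ'`. -/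
lemma cup_dualCell_eq_zero {p q m : ℕ} (h : p + q = m) {σ : K.Cell p} {σ' : K.Cell q}
    (hσ : ∀ τ : K.Cell m, K.restrict (frontFace h) τ = σ → K.restrict (backFace h) τ ≠ σ') :
    K.cup h (K.dualCell σ) (K.dualCell σ') = 0 := by
  refine K.cochain_ext fun τ => ?_
  rw [cup_apply_single, dualCell_apply_single, dualCell_apply_single, LinearMap.zero_apply]
  by_cases h1 : K.restrict (frontFace h) τ = σ
  · rw [if_neg (hσ τ h1), mul_zero]
  · rw [if_neg h1, zero_mul]

/-- If `ρ` is the only cell with front face `σ` and back face `σ'`, then `σ* ∪ σ'* = ρ*`. -/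
lemma cup_dualCell_eq {p q m : ℕ} (h : p + q = m) {σ : K.Cell p} {σ' : K.Cell q} {ρ : K.Cell m}
    (hσ : ∀ τ : K.Cell m,
      K.restrict (frontFace h) τ = σ ∧ K.restrict (backFace h) τ = σ' ↔ τ = ρ) :
    K.cup h (K.dualCell σ) (K.dualCell σ') = K.dualCell ρ := by
  classical
  refine K.cochain_ext fun τ => ?_
  simp only [cup_apply_single, dualCell_apply_single, ← hσ τ, ite_and, ite_mul, one_mul, zero_mul]

/-- The last vertex of the front face is the first vertex of the back face. -/
lemma restrict_last_frontFace {p q m : ℕ} (h : p + q = m) (τ : K.Cell m) :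
    K.restrict (Fin.natAddOrderEmb p) (K.restrict (frontFace h) τ) =
      K.restrict (Fin.castLEOrderEmb (Nat.le_add_left 1 q)) (K.restrict (backFace h) τ) := by
  rw [restrict_restrict, restrict_restrict]
  congr 1

end EquivariantDeltaComplex

/-! ### Cup products of dual cells -/

section DualCells

open EquivariantDeltaComplex

variable {ι M N : Type*} [AddCommGroup M] [Module ℝ M] [AddCommGroup N] [Module ℝ N]
  {P : RootPairing ι ℝ M N} {b : P.Base}

lemma Flag.append_restrict_frontFace {p q : ℕ} (Z : Flag b p) (Z' : Flag b q)
    (h : Z.set (Fin.last p) = Z'.set 0) : (Z.append Z' h).restrict (frontFace rfl) = Z := by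
  refine Flag.ext_set (funext fun i => ?_)
  exact dif_pos (Nat.lt_succ_iff.1 i.2)

lemma Flag.append_restrict_backFace {p q : ℕ} (Z : Flag b p) (Z' : Flag b q)
    (h : Z.set (Fin.last p) = Z'.set 0) : (Z.append Z' h).restrict (backFace rfl) = Z' := by
  refine Flag.ext_set (funext fun i => ?_)
  change (Z.append Z' h).set (backFace rfl i) = _
  rw [Flag.append]
  dsimp only
  split_ifs with hi
  · change p + (i : ℕ) ≤ p at hi
    obtain rfl : i = 0 := Fin.ext (by simpa using hi)
    exact h
  · congr 1
    exact Fin.ext (by simp [backFace_val])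

lemma Flag.ext_frontFace_backFace {p q m : ℕ} (h : p + q = m) {Z Z' : Flag b m}
    (h1 : Z.restrict (frontFace h) = Z'.restrict (frontFace h))
    (h2 : Z.restrict (backFace h) = Z'.restrict (backFace h)) : Z = Z' := by
  refine Flag.ext_set (funext fun i => ?_)
  by_cases hi : (i : ℕ) ≤ p
  · exact congrFun (congrArg Flag.set h1) ⟨i, by omega⟩
  · have := congrFun (congrArg Flag.set h2) ⟨i - p, by omega⟩
    have hi' : backFace h ⟨i - p, by omega⟩ = i :=
      Fin.ext (by rw [backFace_val]; simp only; omega)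
    change Z.set (backFace h _) = Z'.set (backFace h _) at this
    rwa [hi'] at this

variable
  [Nonempty ι] [Finite ι] [P.IsCrystallographic] [P.IsReduced] [P.IsIrreducible]
  [TopologicalSpace N] [IsTopologicalAddGroup N] [ContinuousSMul ℝ N] [T2Space N]
  (Y : WLattice P)

lemma cellOf_injective {d : ℕ} : Function.Injective (cellOf (d := d) (b := b) Y) := by
  intro Z Z' h
  obtain ⟨t, ht⟩ := stdInterior_nonempty d
  have := Flag.sigma_eq_of_param_eq (Z := Z) (Z' := Z') ht ht
    (congrFun (congrArg Subtype.val h) t)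
  simpa using this

/-- A cell `w |Z|` with a face in the closed alcove has this face in common with `|Z|`, and `w`
fixes it pointwise. -/
lemma restrict_eq_cellOf {m d : ℕ} {f : Fin (m + 1) ↪o Fin (d + 1)} {Z' : Flag b m} {Z : Flag b d}
    {w : N ≃ᵃ[ℝ] N} (hw : w ∈ affineWeyl b) {τ : (cellStructure b Y).Cell d}
    (hτ : τ.1 = fun t => w (Z.param t)) (h : (cellStructure b Y).restrict f τ = cellOf Y Z') :
    Z.restrict f = Z' ∧ w ∈ parabolic b {j | j ∉ Z'.set (Fin.last m)} := by
  obtain ⟨t, ht⟩ := stdInterior_nonempty m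
  have h1 : w ((Z.restrict f).param t) = (1 : N ≃ᵃ[ℝ] N) (Z'.param t) := by
    rw [← Z.param_map]
    have := congrFun (congrArg Subtype.val h) t
    change τ.1 _ = Z'.param t at this
    rw [hτ] at this
    exact this
  obtain ⟨h2, h3⟩ := cell_unique hw (one_mem _) ht ht h1
  rw [inv_one, one_mul] at h3
  have h4 : Z.restrict f = Z' := by simpa using h2
  exact ⟨h4, h4 ▸ h3⟩

lemma cup_dualCell_cellOf_eq_zero {p q : ℕ} {Z : Flag b p} {Z' : Flag b q}
    (h : Z.set (Fin.last p) ≠ Z'.set 0) :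
    (cellStructure b Y).cup rfl ((cellStructure b Y).dualCell (cellOf Y Z))
      ((cellStructure b Y).dualCell (cellOf Y Z')) = 0 := by
  refine cup_dualCell_eq_zero _ _ fun τ h1 h2 => h ?_
  have h3 := restrict_last_frontFace _ rfl τ
  rw [h1, h2, restrict_cellOf, restrict_cellOf] at h3
  exact congrFun (congrArg Flag.set (cellOf_injective Y h3)) 0

lemma cup_dualCell_cellOf_eq {p q : ℕ} {Z : Flag b p} {Z' : Flag b q}
    (h : Z.set (Fin.last p) = Z'.set 0) :
    (cellStructure b Y).cup rfl ((cellStructure b Y).dualCell (cellOf Y Z))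
      ((cellStructure b Y).dualCell (cellOf Y Z')) =
      (cellStructure b Y).dualCell (cellOf Y (Z.append Z' h)) := by
  refine cup_dualCell_eq _ _ fun τ => ⟨?_, ?_⟩
  · rintro ⟨h1, h2⟩
    obtain ⟨w, hw, Z₁, hτ⟩ := τ.2
    obtain ⟨h3, -⟩ := restrict_eq_cellOf Y hw hτ h1
    obtain ⟨h4, h5⟩ := restrict_eq_cellOf Y hw hτ h2
    obtain rfl : Z₁ = Z.append Z' h := Flag.ext_frontFace_backFace rfl
      (h3.trans (Z.append_restrict_frontFace Z' h).symm)
      (h4.trans (Z.append_restrict_backFace Z' h).symm)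
    refine Subtype.ext (hτ.trans (funext fun t => ?_))
    -- `w` lies in the parabolic subgroup of the back face, which depends only on its last vertex
    -- and hence is also the one of the whole simplex
    refine Flag.param_eq_self_of_mem_parabolic _ ?_ t
    rw [← h4] at h5
    exact h5
  · rintro rfl
    rw [restrict_cellOf, restrict_cellOf, Z.append_restrict_frontFace,
      Z.append_restrict_backFace]
    exact ⟨rfl, rfl⟩

end DualCells

/-! ### The torus -/

section Torus

variable {ι M N : Type*} [AddCommGroup M] [Module ℝ M] [AddCommGroup N] [Module ℝ N]
  {P : RootPairing ι ℝ M N} {b : P.Base}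
  [Nonempty ι] [Finite ι] [P.IsCrystallographic] [P.IsReduced] [P.IsIrreducible]

omit [Nonempty ι] [Finite ι] [P.IsCrystallographic] [P.IsReduced] [P.IsIrreducible] in
lemma weyl_apply_zero {w : N ≃ᵃ[ℝ] N} (hw : w ∈ weyl P) : w 0 = 0 := by
  simpa using weyl_map_add hw 0 0

omit [Nonempty ι] [Finite ι] [P.IsCrystallographic] [P.IsReduced] [P.IsIrreducible] in
/-- `W_Y` is the semidirect product of `t(Y)` and `W`: a translation in `W` fixes `0`. -/
theorem weylToQuotient_bijective (Y : WLattice P) : Function.Bijective Y.weylToQuotient := by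
  constructor
  · rw [injective_iff_map_eq_one]
    intro w hw
    obtain ⟨y, -, hy⟩ := Y.mem_translations.1 ((QuotientGroup.eq_one_iff (N := Y.translationsIn)
      (Subgroup.inclusion le_sup_right w)).1 hw)
    have h0 : y + 0 = 0 := (DFunLike.congr_fun hy 0).trans (weyl_apply_zero w.2)
    rw [add_zero] at h0
    subst h0
    refine Subtype.ext (hy.symm.trans ?_)
    ext x
    exact zero_add x
  · have key : Y.extWeyl ≤ ((Y.weylToQuotient.range).comap
        (QuotientGroup.mk' Y.translationsIn)).map Y.extWeyl.subtype := by
      refine sup_le (fun g hg => ?_) fun g hg => ?_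
      · refine ⟨⟨g, (le_sup_left : Y.translations ≤ Y.extWeyl) hg⟩, ⟨1, ?_⟩, rfl⟩
        rw [map_one]
        exact ((QuotientGroup.eq_one_iff (N := Y.translationsIn) ⟨g, _⟩).2 hg).symm
      · exact ⟨⟨g, (le_sup_right : weyl P ≤ Y.extWeyl) hg⟩, ⟨⟨g, hg⟩, rfl⟩, rfl⟩
    intro q
    induction q using QuotientGroup.induction_on with
    | H g =>
    obtain ⟨g', ⟨w, hw⟩, h⟩ := key g.2
    exact ⟨w, hw.trans (congrArg _ (Subtype.ext h))⟩

omit [Nonempty ι] [Finite ι] [P.IsCrystallographic] [P.IsReduced] [P.IsIrreducible] in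
lemma torus_mk_eq_iff (Y : WLattice P) {x y : N} :
    (QuotientAddGroup.mk x : Y.Torus) = QuotientAddGroup.mk y ↔ ∃ g ∈ Y.translations, g x = y := by
  rw [QuotientAddGroup.eq]
  constructor
  · intro h
    exact ⟨_, Y.mem_translations.2 ⟨_, h, rfl⟩, neg_add_cancel_comm x y⟩
  · rintro ⟨g, hg, rfl⟩
    obtain ⟨v, hv, rfl⟩ := Y.mem_translations.1 hg
    change -x + (v + x) ∈ _
    rwa [add_comm v, neg_add_cancel_left]

omit [Nonempty ι] [Finite ι] [P.IsCrystallographic] [P.IsReduced] [P.IsIrreducible] in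
lemma torus_mk_translation (Y : WLattice P) {g : N ≃ᵃ[ℝ] N} (hg : g ∈ Y.translations) (x : N) :
    (QuotientAddGroup.mk (g x) : Y.Torus) = QuotientAddGroup.mk x :=
  ((torus_mk_eq_iff Y).2 ⟨g, hg, rfl⟩).symm

variable [TopologicalSpace N] [IsTopologicalAddGroup N] [ContinuousSMul ℝ N] [T2Space N]

omit [P.IsCrystallographic] [P.IsReduced] in
/-- All roots take integral values on `Y`, hence `0` is the only point of `Y` in the neighbourhood
where they are less than `1` in absolute value. -/
lemma discreteTopology_wlattice (b : P.Base) (Y : WLattice P) :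
    DiscreteTopology Y.toAddSubgroup := by
  refine discreteTopology_of_isOpen_singleton_zero ⟨{x | ∀ i, |P.root' i x| < 1}, ?_, ?_⟩
  · rw [Set.ofPred_forall]
    exact isOpen_iInter_of_finite fun i => isOpen_lt (continuous_root' b i).abs continuous_const
  · ext y
    refine ⟨fun h => ?_, ?_⟩
    · refine Subtype.ext (ext_of_root' b fun i => ?_)
      obtain ⟨k, hk⟩ := Y.le_coweight y.2 i
      have h1 : |P.root' i y.1| < 1 := h i
      rw [hk, ← Int.cast_abs] at h1
      have h2 : |k| < 1 := by exact_mod_cast h1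
      rw [hk, Int.abs_lt_one_iff.1 h2]
      simp
    · rintro rfl i
      simp

omit [P.IsCrystallographic] [P.IsReduced] in
lemma t2Space_torus (b : P.Base) (Y : WLattice P) : T2Space Y.Torus := by
  have := discreteTopology_wlattice b Y
  infer_instance

omit [TopologicalSpace N] [IsTopologicalAddGroup N] [ContinuousSMul ℝ N] [T2Space N] in
/-- Two open cells of `V*` whose images in the torus meet differ by a translation in `Y`. -/
lemma exists_translation_of_mk_eq (Y : WLattice P) {p q : Σ n, alcoveSimplices b n}
    {t : stdSimplex ℝ (Fin (p.1 + 1))} {t' : stdSimplex ℝ (Fin (q.1 + 1))}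
    (ht : t ∈ stdInterior p.1) (ht' : t' ∈ stdInterior q.1)
    (h : (QuotientAddGroup.mk (p.2.1 t) : Y.Torus) = QuotientAddGroup.mk (q.2.1 t')) :
    ∃ g, ∃ hg : g ∈ Y.translations, g (p.2.1 t) = q.2.1 t' ∧
      (⟨p.1, fun s => g (p.2.1 s), smul_mem_alcoveSimplices
        ((le_sup_left : Y.translations ≤ Y.extWeyl) hg) p.2.2⟩ : Σ n, alcoveSimplices b n) = q := by
  obtain ⟨g, hg, h⟩ := (torus_mk_eq_iff Y).1 h
  exact ⟨g, hg, h, sigma_alcoveSimplices_eq ⟨t, ht, rfl⟩ ⟨t', ht', h.symm⟩⟩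

variable (b) in
/-- The images in the torus `V* / Y` of the `d`-simplices of the triangulation of `V*`. -/
def torusSimplices (Y : WLattice P) (d : ℕ) : Set (stdSimplex ℝ (Fin (d + 1)) → Y.Torus) :=
  {τ | ∃ σ ∈ alcoveSimplices b d, τ = fun x => QuotientAddGroup.mk (σ x)}

omit [TopologicalSpace N] [IsTopologicalAddGroup N] [ContinuousSMul ℝ N] [T2Space N] in
lemma sigma_torusSimplices_eq (Y : WLattice P) {p q : Σ n, torusSimplices b Y n} {x : Y.Torus}
    (hp : x ∈ p.2.1 '' stdInterior p.1) (hq : x ∈ q.2.1 '' stdInterior q.1) : p = q := by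
  obtain ⟨d, _, σ, hσ, rfl⟩ := p
  obtain ⟨d', _, σ', hσ', rfl⟩ := q
  obtain ⟨t, ht, rfl⟩ := hp
  obtain ⟨t', ht', h⟩ := hq
  obtain ⟨g, hg, -, h'⟩ := exists_translation_of_mk_eq Y (p := ⟨d, σ, hσ⟩) (q := ⟨d', σ', hσ'⟩)
    ht ht' h.symm
  cases h'
  congr 2
  exact funext fun s => (torus_mk_translation Y hg _).symm

variable (b) in
/-- The cell structure on the torus `V* / Y` by the images of the cells of `V*`. -/
def torusCellStructure (Y : WLattice P) : EquivariantDeltaComplex (weyl P) Y.Torus where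
  simplices := torusSimplices b Y
  continuous_of_mem := by
    rintro n _ ⟨σ, hσ, rfl⟩
    exact continuous_quot_mk.comp (continuous_of_mem_alcoveSimplices hσ)
  face_mem := by
    rintro m n _ ⟨σ, hσ, rfl⟩ f
    exact ⟨_, (cellStructure b Y).face_mem m n σ hσ f, rfl⟩
  injOn := by
    rintro n _ ⟨σ, hσ, rfl⟩ t ht t' ht' h
    obtain ⟨g, hg, h1, h2⟩ := exists_translation_of_mk_eq Y (p := ⟨n, σ, hσ⟩) (q := ⟨n, σ, hσ⟩)
      ht ht' h
    have h3 : (fun s => g (σ s)) = σ := by simpa using h2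
    exact (cellStructure b Y).injOn n σ hσ ht ht' ((congrFun h3 t).symm.trans h1)
  existsUnique_mem x := by
    obtain ⟨x, rfl⟩ := QuotientAddGroup.mk_surjective x
    obtain ⟨p, ⟨t, ht, rfl⟩, -⟩ := (cellStructure b Y).existsUnique_mem x
    exact ⟨⟨p.1, _, p.2.1, p.2.2, rfl⟩, ⟨t, ht, rfl⟩,
      fun q hq => sigma_torusSimplices_eq Y hq ⟨t, ht, rfl⟩⟩
  isOpen_of_preimage A hA := by
    refine isOpen_coinduced.2 ?_
    exact (cellStructure b Y).isOpen_of_preimage _ fun n σ hσ => hA n _ ⟨σ, hσ, rfl⟩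
  smul_mem := by
    rintro w n _ ⟨σ, hσ, rfl⟩
    exact ⟨_, smul_mem_alcoveSimplices (Y := Y) ((le_sup_right : weyl P ≤ Y.extWeyl) w.2) hσ, rfl⟩
  fixes := by
    rintro w n _ ⟨σ, hσ, rfl⟩ h _ ⟨t, ht, rfl⟩
    obtain ⟨t', ht', h1⟩ := h.subset ⟨_, ⟨t, ht, rfl⟩, rfl⟩
    obtain ⟨g, hg, -, h2⟩ := exists_translation_of_mk_eq Y
      (p := ⟨n, _, smul_mem_alcoveSimplices (Y := Y)
        ((le_sup_right : weyl P ≤ Y.extWeyl) w.2) hσ⟩) (q := ⟨n, σ, hσ⟩) ht ht' h1.symm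
    have h3 : (fun s => g (w.1 (σ s))) = σ := by simpa using h2
    change (QuotientAddGroup.mk (w.1 (σ t)) : Y.Torus) = QuotientAddGroup.mk (σ t)
    exact (torus_mk_translation Y hg _).symm.trans (congrArg _ (congrFun h3 t))

end Torus

/-! ### Deflation of the cellular complex -/

section Coinvariants

variable {G C D : Type*} [Group G] [MulAction G C] {S : Subgroup G} {p : C → D}

lemma linComb_comp_ofMulAction (h : ∀ c c', p c = p c' ↔ ∃ s ∈ S, s • c = c') (s : S) :
    (linComb fun c => MonoidAlgebra.single (p c) (1 : ℤ)) ∘ₗ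
      ((Representation.ofMulAction ℤ G C).comp S.subtype) s =
        linComb fun c => MonoidAlgebra.single (p c) (1 : ℤ) :=
  linearMap_ext_single fun c => by
    rw [LinearMap.comp_apply, MonoidHom.comp_apply, Representation.ofMulAction_single,
      linComb_single, linComb_single]
    exact congrArg (MonoidAlgebra.single · 1) ((h _ _).2 ⟨_, s.2, rfl⟩).symm

/-- If `p : C → D` is the quotient map by the action of `S`, then the coinvariants of `S` in the
permutation module `ℤ[C]` are `ℤ[D]`. -/
def coinvariantsEquiv (hp : Function.Surjective p)
    (h : ∀ c c', p c = p c' ↔ ∃ s ∈ S, s • c = c') :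
    Representation.Coinvariants ((Representation.ofMulAction ℤ G C).comp S.subtype) ≃ₗ[ℤ] ℤ[D] :=
  LinearEquiv.ofLinearMap
    (Representation.Coinvariants.lift _ (linComb fun c => MonoidAlgebra.single (p c) 1)
      (linComb_comp_ofMulAction h))
    (linComb fun d => Representation.Coinvariants.mk _
      (MonoidAlgebra.single (Function.surjInv hp d) 1))
    (linearMap_ext_single fun d => by
      change Representation.Coinvariants.lift _ _ (linComb_comp_ofMulAction h) (linComb _ _) =
        MonoidAlgebra.single d 1
      rw [linComb_single, Representation.Coinvariants.lift_mk, linComb_single,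
        Function.surjInv_eq hp])
    (Representation.Coinvariants.hom_ext <| linearMap_ext_single fun c => by
      change linComb _ (linComb _ (MonoidAlgebra.single c 1)) =
        Representation.Coinvariants.mk _ (MonoidAlgebra.single c 1)
      rw [linComb_single, linComb_single]
      obtain ⟨s, hs, h'⟩ := (h _ _).1 (Function.surjInv_eq hp (p c)).symm
      rw [← h']
      have := Representation.Coinvariants.mk_self_apply
        ((Representation.ofMulAction ℤ G C).comp S.subtype) ⟨s, hs⟩ (MonoidAlgebra.single c 1)
      rw [MonoidHom.comp_apply, Representation.ofMulAction_single] at this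
      exact this)

end Coinvariants

section Deflation

variable {ι M N : Type*} [AddCommGroup M] [Module ℝ M] [AddCommGroup N] [Module ℝ N]
  {P : RootPairing ι ℝ M N} {b : P.Base}
  [Nonempty ι] [Finite ι] [P.IsCrystallographic] [P.IsReduced] [P.IsIrreducible]
  [TopologicalSpace N] [IsTopologicalAddGroup N] [ContinuousSMul ℝ N] [T2Space N]
  (Y : WLattice P)

/-- The image in the torus of a cell of `V*`. -/
def torusCell {d : ℕ} (σ : (cellStructure b Y).Cell d) : (torusCellStructure b Y).Cell d :=
  ⟨fun x => QuotientAddGroup.mk (σ.1 x), σ.1, σ.2, rfl⟩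

lemma torusCell_surjective {d : ℕ} : Function.Surjective (torusCell (b := b) Y (d := d)) := by
  rintro ⟨_, σ, hσ, rfl⟩
  exact ⟨⟨σ, hσ⟩, rfl⟩

lemma torusCell_eq_iff {d : ℕ} (σ σ' : (cellStructure b Y).Cell d) :
    torusCell Y σ = torusCell Y σ' ↔ ∃ y ∈ Y.translationsIn, y • σ = σ' := by
  constructor
  · intro h
    obtain ⟨t, ht⟩ := stdInterior_nonempty d
    obtain ⟨g, hg, -, h'⟩ := exists_translation_of_mk_eq Y (p := ⟨d, σ⟩) (q := ⟨d, σ'⟩) ht ht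
      (congrFun (congrArg Subtype.val h) t)
    refine ⟨⟨g, (le_sup_left : Y.translations ≤ Y.extWeyl) hg⟩, hg, ?_⟩
    exact eq_of_heq (Sigma.mk.inj h').2
  · rintro ⟨y, hy, rfl⟩
    exact Subtype.ext (funext fun t => (torus_mk_translation Y hy _).symm)

/-- The coinvariants of the translations in the cellular chains of `V*` are the cellular chains of
the torus. -/
def deflationEquiv (d : ℕ) :
    ((Y.deflation.obj (Rep.of ((cellStructure b Y).chainRep d))).ρ).Equiv
      ((torusCellStructure b Y).chainRep d) :=
  .mk (coinvariantsEquiv (torusCell_surjective Y) (torusCell_eq_iff Y)) fun w => by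
    refine Representation.Coinvariants.hom_ext (linearMap_ext_single fun σ => ?_)
    have hw : w.1 ∈ Y.extWeyl := (le_sup_right : weyl P ≤ Y.extWeyl) w.2
    change linComb (fun σ => MonoidAlgebra.single (torusCell Y σ) 1)
        ((cellStructure b Y).chainRep d ⟨w.1, hw⟩ (MonoidAlgebra.single σ 1)) =
      (torusCellStructure b Y).chainRep d w
        (linComb (fun σ => MonoidAlgebra.single (torusCell Y σ) 1) (MonoidAlgebra.single σ 1))
    rw [Representation.ofMulAction_single, linComb_single, linComb_single,
      Representation.ofMulAction_single]
    rfl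

lemma deflationEquiv_mk {d : ℕ} (x : ℤ[(cellStructure b Y).Cell d]) :
    deflationEquiv Y d (Representation.Coinvariants.mk _ x) =
      linComb (fun σ => MonoidAlgebra.single (torusCell Y σ) 1) x := rfl

/-- The map on chains induced by `V* → V* / Y` commutes with the boundary. -/
lemma boundary_linComb_torusCell {d : ℕ} (σ : (cellStructure b Y).Cell (d + 1)) :
    (torusCellStructure b Y).boundary d (linComb
      (fun σ => MonoidAlgebra.single (torusCell Y σ) 1) (MonoidAlgebra.single σ 1)) =
        linComb (fun σ => MonoidAlgebra.single (torusCell Y σ) 1)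
          ((cellStructure b Y).boundary d (MonoidAlgebra.single σ 1)) := by
  simp only [linComb_single, EquivariantDeltaComplex.boundary_single, map_sum, map_zsmul]
  rfl

variable (b) in
/-- The deflation of the cellular complex of `V*` is the cellular complex of the torus. -/
def deflationIso :
    (Y.deflation.mapHomologicalComplex (ComplexShape.down ℕ)).obj
      (cellStructure b Y).cellularComplex ≅ (torusCellStructure b Y).cellularComplex :=
  HomologicalComplex.Hom.isoOfComponents
    (fun d => (Rep.mkIso (deflationEquiv Y d) :
      Y.deflation.obj (Rep.of ((cellStructure b Y).chainRep d)) ≅ _)) (by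
    rintro _ d rfl
    refine Rep.hom_ext (Representation.IntertwiningMap.ext ?_)
    refine Representation.Coinvariants.hom_ext (linearMap_ext_single fun σ => ?_)
    change ((torusCellStructure b Y).cellularComplex.d (d + 1) d).hom
        (deflationEquiv Y (d + 1) (Representation.Coinvariants.mk _ (MonoidAlgebra.single σ 1))) =
      deflationEquiv Y d (Representation.Coinvariants.mk _
        (((cellStructure b Y).cellularComplex.d (d + 1) d).hom (MonoidAlgebra.single σ 1)))
    rw [deflationEquiv_mk, EquivariantDeltaComplex.cellularComplex_d_apply,
      EquivariantDeltaComplex.cellularComplex_d_apply]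
    exact boundary_linComb_torusCell Y σ)

lemma deflationIso_mk_single {d : ℕ} (σ : (cellStructure b Y).Cell d) :
    ((deflationIso b Y).hom.f d).hom
      (Representation.Coinvariants.mk _ (MonoidAlgebra.single σ 1)) =
        MonoidAlgebra.single (torusCell Y σ) 1 :=
  linComb_single _ σ

end Deflation

end Alcove

end

theorem mainTheorem4 {ι M N : Type*} [Finite ι] [Nonempty ι]
    [AddCommGroup M] [Module ℝ M] [AddCommGroup N] [Module ℝ N]
    [TopologicalSpace N] [IsTopologicalAddGroup N] [ContinuousSMul ℝ N] [T2Space N]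
    (P : RootPairing ι ℝ M N) [P.IsCrystallographic] [P.IsReduced] [P.IsIrreducible]
    (b : P.Base) [∀ d, LinearOrder (Alcove.Flag b d)] (Y : Alcove.WLattice P) :
    -- the highest root, and the closed fundamental alcove as the simplex with vertices `v_i`
    Alcove.IsHighestRoot b (Alcove.highestRoot b) ∧
    AffineIndependent ℝ (Alcove.alcoveVertex b) ∧
    closure (Alcove.alcove b) = convexHull ℝ (Set.range (Alcove.alcoveVertex b)) ∧
    -- the translates of the simplices of its barycentric subdivision triangulate `V*`
    (∃ T : Geometry.SimplicialComplex ℝ N, T.space = Set.univ ∧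
      T.faces = {s : Finset N | ∃ w ∈ Alcove.affineWeyl b, ∃ (d : ℕ) (Z : Alcove.Flag b d),
        (s : Set N) = Set.range fun i => w (Alcove.barycenter b (Z.set i))}) ∧
    -- `Ω_Y` acts on the vertices of the alcove, and the chosen flags represent its orbits
    (∀ ω ∈ Y.alcoveGroup b, ∃ π : Equiv.Perm (Alcove.Node b), ∀ i,
      ω (Alcove.alcoveVertex b i) = Alcove.alcoveVertex b (π i)) ∧
    (∀ (d : ℕ) (Z : Alcove.Flag b d),
      ∃! R : Y.OrbitRep b d, ∃ ω ∈ Y.alcoveGroup b, R.1.Moves ω Z) ∧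
    -- the stabilizers
    Alcove.affineWeyl b ≤ Y.extWeyl ∧
    (∀ (d : ℕ) (Z : Y.OrbitRep b d), Alcove.IsInternalSemidirectProduct
      (Alcove.parabolic b {i | i ∉ Z.1.set (Fin.last d)})
      (⨅ j, Y.vertexSetStabilizer (Z.1.set j))
      (Y.cellStabilizer Z.1)) ∧
    -- the triangulation of `V*` is `W_Y`-equivariant
    ∃ K : Alcove.EquivariantDeltaComplex Y.extWeyl N,
      (∀ d, K.simplices d = Alcove.alcoveSimplices b d) ∧
      -- the cellular complex
      (∃ θ : ∀ d, (Y.orbitRep b d).Equiv (K.chainRep d),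
        (∀ (d : ℕ) (Z : Y.OrbitRep b d) (g : Y.extWeyl) (σ : K.Cell d),
          σ.1 = (fun x => g.1 (Z.1.param x)) →
            θ d (Y.gen Z g) = MonoidAlgebra.single σ 1) ∧
        (∀ (d : ℕ) (Z : Y.OrbitRep b (d + 1)) (R : Fin (d + 2) → Y.OrbitRep b d)
          (ω : Fin (d + 2) → Y.alcoveGroup b), (∀ p, (R p).1.Moves (ω p).1 (Z.1.face p)) →
            (K.cellularComplex.d (d + 1) d).hom (θ (d + 1) (Y.gen Z 1)) =
              ∑ p : Fin (d + 2), (-1 : ℤ) ^ (p : ℕ) •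
                θ d (Y.gen (R p) (Subgroup.inclusion inf_le_left (ω p))))) ∧
      -- the dual complex and its cup product
      Alcove.IsEquivariantDGAlgebra K.cochainRep K.coboundary K.cup K.unit ∧
      (∀ (p q : ℕ) (Z : Y.OrbitRep b p) (Z' : Y.OrbitRep b q) (σ : K.Cell p) (σ' : K.Cell q),
        σ.1 = Z.1.param → σ'.1 = Z'.1.param →
          (Z.1.set (Fin.last p) ≠ Z'.1.set 0 → K.cup rfl (K.dualCell σ) (K.dualCell σ') = 0) ∧
          ∀ (h : Z.1.set (Fin.last p) = Z'.1.set 0) (R : Y.OrbitRep b (p + q)),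
            ∀ ω ∈ Y.alcoveGroup b, R.1.Moves ω (Z.1.append Z'.1 h) →
              ∀ τ : K.Cell (p + q), τ.1 = (fun x => ω (R.1.param x)) →
                K.cup rfl (K.dualCell σ) (K.dualCell σ') = K.dualCell τ) ∧
      -- the torus
      T2Space Y.Torus ∧ Function.Bijective Y.weylToQuotient ∧
      ∃ L : Alcove.EquivariantDeltaComplex (Alcove.weyl P) Y.Torus,
        (∀ d, L.simplices d =
          {τ | ∃ σ ∈ K.simplices d, τ = fun x => QuotientAddGroup.mk (σ x)}) ∧
        ∃ φ : (Y.deflation.mapHomologicalComplex (ComplexShape.down ℕ)).obj K.cellularComplex ≅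
            L.cellularComplex,
          ∀ (d : ℕ) (σ : K.Cell d) (τ : L.Cell d),
            τ.1 = (fun x => (QuotientAddGroup.mk (σ.1 x) : Y.Torus)) →
              (φ.hom.f d).hom (Representation.Coinvariants.mk _ (MonoidAlgebra.single σ 1)) =
                MonoidAlgebra.single τ 1
 := by
  refine ⟨Alcove.isHighestRoot_highestRoot b, Alcove.affineIndependent_alcoveVertex b,
    (Alcove.closure_alcove b).trans (Alcove.closedAlcove_eq_convexHull b),
    ⟨Alcove.alcoveComplex b, Alcove.alcoveComplex_space b, rfl⟩,
    fun ω hω => Alcove.exists_perm_vertex hω, fun d Z => Alcove.existsUnique_orbitRep Y Z,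
    Alcove.affineWeyl_le_extWeyl Y,
    fun d Z => Alcove.isInternalSemidirectProduct_cellStabilizer Y Z.1,
    Alcove.cellStructure b Y, fun _ => rfl,
    ⟨fun d => Alcove.chainEquiv b Y d, fun d Z g σ hσ => ?_, fun d Z R ω hR => ?_⟩,
    Alcove.EquivariantDeltaComplex.isEquivariantDGAlgebra _,
    fun p q Z Z' σ σ' hσ hσ' => ?_,
    Alcove.t2Space_torus b Y, Alcove.weylToQuotient_bijective Y,
    Alcove.torusCellStructure b Y, fun _ => rfl, Alcove.deflationIso b Y, fun d σ τ hτ => ?_⟩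
  · obtain rfl : σ = g • Alcove.cellOf Y Z.1 := Subtype.ext hσ
    exact Alcove.chainEquiv_gen Y Z g
  · rw [Alcove.EquivariantDeltaComplex.cellularComplex_d_apply]
    exact Alcove.boundary_chainEquiv_gen Y d Z R ω hR
  · obtain rfl : σ = Alcove.cellOf Y Z.1 := Subtype.ext hσ
    obtain rfl : σ' = Alcove.cellOf Y Z'.1 := Subtype.ext hσ'
    refine ⟨Alcove.cup_dualCell_cellOf_eq_zero Y, fun h R ω hω hR τ hτ => ?_⟩
    rw [Alcove.cup_dualCell_cellOf_eq Y h]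
    congr 1
    exact Subtype.ext ((funext fun t => hR.apply_param hω t).symm.trans hτ.symm)
  · obtain rfl : τ = Alcove.torusCell Y σ := Subtype.ext hτ
    exact Alcove.deflationIso_mk_single Y σ
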